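/- For an integer matrix $Q\in M_n(\mathbb Z)$, regarded as the quadratic form $Q(\mathbf x)=\mathbf x^{t}Q\mathbf x$, put $\Delta_Q=\det(Q^t+Q)$, $\mathcal H_Q=(-1)^{n/2}\det(Q^t+Q)$ if $n$ is even and $\mathcal H_Q=0$ if $n$ is odd; for $q\ge1$ put $$S_Q(q)=\frac1q\sum_{a\in(\mathbb Z/q)^*}\ \sum_{\mathbf h\in(\mathbb Z/q)^n}e^{2\pi i aQ(\mathbf h)/q},\qquad L(s,Q)=\sum_{q\ge1}\frac{S_Q(q)}{q^s},$$ $$f(s,Q)=\prod_{p\mid 2\Delta_Q}\left\{\frac{1-p^{n-2s}}{1-p^{n-2s-1}}\Bigl(1+\sum_{m\ge1}\frac{S_Q(p^m)}{p^{ms}}\Bigr)\right\}.$$ For $\ell\ge1$ let $Q_{FT}=k_1k_2+k_3k_4+\dots+k_{2\ell-1}k_{2\ell}$ (in $n=2\ell$ variables) and $Q_{FM}=k_0^2+k_1k_2+\dots+k_{2\ell-1}k_{2\ell}$ (in $n=2\ell+1$ variables), each given by the matrix whose only nonzero entries are a $1$ for each of its monomials. Let $\tau$ be the number-of-divisors function,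 $\zeta$ the Riemann zeta function and $\gamma$ Euler's constant. Then: (a) For every $\ell\ge1$: $\Delta_{Q_{FT}}=(-1)^\ell$, $\mathcal H_{Q_{FT}}=1$, $\Delta_{Q_{FM}}=2(-1)^\ell$, $\mathcal H_{Q_{FM}}=0$; and for every $m\ge1$, $S_{Q_{FT}}(2^m)=2^{m\ell-1}$, while $S_{Q_{FM}}(2^m)=0$ if $m$ is odd and $S_{Q_{FM}}(2^m)=2^{(2\ell+1)m/2-1}$ if $m$ is even. (b) For every $\ell\ge1$ and every complex $s$ with $\operatorname{Re}s>\ell+1$, $$f(s,Q_{FT})=1+\frac{2^{\ell-s-1}}{1-2^{2\ell-1-2s}},\qquad f(s,Q_{FM})=1,$$ and the series $L(s,Q_{FT})$, $L(s,Q_{FM})$ converge absolutely, with $$L(s,Q_{FT})=\frac{\zeta(s-\ell)}{\zeta(s+1-\ell)},\qquad L(s,Q_{FM})=\frac{\zeta(2s-2\ell-1)}{\zeta(2s-2\ell)}.$$ (c) For every $\varepsilon>0$ and all real $X\ge3$, the $x_i$ running over integers, $$\sum_{1\le x_1,x_2,x_3,x_4\le X}\tau(x_1x_2+x_3x_4)=\frac{2\zeta(2)}{\zeta(3)}X^4\log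 X+c\,X^4+O_\varepsilon\bigl(X^{4-\frac13+\varepsilon}\bigr),$$ $$c=\frac{2\zeta(2)}{\zeta(3)}\left(\gamma+\frac{\pi^2}{48}-\frac{11}{8}+\log2+\frac{\zeta'(2)}{\zeta(2)}-\frac{\zeta'(3)}{\zeta(3)}\right).$$ (d) For every $\varepsilon>0$ and all real $X\ge3$, the $x_i$ running over integers, $$\sum_{1\le x_0,x_1,x_2\le X}\tau(x_0^2+x_1x_2)=\frac{2\zeta(3)}{\zeta(4)}X^3\log X+c'X^3+O_\varepsilon\bigl(X^{3-\frac15+\varepsilon}\bigr),$$ $$c'=\frac{4\zeta(3)}{\zeta(4)}\left(\frac{\gamma}{2}+\frac{\pi^2+8\pi-104+56\log2}{144}+\frac{\zeta'(3)}{\zeta(3)}-\frac{\zeta'(4)}{\zeta(4)}\right).$$ -/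

import Mathlib

/-- The value `xᵗ Q x` of the integral quadratic form with (not necessarily symmetric) matrix `Q`. -/
def quadForm {ι : Type} [Fintype ι] (Q : Matrix ι ι ℤ) (x : ι → ℤ) : ℤ :=
  ∑ i, ∑ j, x i * Q i j * x j

/-- The first discriminant `det (Qᵗ + Q)`. -/
def firstDisc {ι : Type} [Fintype ι] [DecidableEq ι] (Q : Matrix ι ι ℤ) : ℤ :=
  (Q.transpose + Q).det

/-- The second discriminant of a form in `n` variables: `0` for odd `n` and
`(-1)^(n/2) det (Qᵗ + Q)` for even `n`. -/
def secondDisc {ι : Type} [Fintype ι] [DecidableEq ι] (Q : Matrix ι ι ℤ) : ℤ :=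
  if Even (Fintype.card ι) then (-1) ^ (Fintype.card ι / 2) * (Q.transpose + Q).det else 0

/-- The complete exponential sum
`S_Q(q) = q⁻¹ ∑_{a ∈ (ℤ/q)^*} ∑_{h ∈ (ℤ/q)^n} exp(2 π i a Q(h) / q)`;
residues modulo `q` are represented by `0, …, q - 1`. -/
noncomputable def expSum {ι : Type} [Fintype ι] [DecidableEq ι] (Q : Matrix ι ι ℤ) (q : ℕ) : ℂ :=
  (q : ℂ)⁻¹ * ∑ a ∈ (Finset.range q).filter (fun a => Nat.Coprime a q), ∑ h : ι → Fin q,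
    Complex.exp (2 * Real.pi * Complex.I * (a : ℂ) *
      (quadForm Q (fun i => ((h i : ℕ) : ℤ)) : ℂ) / (q : ℂ))

/-- The product over the primes dividing `2 det (Qᵗ + Q)` of
`(1 - p^(n-2s)) / (1 - p^(n-2s-1)) * (1 + ∑_{m ≥ 1} S_Q(p^m) p^(-ms))`,
`n` being the number of variables. -/
noncomputable def badFactor {ι : Type} [Fintype ι] [DecidableEq ι] (Q : Matrix ι ι ℤ) (s : ℂ) : ℂ :=
  ∏ p ∈ (2 * firstDisc Q).natAbs.primeFactors,
    ((1 - (p : ℂ) ^ ((Fintype.card ι : ℂ) - 2 * s)) /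
        (1 - (p : ℂ) ^ ((Fintype.card ι : ℂ) - 2 * s - 1)) *
      (1 + ∑' m : ℕ, expSum Q (p ^ (m + 1)) / (p : ℂ) ^ (((m + 1 : ℕ) : ℂ) * s)))

/-- The matrix of `Q_FT = k₁ k₂ + k₃ k₄ + ⋯ + k_{2ℓ-1} k_{2ℓ}`; the variables with odd index form
the first block, those with even index the second. -/
def QFT (l : ℕ) : Matrix (Fin l ⊕ Fin l) (Fin l ⊕ Fin l) ℤ :=
  Matrix.fromBlocks 0 1 0 0

/-- The matrix of `Q_FM = k₀² + k₁ k₂ + k₃ k₄ + ⋯ + k_{2ℓ-1} k_{2ℓ}`. -/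
def QFM (l : ℕ) : Matrix (Unit ⊕ (Fin l ⊕ Fin l)) (Unit ⊕ (Fin l ⊕ Fin l)) ℤ :=
  Matrix.fromBlocks 1 0 0 (QFT l)

theorem quadForm_QFT (l : ℕ) (x : Fin l ⊕ Fin l → ℤ) :
    quadForm (QFT l) x = ∑ i, x (Sum.inl i) * x (Sum.inr i) := by
  simp [quadForm, QFT, Matrix.one_apply]

theorem quadForm_QFM (l : ℕ) (x : Unit ⊕ (Fin l ⊕ Fin l) → ℤ) :
    quadForm (QFM l) x =
      x (Sum.inl ()) ^ 2 + ∑ i, x (Sum.inr (Sum.inl i)) * x (Sum.inr (Sum.inr i)) := by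
  simp [quadForm, QFM, QFT, Matrix.one_apply, sq]

/-- `∑ τ(x₁ x₂ + x₃ x₄)` over the integers `1 ≤ x₁, x₂, x₃, x₄ ≤ X`. -/
noncomputable def tauSumFT (X : ℝ) : ℕ :=
  ∑ x₁ ∈ Finset.Icc 1 ⌊X⌋₊, ∑ x₂ ∈ Finset.Icc 1 ⌊X⌋₊,
    ∑ x₃ ∈ Finset.Icc 1 ⌊X⌋₊, ∑ x₄ ∈ Finset.Icc 1 ⌊X⌋₊,
      (Nat.divisors (x₁ * x₂ + x₃ * x₄)).card

/-- `∑ τ(x₀² + x₁ x₂)` over the integers `1 ≤ x₀, x₁, x₂ ≤ X`. -/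
noncomputable def tauSumFM (X : ℝ) : ℕ :=
  ∑ x₀ ∈ Finset.Icc 1 ⌊X⌋₊, ∑ x₁ ∈ Finset.Icc 1 ⌊X⌋₊, ∑ x₂ ∈ Finset.Icc 1 ⌊X⌋₊,
    (Nat.divisors (x₀ ^ 2 + x₁ * x₂)).card

/-- The coefficient of `X⁴` in the asymptotics of `tauSumFT`. -/
noncomputable def constFT : ℂ :=
  2 * riemannZeta 2 / riemannZeta 3 *
    (Real.eulerMascheroniConstant + (Real.pi : ℂ) ^ 2 / 48 - 11 / 8 + (Real.log 2 : ℝ)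
      + deriv riemannZeta 2 / riemannZeta 2 - deriv riemannZeta 3 / riemannZeta 3)

/-- The coefficient of `X³` in the asymptotics of `tauSumFM`. -/
noncomputable def constFM : ℂ :=
  4 * riemannZeta 3 / riemannZeta 4 *
    (Real.eulerMascheroniConstant / 2
      + ((Real.pi : ℂ) ^ 2 + 8 * Real.pi - 104 + 56 * (Real.log 2 : ℝ)) / 144
      + deriv riemannZeta 3 / riemannZeta 3 - deriv riemannZeta 4 / riemannZeta 4)

/-! Divisor sums. Both forms are `n = P a x + b t`, with `P a x = a x` and `a ≤ N`, or with `P a x =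
x²` and a single `a`. Pairing `d` with `n / d` expresses `τ(n)` through the divisors with `d² ≤ n`
and those with `d² < n`; since `n ≤ 2 N²`, only `d ≤ 2 N` occur. For fixed `d, a, x, b` the
condition `d² ≤ n` confines `t` to a final segment of `[1, N]`, and additive characters modulo `d`
detect `d ∣ n`. The frequencies `h` with `d ∣ h b` produce the expected count. For the others the
sum over `t` is at most `1 / |sin (π h b / d)|`, and summing this over `b` gives at most `(N + d) (1
+ log d)`, uniformly in `h`. Cauchy-Schwarz in the remaining variables then leaves the number of
coincidences `P a x ≡ P a y` modulo `d` (`abs_sum_strips_le`).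

The segment of `t` depends on `x`, so `x` is cut into blocks of length `K` on which the threshold is
frozen; monotonicity encloses the true count between two frozen ones (`abs_hitSum_sub_densSum_le`).
Summed over `d`, and up to logarithms, the blocks cost `#A N³ / √K` and the freezing costs `#A N²
K`. The choice `K ≈ N^(2/3)` balances them at `#A N^(2+2/3)` (`sum_abs_hitSum_sub_le`): the exponent
is `4 - 1/3` for the first form, and `3 - 1/3` for the second, which is stronger than needed.

Main terms. The solutions modulo `d` have density `d⁻¹ ∑ φ(r) / r²` over `r ^ k ∣ d`, with `k = 1`
or `2`. Its sum over `d ≤ √n` is `L (½ log n + γ) - M`, where `L` and `M` are values of the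
Dirichlet series of `φ` and of its derivative, hence given by `ζ` and `ζ'`. There remains the sum of
`log n` over the cube `[1, N]^j`. Its increment in `N` is a sum over faces, evaluated by Riemann
sums of elementary functions; `π²` enters through the integral of `log (1 + u) / u`.

Exponential sums. `Q_FT` is linear in half of its variables, so `S(q) = φ(q) q^(ℓ-1)`. For `Q_FM`
the Gauss sums modulo `q` are needed only in total over all units; summing over all residues instead
counts the solutions of `k² ≡ 0`, and inversion over divisors gives `φ(r) r^(2ℓ)` at `q = r²` and
`0` elsewhere (`gaussSumTotal_eq`). Both L-series are therefore shifts of the Dirichlet series of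
`φ`. -/

namespace QuadDivisor

open Finset

/-! ### Additive characters modulo `d` and sums of `1 / |sin|` -/

/-- The additive character `m ↦ exp (2 π i m / d)`. -/
noncomputable def expZ (d : ℕ) (m : ℤ) : ℂ :=
  Complex.exp (2 * Real.pi * Complex.I * m / d)

lemma expZ_zero (d : ℕ) : expZ d 0 = 1 := by simp [expZ]

lemma expZ_add (d : ℕ) (m n : ℤ) : expZ d (m + n) = expZ d m * expZ d n := by
  rw [expZ, expZ, expZ, ← Complex.exp_add]
  congr 1
  push_cast
  ring

lemma expZ_nat_mul (d h : ℕ) (m : ℤ) : expZ d (h * m) = expZ d m ^ h := by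
  rw [expZ, expZ, ← Complex.exp_nat_mul]
  congr 1
  push_cast
  ring

lemma expZ_eq (d : ℕ) (m : ℤ) :
    expZ d m = Complex.exp (Complex.I * ((2 * (Real.pi * m / d) : ℝ) : ℂ)) := by
  rw [expZ]
  congr 1
  push_cast
  ring

lemma norm_expZ (d : ℕ) (m : ℤ) : ‖expZ d m‖ = 1 := by
  rw [expZ_eq, Complex.norm_exp_I_mul_ofReal]

lemma conj_expZ (d : ℕ) (m : ℤ) : (starRingEnd ℂ) (expZ d m) = expZ d (-m) := by
  rw [expZ, expZ, ← Complex.exp_conj]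
  congr 1
  have h2 : (starRingEnd ℂ) 2 = 2 := map_ofNat _ 2
  simp [h2]

lemma norm_expZ_sub_one (d : ℕ) (m : ℤ) :
    ‖expZ d m - 1‖ = 2 * |Real.sin (Real.pi * m / d)| := by
  rw [expZ_eq, Complex.norm_exp_I_mul_ofReal_sub_one, Real.norm_eq_abs, abs_mul, abs_two,
    mul_div_cancel_left₀ _ (two_ne_zero' ℝ)]

lemma expZ_eq_one_iff {d : ℕ} (hd : d ≠ 0) (m : ℤ) : expZ d m = 1 ↔ (d : ℤ) ∣ m := by
  have hd' : (d : ℂ) ≠ 0 := by exact_mod_cast hd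
  have hpi : (Real.pi : ℂ) ≠ 0 := by exact_mod_cast Real.pi_ne_zero
  rw [expZ, Complex.exp_eq_one_iff]
  constructor
  · rintro ⟨n, hn⟩
    refine ⟨n, ?_⟩
    have h1 : (m : ℂ) = d * n := by
      have h2 : (2 * Real.pi * Complex.I) * (m : ℂ) = (2 * Real.pi * Complex.I) * (d * n) := by
        rw [div_eq_iff hd'] at hn
        rw [hn]; ring
      exact mul_left_cancel₀ Complex.two_pi_I_ne_zero h2
    exact_mod_cast h1
  · rintro ⟨n, rfl⟩
    refine ⟨n, ?_⟩
    push_cast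
    field_simp

lemma sum_expZ {d : ℕ} (hd : d ≠ 0) (m : ℤ) :
    ∑ h ∈ range d, expZ d (h * m) = if (d : ℤ) ∣ m then (d : ℂ) else 0 := by
  simp_rw [expZ_nat_mul]
  split_ifs with h
  · rw [(expZ_eq_one_iff hd m).2 h]; simp
  · have h1 : expZ d m ≠ 1 := fun h' => h ((expZ_eq_one_iff hd m).1 h')
    rw [geom_sum_eq h1, ← expZ_nat_mul, (expZ_eq_one_iff hd _).2 (dvd_mul_right _ _)]
    simp

/-- In the closed form of the geometric sum the numerator is at most `2` and the denominator is `2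
|sin|`. The bound does not see the endpoints, so a cut-off in `t` costs nothing. -/
lemma norm_sum_Ico_expZ_le {d : ℕ} (hd : d ≠ 0) {m : ℤ} (hm : ¬ (d : ℤ) ∣ m) {α β : ℕ}
    (hab : α ≤ β) :
    ‖∑ t ∈ Ico α β, expZ d (t * m)‖ ≤ 1 / |Real.sin (Real.pi * m / d)| := by
  have h1 : expZ d m ≠ 1 := fun h' => hm ((expZ_eq_one_iff hd m).1 h')
  have h2 : 0 < ‖expZ d m - 1‖ := norm_pos_iff.2 (sub_ne_zero.2 h1)
  simp_rw [expZ_nat_mul]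
  rw [geom_sum_Ico h1 hab, norm_div]
  have h3 : ‖expZ d m ^ β - expZ d m ^ α‖ ≤ 2 := by
    refine (norm_sub_le _ _).trans ?_
    rw [norm_pow, norm_pow, norm_expZ]
    norm_num
  rw [norm_expZ_sub_one] at h2 ⊢
  rw [div_le_div_iff₀ h2 (by linarith)]
  nlinarith

/-- An upward closed condition cuts out a final segment. The value `α = N + 1` covers the empty
case, so that `α ≤ N + 1` always holds. -/
lemma exists_filter_Icc_eq_Ico {p : ℕ → Prop} [DecidablePred p]
    (hp : ∀ t t', t ≤ t' → p t → p t') (N : ℕ) :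
    ∃ α, α ≤ N + 1 ∧ (Icc 1 N).filter p = Ico α (N + 1) := by
  by_cases h : ∃ t, 1 ≤ t ∧ p t
  · classical
    refine ⟨min (Nat.find h) (N + 1), min_le_right _ _, ?_⟩
    ext t
    simp only [mem_filter, mem_Icc, mem_Ico]
    constructor
    · rintro ⟨⟨h1, h2⟩, h3⟩
      have := Nat.find_min' h ⟨h1, h3⟩
      omega
    · rintro ⟨h1, h2⟩
      have h3 : Nat.find h ≤ t := by omega
      have h4 := Nat.find_spec h
      exact ⟨⟨h4.1.trans h3, by omega⟩, hp _ _ h3 h4.2⟩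
  · refine ⟨N + 1, le_rfl, ?_⟩
    ext t
    simp only [mem_filter, mem_Icc, mem_Ico]
    push Not at h
    constructor
    · rintro ⟨⟨h1, h2⟩, h3⟩
      exact absurd h3 (h t h1)
    · rintro ⟨h1, h2⟩
      omega

lemma sum_inv_le_one_add_log (n : ℕ) : ∑ k ∈ Icc 1 n, (1 / (k : ℝ)) ≤ 1 + Real.log n := by
  have h := harmonic_le_one_add_log n
  rw [harmonic_eq_sum_Icc] at h
  simpa using h

/-- Jordan's inequality `sin y ≥ 2 y / π` on `[0, π/2]` is applied to `k` or to its reflection `q -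
k`. Keeping both terms on the right avoids splitting the later sum over `k`. -/
lemma one_div_abs_sin_le {k q : ℕ} (hk : 0 < k) (hkq : k < q) :
    1 / |Real.sin (Real.pi * k / q)| ≤ (q : ℝ) / 2 * (1 / k + 1 / ((q - k : ℕ) : ℝ)) := by
  have hk' : (0 : ℝ) < k := by exact_mod_cast hk
  have hq' : (0 : ℝ) < q := by exact_mod_cast hk.trans hkq
  have hkq' : (0 : ℝ) < ((q - k : ℕ) : ℝ) := by exact_mod_cast Nat.sub_pos_of_lt hkq
  have hpi := Real.pi_pos
  have hcast : ((q - k : ℕ) : ℝ) = q - k := by push_cast [hkq.le]; ring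
  have key : ∀ y : ℝ, 0 < y → y ≤ q / 2 → 2 * y / q ≤ Real.sin (Real.pi * y / q) := by
    intro y hy hy2
    have h1 : Real.pi * y / q ≤ Real.pi / 2 := by
      rw [div_le_div_iff₀ hq' two_pos]
      nlinarith
    have := Real.mul_le_sin (x := Real.pi * y / q) (by positivity) h1
    calc 2 * y / q = 2 / Real.pi * (Real.pi * y / q) := by field_simp
      _ ≤ _ := this
  rcases le_total (k : ℝ) (q / 2) with h | h
  · have h1 := key k hk' h
    have h2 : 0 < 2 * (k : ℝ) / q := by positivity
    calc 1 / |Real.sin (Real.pi * k / q)| ≤ 1 / (2 * k / q) := by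
          apply one_div_le_one_div_of_le h2
          exact h1.trans (le_abs_self _)
      _ = (q : ℝ) / 2 * (1 / k) := by field_simp
      _ ≤ _ := by
          apply mul_le_mul_of_nonneg_left _ (by positivity)
          have : 0 < 1 / ((q - k : ℕ) : ℝ) := by positivity
          linarith
  · have h1 := key (q - k : ℕ) hkq' (by rw [hcast]; linarith)
    have h2 : 0 < 2 * ((q - k : ℕ) : ℝ) / q := by positivity
    have h3 : Real.sin (Real.pi * ((q - k : ℕ) : ℝ) / q) = Real.sin (Real.pi * k / q) := by
      rw [hcast, ← Real.sin_pi_sub]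
      congr 1
      field_simp
      ring
    rw [h3] at h1
    calc 1 / |Real.sin (Real.pi * k / q)| ≤ 1 / (2 * ((q - k : ℕ) : ℝ) / q) := by
          apply one_div_le_one_div_of_le h2
          exact h1.trans (le_abs_self _)
      _ = (q : ℝ) / 2 * (1 / ((q - k : ℕ) : ℝ)) := by field_simp
      _ ≤ _ := by
          apply mul_le_mul_of_nonneg_left _ (by positivity)
          have : 0 < 1 / (k : ℝ) := by positivity
          linarith

lemma sum_one_div_abs_sin_le {q : ℕ} (hq : 0 < q) :
    ∑ k ∈ Ico 1 q, 1 / |Real.sin (Real.pi * k / q)| ≤ q * (1 + Real.log q) := by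
  have h1 : ∑ k ∈ Ico 1 q, 1 / ((q - k : ℕ) : ℝ) = ∑ k ∈ Ico 1 q, 1 / (k : ℝ) := by
    refine sum_nbij' (fun k => q - k) (fun k => q - k) ?_ ?_ ?_ ?_ ?_
    all_goals intro k hk; simp only [mem_Ico] at hk ⊢
    all_goals omega
  calc ∑ k ∈ Ico 1 q, 1 / |Real.sin (Real.pi * k / q)|
      ≤ ∑ k ∈ Ico 1 q, (q : ℝ) / 2 * (1 / k + 1 / ((q - k : ℕ) : ℝ)) :=
        sum_le_sum fun k hk => one_div_abs_sin_le (by simp at hk; omega) (by simp at hk; omega)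
    _ = q * ∑ k ∈ Ico 1 q, 1 / (k : ℝ) := by
        rw [← mul_sum, sum_add_distrib, h1]; ring
    _ ≤ q * ∑ k ∈ Icc 1 q, 1 / (k : ℝ) := by
        apply mul_le_mul_of_nonneg_left _ (by positivity)
        apply sum_le_sum_of_subset_of_nonneg
        · intro k; simp; omega
        · intros; positivity
    _ ≤ _ := mul_le_mul_of_nonneg_left (sum_inv_le_one_add_log q) (by positivity)

lemma sum_range_mul_of_periodic {M : Type*} [AddCommMonoid M] {f : ℕ → M} {q : ℕ}
    (hf : ∀ n, f (n + q) = f n) (m : ℕ) :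
    ∑ b ∈ range (q * m), f b = m • ∑ b ∈ range q, f b := by
  have hf' : ∀ m n, f (q * m + n) = f n := by
    intro m
    induction m with
    | zero => simp
    | succ m ih =>
      intro n
      rw [show q * (m + 1) + n = (q * m + n) + q by ring, hf, ih]
  induction m with
  | zero => simp
  | succ m ih =>
    rw [Nat.mul_succ, sum_range_add, ih, succ_nsmul]
    congr 1
    exact sum_congr rfl fun n _ => hf' m n

lemma sum_range_unit_mul {M : Type*} [AddCommMonoid M] {q h : ℕ} (hq : 0 < q)
    (hh : Nat.Coprime h q) (F : ℕ → M) :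
    ∑ b ∈ range q, F (h * b % q) = ∑ c ∈ range q, F c := by
  have hinj : Set.InjOn (fun b => h * b % q) (range q : Finset ℕ) := by
    intro x hx y hy hxy
    simp only [coe_range, Set.mem_Iio] at hx hy
    have h1 : h * x ≡ h * y [MOD q] := hxy
    have h2 := Nat.ModEq.cancel_left_of_coprime (Nat.coprime_comm.1 hh) h1
    have h3 : x % q = y % q := h2
    rwa [Nat.mod_eq_of_lt hx, Nat.mod_eq_of_lt hy] at h3
  have himg : (range q).image (fun b => h * b % q) = range q := by
    apply eq_of_subset_of_card_le
    · intro c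
      simp only [mem_image, mem_range]
      rintro ⟨b, _, rfl⟩
      exact Nat.mod_lt _ hq
    · rw [card_image_of_injOn hinj]
  conv_rhs => rw [← himg]
  rw [sum_image hinj]

lemma abs_sin_nat_mod (q m : ℕ) (hq : 0 < q) :
    |Real.sin (Real.pi * m / q)| = |Real.sin (Real.pi * (m % q : ℕ) / q)| := by
  have h1 : (m : ℝ) = q * (m / q : ℕ) + (m % q : ℕ) := by exact_mod_cast (Nat.div_add_mod m q).symm
  have h2 : Real.pi * m / q = Real.pi * (m % q : ℕ) / q + (m / q : ℕ) * Real.pi := by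
    have : (q : ℝ) ≠ 0 := by positivity
    rw [h1]
    field_simp
    ring
  rw [h2, Real.sin_add_nat_mul_pi, abs_mul]
  simp

/-- Multiplication by the unit `h` permutes the residues modulo `q`, so each period contributes the
sum over `k = 1, …, q - 1`; `N / q + 1` periods cover `[1, N]`. -/
lemma sum_one_div_abs_sin_dilate_le {q h : ℕ} (hq : 0 < q) (hh : Nat.Coprime h q) (N : ℕ) :
    ∑ b ∈ (Icc 1 N).filter (fun b => ¬ q ∣ b), 1 / |Real.sin (Real.pi * (h * b : ℕ) / q)| ≤
      (N + q) * (1 + Real.log q) := by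
  set F : ℕ → ℝ := fun c => if c = 0 then 0 else 1 / |Real.sin (Real.pi * c / q)| with hF
  have hF0 : ∀ c, 0 ≤ F c := by
    intro c; simp only [hF]; split_ifs <;> positivity
  have h1 : ∑ b ∈ (Icc 1 N).filter (fun b => ¬ q ∣ b), 1 / |Real.sin (Real.pi * (h * b : ℕ) / q)| =
      ∑ b ∈ (Icc 1 N).filter (fun b => ¬ q ∣ b), F (h * b % q) := by
    refine sum_congr rfl fun b hb => ?_
    have h2 : h * b % q ≠ 0 := by
      intro h3
      exact (mem_filter.1 hb).2
        (Nat.Coprime.dvd_of_dvd_mul_left (Nat.coprime_comm.1 hh) (Nat.dvd_of_mod_eq_zero h3))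
    simp only [hF, if_neg h2]
    rw [abs_sin_nat_mod q _ hq]
  rw [h1]
  have hlog : 0 ≤ Real.log q := Real.log_natCast_nonneg q
  have hsum : ∑ c ∈ range q, F c ≤ q * (1 + Real.log q) := by
    refine le_trans (le_of_eq ?_) (sum_one_div_abs_sin_le hq)
    rw [range_eq_Ico, sum_eq_sum_Ico_succ_bot hq]
    simp only [hF, if_true, zero_add]
    exact sum_congr rfl fun c hc => by rw [if_neg (by simp at hc; omega)]
  calc ∑ b ∈ (Icc 1 N).filter (fun b => ¬ q ∣ b), F (h * b % q)
      ≤ ∑ b ∈ range (q * (N / q + 1)), F (h * b % q) := by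
        apply sum_le_sum_of_subset_of_nonneg
        · intro b hb
          simp only [mem_filter, mem_Icc, mem_range] at hb ⊢
          have := Nat.lt_mul_div_succ N hq
          omega
        · intros; exact hF0 _
    _ = (N / q + 1 : ℕ) * ∑ c ∈ range q, F c := by
        rw [sum_range_mul_of_periodic, sum_range_unit_mul hq hh F, nsmul_eq_mul]
        intro n
        rw [mul_add, Nat.add_mul_mod_self_right]
    _ ≤ (N / q + 1 : ℕ) * (q * (1 + Real.log q)) :=
        mul_le_mul_of_nonneg_left hsum (by positivity)
    _ = ((N / q : ℕ) * q + q) * (1 + Real.log q) := by push_cast; ring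
    _ ≤ _ := by
        apply mul_le_mul_of_nonneg_right _ (by linarith)
        have : ((N / q : ℕ) : ℝ) * q ≤ N := by exact_mod_cast Nat.div_mul_le_self N q
        linarith

/-- Cancelling `gcd(h, d)` makes the multiplier a unit to a smaller modulus `q ≤ d`, so the bound is
uniform in `h`. -/
lemma sum_one_div_abs_sin_mul_le {d : ℕ} (hd : 0 < d) (h N : ℕ) :
    ∑ b ∈ (Icc 1 N).filter (fun b => ¬ d ∣ h * b), 1 / |Real.sin (Real.pi * (h * b : ℕ) / d)| ≤
      (N + d) * (1 + Real.log d) := by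
  obtain ⟨g, h', q, hg, hco, rfl, rfl⟩ := Nat.exists_coprime' (m := h) (n := d)
    (Nat.gcd_pos_of_pos_right _ hd)
  have hq : 0 < q := Nat.pos_of_mul_pos_right hd
  have h1 : ∑ b ∈ (Icc 1 N).filter (fun b => ¬ q * g ∣ h' * g * b),
      1 / |Real.sin (Real.pi * (h' * g * b : ℕ) / (q * g : ℕ))| =
      ∑ b ∈ (Icc 1 N).filter (fun b => ¬ q ∣ b), 1 / |Real.sin (Real.pi * (h' * b : ℕ) / q)| := by
    refine sum_congr ?_ fun b _ => ?_
    · ext b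
      simp only [mem_filter]
      rw [show h' * g * b = (h' * b) * g by ring, Nat.mul_dvd_mul_iff_right hg]
      rw [Nat.Coprime.dvd_mul_left (Nat.coprime_comm.1 hco)]
    · congr 3
      have : (g : ℝ) ≠ 0 := by positivity
      push_cast
      field_simp
  rw [h1]
  refine (sum_one_div_abs_sin_dilate_le hq hco N).trans ?_
  have hqg : (q : ℝ) ≤ (q * g : ℕ) := by exact_mod_cast Nat.le_mul_of_pos_right q hg
  have hq' : (0 : ℝ) < q := by exact_mod_cast hq
  have hlog : 0 ≤ Real.log q := Real.log_natCast_nonneg q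
  have hlog2 := Real.log_le_log hq' hqg
  apply mul_le_mul <;> linarith

/-! ### Equidistribution of `p + b t` modulo `d` -/

/-- The proportion of `t` with `d ∣ p + b t`. -/
noncomputable def dens (d p b : ℕ) : ℝ := if Nat.gcd b d ∣ p then (Nat.gcd b d : ℝ) / d else 0

lemma dens_nonneg (d p b : ℕ) : 0 ≤ dens d p b := by
  unfold dens; split_ifs <;> positivity

lemma dens_le (d p b : ℕ) : dens d p b ≤ (Nat.gcd b d : ℝ) / d := by
  unfold dens; split_ifs
  · exact le_rfl
  · positivity

lemma expZ_mul_left {k : ℕ} (hk : k ≠ 0) (g : ℕ) (m : ℤ) : expZ (k * g) (k * m) = expZ g m := by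
  rw [expZ, expZ]
  congr 1
  have : (k : ℂ) ≠ 0 := by exact_mod_cast hk
  push_cast
  rw [show 2 * (Real.pi : ℂ) * Complex.I * (k * m) = k * (2 * Real.pi * Complex.I * m) by ring,
    mul_div_mul_left _ _ this]

/-- The frequencies with `d ∣ h b` are the multiples of `d / gcd(b, d)`, and they form a complete
character sum modulo `gcd(b, d)`. This is the origin of the condition `gcd(b, d) ∣ p` in `dens`. -/
lemma sum_expZ_filter {d : ℕ} (hd : 0 < d) (b p : ℕ) :
    ∑ h ∈ (range d).filter (fun h => d ∣ h * b), expZ d (h * p) = (d : ℂ) * (dens d p b : ℝ) := by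
  obtain ⟨g, b', k, hg, hco, rfl, rfl⟩ := Nat.exists_coprime' (m := b) (n := d)
    (Nat.gcd_pos_of_pos_right _ hd)
  have hk : 0 < k := Nat.pos_of_mul_pos_right hd
  have hgcd : Nat.gcd (b' * g) (k * g) = g := by rw [Nat.gcd_mul_right, hco.gcd_eq_one, one_mul]
  have h1 : ∑ h ∈ (range (k * g)).filter (fun h => k * g ∣ h * (b' * g)), expZ (k * g) (h * p) =
      ∑ i ∈ range g, expZ g (i * p) := by
    symm
    refine sum_nbij (fun i => k * i) ?_ ?_ ?_ ?_
    · intro i hi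
      simp only [mem_filter, mem_range] at hi ⊢
      exact ⟨Nat.mul_lt_mul_of_pos_left hi hk, ⟨i * b', by ring⟩⟩
    · intro i _ j _ hij
      exact Nat.eq_of_mul_eq_mul_left hk hij
    · intro h hh
      simp only [coe_filter, mem_range, Set.mem_ofPred_eq] at hh
      have h2 : k ∣ h := by
        have h3 : k * g ∣ (h * b') * g := by rw [mul_assoc]; exact hh.2
        have h4 := Nat.dvd_of_mul_dvd_mul_right hg h3
        exact Nat.Coprime.dvd_of_dvd_mul_right (Nat.coprime_comm.1 hco) h4
      obtain ⟨i, rfl⟩ := h2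
      refine ⟨i, ?_, rfl⟩
      simp only [coe_range, Set.mem_Iio]
      exact Nat.lt_of_mul_lt_mul_left hh.1
    · intro i _
      rw [← expZ_mul_left hk.ne']
      congr 1
      push_cast
      ring
  rw [h1, sum_expZ hg.ne', dens, hgcd]
  have hk' : (k : ℂ) ≠ 0 := by exact_mod_cast hk.ne'
  have hg' : (g : ℂ) ≠ 0 := by exact_mod_cast hg.ne'
  by_cases h : g ∣ p
  · rw [if_pos h, if_pos (by exact_mod_cast h)]
    push_cast
    field_simp
  · rw [if_neg h, if_neg (by exact_mod_cast h)]
    simp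

/-- Frequencies with `d ∣ h b` have constant phase in `t` and contribute exactly `dens d p b * #J`;
the deviation is carried by the others. -/
lemma sum_ite_dvd_eq {d : ℕ} (hd : 0 < d) (p b : ℕ) (J : Finset ℕ) :
    (((∑ t ∈ J, if d ∣ p + b * t then (1 : ℝ) else 0) - dens d p b * (#J : ℝ) : ℝ) : ℂ) =
      (d : ℂ)⁻¹ * ∑ h ∈ (range d).filter (fun h => ¬ d ∣ h * b),
        expZ d (h * p) * ∑ t ∈ J, expZ d (t * (h * b : ℕ)) := by
  have hd' : (d : ℂ) ≠ 0 := by exact_mod_cast hd.ne'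
  have h1 : ∀ t ∈ J, (((if d ∣ p + b * t then (1 : ℝ) else 0 : ℝ)) : ℂ) =
      (d : ℂ)⁻¹ * ∑ h ∈ range d, expZ d (h * p) * expZ d (t * (h * b : ℕ)) := by
    intro t _
    have h2 := sum_expZ hd.ne' ((p + b * t : ℕ) : ℤ)
    have h3 : ∀ h ∈ range d, expZ d (h * ((p + b * t : ℕ) : ℤ)) =
        expZ d (h * p) * expZ d (t * (h * b : ℕ)) := by
      intro h _
      rw [← expZ_add]; congr 1; push_cast; ring
    rw [sum_congr rfl h3] at h2
    rw [h2]
    by_cases hdv : d ∣ p + b * t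
    · rw [if_pos hdv, if_pos (by exact_mod_cast hdv), inv_mul_cancel₀ hd']; simp
    · rw [if_neg hdv, if_neg (by exact_mod_cast hdv)]; simp
  have h4 : ∑ h ∈ (range d).filter (fun h => d ∣ h * b),
      expZ d (h * p) * ∑ t ∈ J, expZ d (t * (h * b : ℕ)) = (d : ℂ) * (dens d p b : ℝ) * #J := by
    rw [← sum_expZ_filter hd, sum_mul]
    refine sum_congr rfl fun h hh => ?_
    congr 1
    rw [sum_congr rfl (g := fun _ => (1 : ℂ))]
    · simp
    · intro t _
      rw [expZ_eq_one_iff hd.ne']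
      exact (Int.natCast_dvd_natCast.2 (mem_filter.1 hh).2).mul_left _
  rw [Complex.ofReal_sub, Complex.ofReal_sum, sum_congr rfl h1, ← mul_sum, sum_comm]
  simp_rw [← mul_sum]
  rw [← sum_filter_add_sum_filter_not (range d) (fun h => d ∣ h * b), mul_add, h4]
  field_simp
  push_cast
  ring

/-- Parseval: expanding the square and summing over `h` detects `p x ≡ p y` modulo `d`. -/
lemma sum_normSq_expZ {d : ℕ} (hd : 0 < d) (S : Finset ℕ) (p : ℕ → ℕ) :
    ∑ h ∈ range d, ‖∑ x ∈ S, expZ d (h * p x)‖ ^ 2 =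
      d * (#((S ×ˢ S).filter fun z => (d : ℤ) ∣ p z.1 - p z.2) : ℝ) := by
  have h1 : ∀ h ∈ range d, (((‖∑ x ∈ S, expZ d (h * p x)‖ ^ 2 : ℝ)) : ℂ) =
      ∑ z ∈ S ×ˢ S, expZ d (h * ((p z.1 : ℤ) - p z.2)) := by
    intro h _
    rw [Complex.ofReal_pow, ← Complex.mul_conj', map_sum, sum_mul_sum, sum_product]
    refine sum_congr rfl fun x _ => sum_congr rfl fun y _ => ?_
    rw [conj_expZ, ← expZ_add]; congr 1; ring
  have h2 : ((∑ h ∈ range d, ‖∑ x ∈ S, expZ d (h * p x)‖ ^ 2 : ℝ) : ℂ) =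
      ((d * (#((S ×ˢ S).filter fun z => (d : ℤ) ∣ p z.1 - p z.2) : ℝ) : ℝ) : ℂ) := by
    rw [Complex.ofReal_sum, sum_congr rfl h1, sum_comm]
    simp_rw [sum_expZ hd.ne']
    rw [← sum_filter, sum_const, nsmul_eq_mul]
    push_cast
    ring
  exact_mod_cast h2

/-- The range of `t` may depend on `i` and `b` but not on `x ∈ S i`; hence the sums over `x` and
over `t` separate. The sum over `t` is bounded pointwise and summed over `b`, uniformly in `h`. The
sum over `x` is treated in mean square over `(i, h)`. -/
lemma abs_sum_strips_le {ι : Type*} {d : ℕ} (hd : 0 < d) (I : Finset ι) (S : ι → Finset ℕ)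
    (p : ι → ℕ → ℕ) (N : ℕ) (J : ι → ℕ → Finset ℕ)
    (hJ : ∀ i b, ∃ α, α ≤ N + 1 ∧ J i b = Ico α (N + 1)) :
    |∑ i ∈ I, ∑ b ∈ Icc 1 N, ∑ x ∈ S i, ((∑ t ∈ J i b, if d ∣ p i x + b * t then (1 : ℝ) else 0) -
        dens d (p i x) b * (#(J i b) : ℝ))| ≤
      √(#I * ∑ i ∈ I, (#((S i ×ˢ S i).filter fun z => (d : ℤ) ∣ p i z.1 - p i z.2) : ℝ)) *
        ((N + d) * (1 + Real.log d)) := by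
  set C : ℝ := ∑ i ∈ I, (#((S i ×ˢ S i).filter fun z => (d : ℤ) ∣ p i z.1 - p i z.2) : ℝ) with hC
  set W : ℝ := (N + d) * (1 + Real.log d) with hW
  have hd' : (0 : ℝ) < d := by exact_mod_cast hd
  have hW0 : 0 ≤ W := by
    have : 0 ≤ Real.log d := Real.log_natCast_nonneg d
    positivity
  set G : ι → ℕ → ℝ := fun i h => ‖∑ x ∈ S i, expZ d (h * p i x)‖ with hG
  have hG2 : ∑ i ∈ I, ∑ h ∈ range d, G i h ≤ d * √(#I * C) := by
    -- Cauchy-Schwarz against the constant `1` over the `#I * d` pairs `(i, h)`, followed by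
    -- Parseval for each `i`.
    have h1 := Finset.sum_mul_sq_le_sq_mul_sq (I ×ˢ range d) (fun _ => (1 : ℝ))
      (fun z => G z.1 z.2)
    have h2 : ∑ z ∈ I ×ˢ range d, G z.1 z.2 ^ 2 = d * C := by
      rw [sum_product, hC, mul_sum]
      exact sum_congr rfl fun i _ => sum_normSq_expZ hd (S i) (p i)
    rw [h2] at h1
    simp only [one_mul, one_pow, sum_const, nsmul_eq_mul, mul_one, card_product, card_range] at h1
    rw [sum_product] at h1
    have h3 := Real.le_sqrt_of_sq_le h1
    refine h3.trans (le_of_eq ?_)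
    rw [show ((#I * d : ℕ) : ℝ) * (d * C) = (d : ℝ) ^ 2 * (#I * C) by push_cast; ring,
      Real.sqrt_mul (by positivity), Real.sqrt_sq hd'.le]
  have key : ∀ i ∈ I, ∀ b ∈ Icc 1 N,
      |∑ x ∈ S i, ((∑ t ∈ J i b, if d ∣ p i x + b * t then (1 : ℝ) else 0) -
        dens d (p i x) b * (#(J i b) : ℝ))| ≤ (d : ℝ)⁻¹ *
      ∑ h ∈ range d, if d ∣ h * b then 0 else
        G i h * (1 / |Real.sin (Real.pi * (h * b : ℕ) / d)|) := by
    intro i _ b _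
    rw [← Real.norm_eq_abs, ← Complex.norm_real, Complex.ofReal_sum,
      sum_congr rfl (fun x _ => sum_ite_dvd_eq hd (p i x) b (J i b)), ← mul_sum, norm_mul, norm_inv,
      Complex.norm_natCast, sum_comm]
    apply mul_le_mul_of_nonneg_left _ (by positivity)
    refine (norm_sum_le _ _).trans ?_
    rw [sum_filter]
    refine sum_le_sum fun h _ => ?_
    by_cases hh : d ∣ h * b
    · simp [hh]
    · simp only [hh, not_false_eq_true, if_true, if_false]
      rw [← sum_mul, norm_mul]
      apply mul_le_mul_of_nonneg_left _ (norm_nonneg _)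
      obtain ⟨α, hα, hJα⟩ := hJ i b
      rw [hJα]
      have := norm_sum_Ico_expZ_le hd.ne' (m := ((h * b : ℕ) : ℤ)) (by exact_mod_cast hh) hα
      simpa using this
  calc _ ≤ ∑ i ∈ I, ∑ b ∈ Icc 1 N, (d : ℝ)⁻¹ * ∑ h ∈ range d, (if d ∣ h * b then 0 else
        G i h * (1 / |Real.sin (Real.pi * (h * b : ℕ) / d)|)) := by
        refine (abs_sum_le_sum_abs _ _).trans (sum_le_sum fun i hi => ?_)
        exact (abs_sum_le_sum_abs _ _).trans (sum_le_sum fun b hb => key i hi b hb)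
    _ = (d : ℝ)⁻¹ * ∑ i ∈ I, ∑ h ∈ range d, G i h *
          ∑ b ∈ (Icc 1 N).filter (fun b => ¬ d ∣ h * b),
            1 / |Real.sin (Real.pi * (h * b : ℕ) / d)| := by
        rw [mul_sum]
        refine sum_congr rfl fun i _ => ?_
        rw [← mul_sum, sum_comm]
        congr 1
        refine sum_congr rfl fun h _ => ?_
        rw [mul_sum, sum_filter]
        refine sum_congr rfl fun b _ => ?_
        by_cases hh : d ∣ h * b <;> simp [hh]
    _ ≤ (d : ℝ)⁻¹ * ∑ i ∈ I, ∑ h ∈ range d, G i h * W := by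
        apply mul_le_mul_of_nonneg_left _ (by positivity)
        refine sum_le_sum fun i _ => sum_le_sum fun h _ => ?_
        exact mul_le_mul_of_nonneg_left (sum_one_div_abs_sin_mul_le hd h N) (norm_nonneg _)
    _ = (d : ℝ)⁻¹ * (∑ i ∈ I, ∑ h ∈ range d, G i h) * W := by
        simp_rw [← sum_mul]; ring
    _ ≤ (d : ℝ)⁻¹ * (d * √(#I * C)) * W := by
        apply mul_le_mul_of_nonneg_right _ hW0
        exact mul_le_mul_of_nonneg_left hG2 (by positivity)
    _ = _ := by field_simp

/-! ### Freezing the threshold on blocks -/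

/-- The `t ∈ [1, N]` with `M ≤ p + b t`. -/
def above (M p b N : ℕ) : Finset ℕ := (Icc 1 N).filter fun t => M ≤ p + b * t

lemma above_mono {M p p' b b' N : ℕ} (h : p ≤ p') (hb : b ≤ b') :
    above M p b N ⊆ above M p' b' N := by
  intro t ht
  simp only [above, mem_filter] at ht ⊢
  refine ⟨ht.1, ht.2.trans (Nat.add_le_add h (Nat.mul_le_mul_right t hb))⟩

lemma card_above_le (M p b N : ℕ) : #(above M p b N) ≤ N := by
  refine (card_filter_le _ _).trans ?_
  simp

lemma exists_above_eq_Ico (M p b N : ℕ) : ∃ α, α ≤ N + 1 ∧ above M p b N = Ico α (N + 1) :=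
  exists_filter_Icc_eq_Ico
    (fun _ _ htt' h => h.trans (Nat.add_le_add_left (Nat.mul_le_mul_left b htt') p)) N

lemma sum_fiberwise_div {M : Type*} [AddCommMonoid M] {K : ℕ} (N : ℕ) (f : ℕ → M) :
    ∑ j ∈ range (N / K + 1), ∑ x ∈ (Icc 1 N).filter (fun x => x / K = j), f x =
      ∑ x ∈ Icc 1 N, f x := by
  apply sum_fiberwise_of_maps_to
  intro x hx
  simp only [mem_Icc, mem_range] at hx ⊢
  exact Nat.lt_succ_of_le (Nat.div_le_div_right hx.2)

/-- All points of a block carry the same increment, a block has at most `K` points, and the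
increments telescope over the blocks to at most `N`. -/
lemma sum_div_increments_le {K : ℕ} (hK : 0 < K) (N : ℕ) {u : ℕ → ℕ} (hu : Monotone u)
    (huN : ∀ j, u j ≤ N) :
    ∑ x ∈ Icc 1 N, ((u (x / K + 1) : ℝ) - u (x / K)) ≤ K * N := by
  rw [← sum_fiberwise_div (K := K)]
  calc _ ≤ ∑ j ∈ range (N / K + 1), (K : ℝ) * ((u (j + 1) : ℝ) - u j) := by
        refine sum_le_sum fun j _ => ?_
        rw [sum_congr rfl (g := fun _ => (u (j + 1) : ℝ) - u j)
          (fun x hx => by rw [(mem_filter.1 hx).2]), sum_const, nsmul_eq_mul]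
        apply mul_le_mul_of_nonneg_right
        · have h1 : (Icc 1 N).filter (fun x => x / K = j) ⊆ Ico (j * K) (j * K + K) := by
            intro x hx
            have h2 := (mem_filter.1 hx).2
            rw [Nat.div_eq_iff hK] at h2
            simp only [mem_Ico]
            omega
          have h2 := card_le_card h1
          rw [Nat.card_Ico] at h2
          exact_mod_cast h2.trans (by omega)
        · have : (u j : ℝ) ≤ u (j + 1) := by exact_mod_cast hu (Nat.le_succ j)
          linarith
    _ = K * ((u (N / K + 1) : ℝ) - u 0) := by
        rw [← mul_sum, sum_range_sub (fun j => (u j : ℝ))]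
    _ ≤ _ := by
        apply mul_le_mul_of_nonneg_left _ (by positivity)
        have h1 : (u (N / K + 1) : ℝ) ≤ N := by exact_mod_cast huN _
        have h2 : (0 : ℝ) ≤ u 0 := by positivity
        linarith

lemma gcd_eq_sum_totient {d : ℕ} (hd : d ≠ 0) (b : ℕ) :
    Nat.gcd b d = ∑ r ∈ d.divisors, if r ∣ b then r.totient else 0 := by
  conv_lhs => rw [← Nat.sum_totient (Nat.gcd b d)]
  rw [← sum_filter]
  refine sum_congr ?_ fun _ _ => rfl
  ext r
  simp only [Nat.mem_divisors, mem_filter, Nat.dvd_gcd_iff]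
  have : Nat.gcd b d ≠ 0 := by simp [hd]
  tauto

lemma card_filter_dvd_Icc (N k : ℕ) : #((Icc 1 N).filter fun x => k ∣ x) = N / k := by
  have := Nat.Ioc_filter_dvd_card_eq_div N k
  rw [← this]
  congr 1

/-- With the gcd written as a sum of `φ(r)` over common divisors, each `r ∣ d` contributes `φ(r) ⌊N
/ r⌋ ≤ N`. -/
lemma sum_gcd_le {d : ℕ} (hd : d ≠ 0) (N : ℕ) :
    ∑ b ∈ Icc 1 N, (Nat.gcd b d : ℝ) ≤ N * (#d.divisors : ℝ) := by
  simp_rw [gcd_eq_sum_totient hd]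
  have h : ∑ b ∈ Icc 1 N, ∑ r ∈ d.divisors, (if r ∣ b then r.totient else 0) ≤
      N * #d.divisors := by
    rw [sum_comm, mul_comm, ← smul_eq_mul, ← sum_const]
    refine sum_le_sum fun r _ => ?_
    rw [← sum_filter, sum_const, card_filter_dvd_Icc, smul_eq_mul]
    exact (Nat.mul_le_mul_left _ (Nat.totient_le r)).trans (Nat.div_mul_le_self N r)
  exact_mod_cast h

/-- For given `k` the admissible `s` are the multiples of `d / gcd(k, d)`; it remains to sum `gcd(k,
d)`. -/
lemma card_mul_dvd_le {d : ℕ} (hd : 0 < d) (U V : ℕ) :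
    (#((Icc 1 U ×ˢ Icc 1 V).filter fun z => d ∣ z.1 * z.2) : ℝ) ≤
      U * V * (#d.divisors : ℝ) / d := by
  have hd' : (0 : ℝ) < d := by exact_mod_cast hd
  have h1 : (#((Icc 1 U ×ˢ Icc 1 V).filter fun z => d ∣ z.1 * z.2) : ℝ) =
      ∑ k ∈ Icc 1 U, (#((Icc 1 V).filter fun s => d ∣ k * s) : ℝ) := by
    rw [card_filter, sum_product]
    push_cast [card_filter]
    rfl
  rw [h1]
  calc _ ≤ ∑ k ∈ Icc 1 U, (V : ℝ) * Nat.gcd k d / d := by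
        refine sum_le_sum fun k _ => ?_
        obtain ⟨g, k', q, hg, hco, rfl, rfl⟩ := Nat.exists_coprime' (m := k) (n := d)
          (Nat.gcd_pos_of_pos_right _ hd)
        have h2 : (Icc 1 V).filter (fun s => q * g ∣ k' * g * s) =
            (Icc 1 V).filter (fun s => q ∣ s) := by
          ext s
          simp only [mem_filter]
          rw [show k' * g * s = (k' * s) * g by ring, Nat.mul_dvd_mul_iff_right hg]
          rw [Nat.Coprime.dvd_mul_left (Nat.coprime_comm.1 hco)]
        have hq : 0 < q := Nat.pos_of_mul_pos_right hd
        have hq' : (0 : ℝ) < q := by exact_mod_cast hq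
        have hg' : (0 : ℝ) < g := by exact_mod_cast hg
        rw [h2, card_filter_dvd_Icc, Nat.gcd_mul_right, hco.gcd_eq_one, one_mul]
        refine Nat.cast_div_le.trans (le_of_eq ?_)
        push_cast
        field_simp
    _ = V * (∑ k ∈ Icc 1 U, (Nat.gcd k d : ℝ)) / d := by rw [mul_sum, sum_div]
    _ ≤ V * (U * (#d.divisors : ℝ)) / d := by
        have := sum_gcd_le hd.ne' U
        gcongr
    _ = _ := by ring

/-- The number of `(a, x, b, t)` with `M ≤ z + b t` and `d ∣ P a x + b t`, where `z = Z a x`. -/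
noncomputable def hitSum (A : Finset ℕ) (P Z : ℕ → ℕ → ℕ) (d M N : ℕ) : ℝ :=
  ∑ a ∈ A, ∑ x ∈ Icc 1 N, ∑ b ∈ Icc 1 N,
    ∑ t ∈ above M (Z a x) b N, if d ∣ P a x + b * t then (1 : ℝ) else 0

/-- The expected value of `hitSum`. -/
noncomputable def densSum (A : Finset ℕ) (P Z : ℕ → ℕ → ℕ) (d M N : ℕ) : ℝ :=
  ∑ a ∈ A, ∑ x ∈ Icc 1 N, ∑ b ∈ Icc 1 N, dens d (P a x) b * (#(above M (Z a x) b N) : ℝ)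

lemma hitSum_mono {A : Finset ℕ} {P Z Z' : ℕ → ℕ → ℕ} (h : ∀ a x, Z a x ≤ Z' a x) (d M N : ℕ) :
    hitSum A P Z d M N ≤ hitSum A P Z' d M N := by
  refine sum_le_sum fun a _ => sum_le_sum fun x _ => sum_le_sum fun b _ => ?_
  apply sum_le_sum_of_subset_of_nonneg (above_mono (h a x) le_rfl)
  intros; split_ifs <;> simp

lemma densSum_mono {A : Finset ℕ} {P Z Z' : ℕ → ℕ → ℕ} (h : ∀ a x, Z a x ≤ Z' a x) (d M N : ℕ) :
    densSum A P Z d M N ≤ densSum A P Z' d M N := by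
  refine sum_le_sum fun a _ => sum_le_sum fun x _ => sum_le_sum fun b _ => ?_
  apply mul_le_mul_of_nonneg_left _ (dens_nonneg _ _ _)
  exact_mod_cast card_le_card (above_mono (h a x) le_rfl)

/-- The number of `(a, x, y)`, `x` and `y` in the same block of length `K`,
with `P a x ≡ P a y` modulo `d`. -/
noncomputable def collisions (A : Finset ℕ) (P : ℕ → ℕ → ℕ) (d N K : ℕ) : ℝ :=
  ∑ a ∈ A, (#((Icc 1 N ×ˢ Icc 1 N).filter fun z =>
    z.1 / K = z.2 / K ∧ (d : ℤ) ∣ (P a z.1 : ℤ) - P a z.2) : ℝ)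

/-- With a threshold depending on `x` only through `x / K`, `abs_sum_strips_le` applies to the pairs
`(a, block)`; the coincidences inside the blocks add up to `collisions`. -/
lemma abs_hitSum_block_sub_le (A : Finset ℕ) (P : ℕ → ℕ → ℕ) (Y : ℕ → ℕ → ℕ) {d : ℕ} (hd : 0 < d)
    (M N K : ℕ) :
    |hitSum A P (fun a x => Y a (x / K)) d M N - densSum A P (fun a x => Y a (x / K)) d M N| ≤
      √(#A * (N / K + 1 : ℕ) * collisions A P d N K) * ((N + d) * (1 + Real.log d)) := by
  have h1 := abs_sum_strips_le hd (A ×ˢ range (N / K + 1))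
    (fun i => (Icc 1 N).filter (fun x => x / K = i.2)) (fun i => P i.1) N
    (fun i b => above M (Y i.1 i.2) b N) (fun i b => exists_above_eq_Ico _ _ _ _)
  have h2 : ∑ i ∈ A ×ˢ range (N / K + 1), (#((((Icc 1 N).filter (fun x => x / K = i.2)) ×ˢ
      ((Icc 1 N).filter (fun x => x / K = i.2))).filter
        fun z => (d : ℤ) ∣ (P i.1 z.1 : ℤ) - P i.1 z.2) : ℝ) = collisions A P d N K := by
    rw [sum_product, collisions]
    refine sum_congr rfl fun a _ => ?_
    rw [← Nat.cast_sum]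
    congr 1
    rw [card_eq_sum_card_fiberwise (f := fun z => z.1 / K) (t := range (N / K + 1))]
    · refine sum_congr rfl fun j _ => ?_
      congr 1
      ext z
      simp only [mem_filter, mem_product]
      constructor
      · rintro ⟨⟨⟨h1, h2⟩, h3, h4⟩, h5⟩
        exact ⟨⟨⟨h1, h3⟩, h2.trans h4.symm, h5⟩, h2⟩
      · rintro ⟨⟨⟨h1, h3⟩, h2, h5⟩, h4⟩
        exact ⟨⟨⟨h1, h4⟩, h3, h2.symm.trans h4⟩, h5⟩
    · intro z hz
      simp only [coe_filter, mem_product, mem_Icc, Set.mem_ofPred_eq, coe_range, Set.mem_Iio] at hz ⊢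
      exact Nat.lt_succ_of_le (Nat.div_le_div_right hz.1.1.2)
  rw [h2, card_product, card_range] at h1
  push_cast at h1 ⊢
  refine le_trans (le_of_eq ?_) h1
  congr 1
  rw [hitSum, densSum, ← sum_sub_distrib, sum_product]
  refine sum_congr rfl fun a _ => ?_
  rw [← sum_sub_distrib, ← sum_fiberwise_div (K := K)]
  refine sum_congr rfl fun j _ => ?_
  rw [sum_comm (s := Icc 1 N)]
  refine sum_congr rfl fun x hx => ?_
  rw [← sum_sub_distrib]
  refine sum_congr rfl fun b _ => ?_
  rw [(mem_filter.1 hx).2]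

/-- Both `hitSum` and `densSum` increase with the threshold argument `Z`, so the values frozen at
the two ends of each block enclose the true ones. The first error term comes from the frozen sums,
the second is the gap between the two frozen expected counts. -/
theorem abs_hitSum_sub_densSum_le (A : Finset ℕ) {P : ℕ → ℕ → ℕ} (hP : ∀ a, Monotone (P a))
    {d K : ℕ} (hd : 0 < d) (hK : 0 < K) (M N : ℕ) :
    |hitSum A P P d M N - densSum A P P d M N| ≤
      √(#A * (N / K + 1 : ℕ) * collisions A P d N K) * ((N + d) * (1 + Real.log d)) +
        #A * (N : ℝ) ^ 2 * K * (#d.divisors : ℝ) / d := by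
  set Zl : ℕ → ℕ → ℕ := fun a x => P a (K * (x / K)) with hZl
  set Zu : ℕ → ℕ → ℕ := fun a x => P a (K * (x / K + 1)) with hZu
  have hl := abs_hitSum_block_sub_le A P (fun a j => P a (K * j)) hd M N K
  have hu := abs_hitSum_block_sub_le A P (fun a j => P a (K * (j + 1))) hd M N K
  have hle : ∀ a x, Zl a x ≤ P a x := fun a x => hP a (Nat.mul_div_le x K)
  have hge : ∀ a x, P a x ≤ Zu a x := fun a x => hP a (Nat.lt_mul_div_succ x hK).le
  have hd' : (0 : ℝ) < d := by exact_mod_cast hd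
  have hdiff : densSum A P Zu d M N - densSum A P Zl d M N ≤
      #A * (N : ℝ) ^ 2 * K * (#d.divisors : ℝ) / d := by
    have h1 : ∀ a ∈ A, ∑ x ∈ Icc 1 N, ∑ b ∈ Icc 1 N, (dens d (P a x) b *
        (#(above M (Zu a x) b N) : ℝ) - dens d (P a x) b * (#(above M (Zl a x) b N) : ℝ)) ≤
        (N : ℝ) ^ 2 * K * (#d.divisors : ℝ) / d := by
      intro a _
      rw [sum_comm]
      calc _ ≤ ∑ b ∈ Icc 1 N, (Nat.gcd b d : ℝ) / d * (K * N) := by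
            refine sum_le_sum fun b _ => ?_
            calc _ ≤ ∑ x ∈ Icc 1 N, (Nat.gcd b d : ℝ) / d *
                  ((#(above M (P a (K * (x / K + 1))) b N) : ℝ) -
                    #(above M (P a (K * (x / K))) b N)) := by
                  refine sum_le_sum fun x _ => ?_
                  rw [← mul_sub]
                  apply mul_le_mul_of_nonneg_right (dens_le _ _ _)
                  rw [sub_nonneg]
                  exact_mod_cast card_le_card (above_mono ((hle a x).trans (hge a x)) le_rfl)
              _ ≤ _ := by
                  rw [← mul_sum]
                  apply mul_le_mul_of_nonneg_left _ (by positivity)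
                  -- For fixed `a` and `b` the number of admissible `t` at the block ends is a
                  -- monotone function of the block index, bounded by `N`; the gap telescopes.
                  refine sum_div_increments_le hK N
                    (u := fun j => #(above M (P a (K * j)) b N)) ?_ (fun j => card_above_le _ _ _ _)
                  intro i j hij
                  exact card_le_card (above_mono (hP a (Nat.mul_le_mul_left K hij)) le_rfl)
        _ = (∑ b ∈ Icc 1 N, (Nat.gcd b d : ℝ)) * (K * N) / d := by
            rw [← sum_mul, ← sum_div]; ring
        _ ≤ (N * (#d.divisors : ℝ)) * (K * N) / d := by
            have := sum_gcd_le hd.ne' N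
            gcongr
        _ = _ := by ring
    rw [densSum, densSum, ← sum_sub_distrib]
    simp_rw [← sum_sub_distrib]
    refine (sum_le_sum h1).trans (le_of_eq ?_)
    rw [sum_const, nsmul_eq_mul]
    ring
  have h1 := hitSum_mono (A := A) (P := P) hle d M N
  have h2 := hitSum_mono (A := A) (P := P) hge d M N
  have h3 := densSum_mono (A := A) (P := P) hle d M N
  have h4 := densSum_mono (A := A) (P := P) hge d M N
  rw [abs_le] at hl hu ⊢
  constructor <;> linarith [hl.1, hl.2, hu.1, hu.2]

/-! ### Counting coincidences inside blocks -/

/-- Besides the at most `N` diagonal pairs, a pair from one block is `(y + k, y)` or its mirror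
image with `1 ≤ k ≤ K`. -/
lemma card_same_block_le {d K : ℕ} (hK : 0 < K) (p : ℕ → ℕ) (N : ℕ) :
    #((Icc 1 N ×ˢ Icc 1 N).filter fun z => z.1 / K = z.2 / K ∧ (d : ℤ) ∣ (p z.1 : ℤ) - p z.2) ≤
      N + 2 * #((Icc 1 K ×ˢ Icc 1 N).filter fun z =>
        (d : ℤ) ∣ (p (z.2 + z.1) : ℤ) - p z.2) := by
  set S := (Icc 1 N ×ˢ Icc 1 N).filter fun z =>
    z.1 / K = z.2 / K ∧ (d : ℤ) ∣ (p z.1 : ℤ) - p z.2 with hS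
  set T := (Icc 1 K ×ˢ Icc 1 N).filter fun z => (d : ℤ) ∣ (p (z.2 + z.1) : ℤ) - p z.2 with hT
  have hblock : ∀ x y, x / K = y / K → x < y + K := by
    intro x y hxy
    have h1 := Nat.lt_mul_div_succ x hK
    have h2 := Nat.mul_div_le y K
    rw [hxy, mul_add, mul_one] at h1
    omega
  have hsub : S ⊆ (Icc 1 N).image (fun x => (x, x)) ∪
      (T.image (fun z => (z.2 + z.1, z.2)) ∪ T.image (fun z => (z.2, z.2 + z.1))) := by
    rintro ⟨x, y⟩ hz
    simp only [hS, mem_filter, mem_product, mem_Icc] at hz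
    obtain ⟨⟨hx, hy⟩, hxy, hdv⟩ := hz
    simp only [mem_union, mem_image, hT, mem_filter, mem_product, mem_Icc]
    rcases lt_trichotomy x y with h | h | h
    · right; right
      have := hblock y x hxy.symm
      refine ⟨(y - x, x), ⟨⟨⟨by omega, by omega⟩, hx⟩, ?_⟩, ?_⟩
      · simp only [Nat.add_sub_cancel' h.le]
        rw [← dvd_neg, neg_sub]; exact hdv
      · simp only [Nat.add_sub_cancel' h.le]
    · left; exact ⟨x, hx, by rw [h]⟩
    · right; left
      have := hblock x y hxy
      refine ⟨(x - y, y), ⟨⟨⟨by omega, by omega⟩, hy⟩, ?_⟩, ?_⟩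
      · simp only [Nat.add_sub_cancel' h.le]
        exact hdv
      · simp only [Nat.add_sub_cancel' h.le]
  have h1 := card_le_card hsub
  have h2 := card_union_le ((Icc 1 N).image (fun x => (x, x)))
    (T.image (fun z => (z.2 + z.1, z.2)) ∪ T.image (fun z => (z.2, z.2 + z.1)))
  have h3 := card_union_le (T.image (fun z => (z.2 + z.1, z.2))) (T.image (fun z => (z.2, z.2 + z.1)))
  have h4 : #((Icc 1 N).image (fun x => (x, x))) ≤ N := by
    refine card_image_le.trans ?_
    simp
  have h5 : #(T.image (fun z => (z.2 + z.1, z.2))) ≤ #T := card_image_le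
  have h6 : #(T.image (fun z => (z.2, z.2 + z.1))) ≤ #T := card_image_le
  omega

/-- The difference `a (y + k) - a y = a k` does not involve `y`, so it suffices to count pairs `(a,
k)` with `d ∣ a k`. -/
lemma collisions_mul_le {d K : ℕ} (hd : 0 < d) (hK : 0 < K) (N : ℕ) :
    collisions (Icc 1 N) (fun a x => a * x) d N K ≤
      N * N * (1 + 6 * (K * (#d.divisors : ℝ) / d)) := by
  have hd' : (0 : ℝ) < d := by exact_mod_cast hd
  have h1 : collisions (Icc 1 N) (fun a x => a * x) d N K ≤
      ∑ a ∈ Icc 1 N, ((N : ℝ) + 2 * (N * #((Icc 1 K).filter fun k => d ∣ a * k))) := by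
    refine sum_le_sum fun a _ => ?_
    have h2 := card_same_block_le (d := d) hK (fun x => a * x) N
    have h3 : #((Icc 1 K ×ˢ Icc 1 N).filter fun z =>
        (d : ℤ) ∣ ((a * (z.2 + z.1) : ℕ) : ℤ) - (a * z.2 : ℕ)) =
        N * #((Icc 1 K).filter fun k => d ∣ a * k) := by
      have h4 : ((Icc 1 K ×ˢ Icc 1 N).filter fun z =>
        (d : ℤ) ∣ ((a * (z.2 + z.1) : ℕ) : ℤ) - (a * z.2 : ℕ)) =
          ((Icc 1 K).filter fun k => d ∣ a * k) ×ˢ Icc 1 N := by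
        ext ⟨k, y⟩
        simp only [mem_filter, mem_product]
        rw [show ((a * (y + k) : ℕ) : ℤ) - (a * y : ℕ) = (a * k : ℕ) by push_cast; ring,
          Int.natCast_dvd_natCast]
        tauto
      rw [h4, card_product, Nat.card_Icc, mul_comm]
      simp
    rw [h3] at h2
    exact_mod_cast h2
  have h5 : ∑ a ∈ Icc 1 N, (#((Icc 1 K).filter fun k => d ∣ a * k) : ℝ) =
      #((Icc 1 N ×ˢ Icc 1 K).filter fun z => d ∣ z.1 * z.2) := by
    rw [card_filter, sum_product]
    push_cast [card_filter]
    rfl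
  refine h1.trans ?_
  rw [sum_add_distrib, ← mul_sum, ← mul_sum, h5]
  have h6 := card_mul_dvd_le hd N K
  simp only [sum_const, Nat.card_Icc, nsmul_eq_mul, Nat.add_sub_cancel]
  have h7 : 0 ≤ (K * (#d.divisors : ℝ) / d) := by positivity
  have h8 : (N : ℝ) * #((Icc 1 N ×ˢ Icc 1 K).filter fun z => d ∣ z.1 * z.2) ≤
      N * (N * K * (#d.divisors : ℝ) / d) := mul_le_mul_of_nonneg_left h6 (by positivity)
  have h9 : (N : ℝ) * (N * K * (#d.divisors : ℝ) / d) = N * N * (K * (#d.divisors : ℝ) / d) := by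
    ring
  have h10 : 0 ≤ (N : ℝ) * N * (K * (#d.divisors : ℝ) / d) := by positivity
  nlinarith

/-- Since `(y + k)² - y² = k (2 y + k)`, the injection `(k, y) ↦ (k, 2 y + k)` reduces this to
products divisible by `d`. The range `3 N` for the second factor uses `K ≤ N`. -/
lemma collisions_sq_le {d K N : ℕ} (hd : 0 < d) (hK : 0 < K) (hKN : K ≤ N) :
    collisions {1} (fun _ x => x ^ 2) d N K ≤
      N * (1 + 6 * (K * (#d.divisors : ℝ) / d)) := by
  have hd' : (0 : ℝ) < d := by exact_mod_cast hd
  rw [collisions, sum_singleton]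
  have h2 := card_same_block_le (d := d) hK (fun x => x ^ 2) N
  have h3 : #((Icc 1 K ×ˢ Icc 1 N).filter fun z =>
        (d : ℤ) ∣ (((z.2 + z.1) ^ 2 : ℕ) : ℤ) - (z.2 ^ 2 : ℕ)) ≤
      #((Icc 1 K ×ˢ Icc 1 (3 * N)).filter fun z => d ∣ z.1 * z.2) := by
    refine card_le_card_of_injOn (fun z => (z.1, 2 * z.2 + z.1)) ?_ ?_
    · rintro ⟨k, y⟩ hz
      simp only [coe_filter, mem_product, mem_Icc, Set.mem_ofPred_eq] at hz ⊢
      refine ⟨⟨hz.1.1, by omega⟩, ?_⟩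
      rw [← Int.natCast_dvd_natCast]
      have h4 := hz.2
      rwa [show (((y + k) ^ 2 : ℕ) : ℤ) - (y ^ 2 : ℕ) = ((k * (2 * y + k) : ℕ) : ℤ) by
        push_cast; ring] at h4
    · rintro ⟨k, y⟩ _ ⟨k', y'⟩ _ h
      simp only [Prod.mk.injEq] at h ⊢
      omega
  have h4 := card_mul_dvd_le hd K (3 * N)
  have h5 : (#((Icc 1 N ×ˢ Icc 1 N).filter fun z =>
      z.1 / K = z.2 / K ∧ (d : ℤ) ∣ ((z.1 ^ 2 : ℕ) : ℤ) - (z.2 ^ 2 : ℕ)) : ℝ) ≤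
      N + 2 * #((Icc 1 K ×ˢ Icc 1 (3 * N)).filter fun z => d ∣ z.1 * z.2) := by
    exact_mod_cast h2.trans (by omega)
  refine h5.trans ?_
  push_cast at h4
  have h6 : (K : ℝ) * (3 * N) * (#d.divisors : ℝ) / d = 3 * (N * (K * (#d.divisors : ℝ) / d)) := by
    ring
  rw [h6] at h4
  linarith

/-! ### The expected count and the density of the form modulo `d` -/

/-- Abel summation: the weight `k · 1_{k ∣ x} - 1` has partial sums `S n` in `[-k, 0]`, and a
monotone `f` has total variation at most `f N`. -/
lemma abs_mul_sum_filter_dvd_sub_le {f : ℕ → ℝ} (hf : Monotone f) (h0 : 0 ≤ f 0) {k N : ℕ} {B : ℝ}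
    (hk : 0 < k) (hB : f N ≤ B) :
    |k * ∑ x ∈ (Icc 1 N).filter (fun x => k ∣ x), f x - ∑ x ∈ Icc 1 N, f x| ≤ k * B := by
  have hk' : (0 : ℝ) < k := by exact_mod_cast hk
  have hpos : ∀ n, 0 ≤ f n := fun n => h0.trans (hf (Nat.zero_le n))
  set S : ℕ → ℝ := fun n => k * (n / k : ℕ) - n with hS
  have hS0 : ∀ n, S n ≤ 0 := by
    intro n
    have : ((k * (n / k) : ℕ) : ℝ) ≤ n := by exact_mod_cast Nat.mul_div_le n k
    push_cast at this
    simp only [hS]; linarith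
  have hSk : ∀ n, -k ≤ S n := by
    intro n
    have : (n : ℝ) ≤ ((k * (n / k + 1) : ℕ) : ℝ) := by exact_mod_cast (Nat.lt_mul_div_succ n hk).le
    push_cast at this
    simp only [hS]; linarith
  -- Passing from `n` to `n + 1` changes the quantity `difference - S n * f n` by exactly `-S n * (f
  -- (n + 1) - f n)`, which lies between `0` and `k (f (n + 1) - f n)`.
  have key : ∀ n, 0 ≤ (k * ∑ x ∈ (Icc 1 n).filter (fun x => k ∣ x), f x - ∑ x ∈ Icc 1 n, f x) -
        S n * f n ∧
      (k * ∑ x ∈ (Icc 1 n).filter (fun x => k ∣ x), f x - ∑ x ∈ Icc 1 n, f x) -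
        S n * f n ≤ k * f n := by
    intro n
    induction n with
    | zero =>
      simp only [hS]
      simpa using mul_nonneg hk'.le h0
    | succ n ih =>
      have hstep : S (n + 1) = S n + ((if k ∣ n + 1 then (k : ℝ) else 0) - 1) := by
        simp only [hS, Nat.succ_div]
        split_ifs <;> push_cast <;> ring
      rw [sum_filter] at ih ⊢
      rw [sum_Icc_succ_top (by omega), sum_Icc_succ_top (by omega), hstep]
      have h1 := hf (Nat.le_succ n)
      have h2 : -S n * (f (n + 1) - f n) ≤ k * (f (n + 1) - f n) :=
        mul_le_mul_of_nonneg_right (by linarith [hSk n]) (by simpa using h1)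
      have h3 : 0 ≤ -S n * (f (n + 1) - f n) :=
        mul_nonneg (by linarith [hS0 n]) (by simpa using h1)
      by_cases hd : k ∣ n + 1
      · simp only [if_pos hd]
        constructor <;> nlinarith [ih.1, ih.2]
      · simp only [if_neg hd]
        constructor <;> nlinarith [ih.1, ih.2]
  obtain ⟨h1, h2⟩ := key N
  have h3 : S N * f N ≤ 0 := mul_nonpos_of_nonpos_of_nonneg (hS0 N) (hpos N)
  have h4 : -k * f N ≤ S N * f N := mul_le_mul_of_nonneg_right (hSk N) (hpos N)
  have h5 : k * f N ≤ k * B := mul_le_mul_of_nonneg_left hB hk'.le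
  rw [abs_le]
  constructor <;> linarith

/-- With `g = v² u` and `u` squarefree, take `κ = u v`. Moreover `r² ∣ g` is equivalent to `r ∣ v`,
so the sum of `φ(r)` over such `r` is `v`. -/
lemma exists_dvd_sq_iff {g : ℕ} (hg : 0 < g) :
    ∃ κ v : ℕ, κ * v = g ∧ (∀ x, g ∣ x ^ 2 ↔ κ ∣ x) ∧
      v = ∑ r ∈ g.divisors, if r ^ 2 ∣ g then r.totient else 0 := by
  obtain ⟨u, v, h1, hu⟩ := Nat.sq_mul_squarefree g
  have hv : 0 < v := by
    rcases Nat.eq_zero_or_pos v with h | h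
    · subst h; simp at h1; omega
    · exact h
  refine ⟨u * v, v, by rw [← h1]; ring, ?_, ?_⟩
  · intro x
    rw [← h1]
    constructor
    · intro h
      have h2 : v ∣ x := by
        rw [← Nat.pow_dvd_pow_iff two_ne_zero]
        exact (dvd_mul_right _ _).trans h
      obtain ⟨y, rfl⟩ := h2
      rw [mul_pow] at h
      have h3 := Nat.dvd_of_mul_dvd_mul_left (pow_pos hv 2) h
      rw [mul_comm u v]
      exact Nat.mul_dvd_mul_left v ((hu.dvd_pow_iff_dvd two_ne_zero).1 h3)
    · rintro ⟨y, rfl⟩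
      exact ⟨u * y ^ 2, by ring⟩
  · conv_lhs => rw [← Nat.sum_totient v]
    rw [← sum_filter]
    refine sum_congr ?_ fun _ _ => rfl
    ext r
    simp only [Nat.mem_divisors, mem_filter]
    constructor
    · rintro ⟨h2, _⟩
      have h3 : r ^ 2 ∣ g := (pow_dvd_pow_of_dvd h2 2).trans (h1 ▸ dvd_mul_right _ _)
      exact ⟨⟨(dvd_pow_self r two_ne_zero).trans h3, hg.ne'⟩, h3⟩
    · rintro ⟨_, h3⟩
      refine ⟨?_, hv.ne'⟩
      obtain ⟨c, r', v', hc, hco, rfl, rfl⟩ := Nat.exists_coprime' (m := r) (n := v)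
        (Nat.gcd_pos_of_pos_right _ hv)
      rw [← h1, mul_pow, mul_pow, mul_comm (r' ^ 2), mul_comm (v' ^ 2), mul_assoc] at h3
      have h4 := Nat.dvd_of_mul_dvd_mul_left (pow_pos hc 2) h3
      have h5 : r' ^ 2 ∣ u := (hco.pow 2 2).dvd_of_dvd_mul_left h4
      have h6 : r' = 1 := Nat.isUnit_iff.1 (hu r' (by rwa [← sq]))
      rw [h6, one_mul]
      exact dvd_mul_left _ _

/-- The density of the solutions of `Q ≡ 0` modulo `d`, for `x₁ x₂ + x₃ x₄` if `k = 1` and for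
`x₀² + x₁ x₂` if `k = 2`. -/
noncomputable def sigmaDens (k d : ℕ) : ℝ :=
  (∑ r ∈ d.divisors, if r ^ k ∣ d then (r.totient : ℝ) / r ^ 2 else 0) / d

/-- The number of `(a, x, b, t)` with `M ≤ P a x + b t`. -/
noncomputable def totalAbove (A : Finset ℕ) (P : ℕ → ℕ → ℕ) (M N : ℕ) : ℝ :=
  ∑ a ∈ A, ∑ x ∈ Icc 1 N, ∑ b ∈ Icc 1 N, (#(above M (P a x) b N) : ℝ)

/-- Averaging over `x` replaces the condition `gcd(b, d) ∣ x²` by the weight `v / d`, where `v` is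
the sum of `φ(r)` over `r² ∣ gcd(b, d)`. Averaging over `b` then turns `r² ∣ b` into `1 / r²`. The
factor `√d` bounds the `r` with `r² ∣ d`. -/
lemma abs_densSum_sq_sub_le {d : ℕ} (hd : 0 < d) (M N : ℕ) :
    |densSum {1} (fun _ x => x ^ 2) (fun _ x => x ^ 2) d M N -
        sigmaDens 2 d * totalAbove {1} (fun _ x => x ^ 2) M N| ≤
      (N : ℝ) ^ 2 * (1 + √d) * (#d.divisors : ℝ) / d := by
  have hd' : (0 : ℝ) < d := by exact_mod_cast hd
  set F : ℕ → ℝ := fun b => ∑ x ∈ Icc 1 N, (#(above M (x ^ 2) b N) : ℝ) with hF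
  have hFmono : Monotone F := fun b b' hb => sum_le_sum fun x _ => by
    exact_mod_cast card_le_card (above_mono le_rfl hb)
  have hF0 : ∀ b, 0 ≤ F b := fun b => sum_nonneg fun _ _ => by positivity
  have hFN : F N ≤ (N : ℝ) ^ 2 := by
    have : F N ≤ ∑ x ∈ Icc 1 N, (N : ℝ) := sum_le_sum fun x _ => by
      exact_mod_cast card_above_le _ _ _ _
    refine this.trans (le_of_eq ?_)
    simp [sq]
  have h1 : ∀ b ∈ Icc 1 N, |∑ x ∈ Icc 1 N, dens d (x ^ 2) b * (#(above M (x ^ 2) b N) : ℝ) -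
      (∑ r ∈ d.divisors, if r ^ 2 ∣ d ∧ r ^ 2 ∣ b then (r.totient : ℝ) else 0) / d * F b| ≤
        (Nat.gcd b d : ℝ) / d * N := by
    intro b _
    set g := Nat.gcd b d with hg
    have hg0 : 0 < g := Nat.gcd_pos_of_pos_right _ hd
    obtain ⟨κ, v, hκv, hiff, hv⟩ := exists_dvd_sq_iff hg0
    have hκ : 0 < κ := Nat.pos_of_mul_pos_right (show 0 < κ * v by rw [hκv]; exact hg0)
    have h2 : (∑ r ∈ d.divisors, if r ^ 2 ∣ d ∧ r ^ 2 ∣ b then (r.totient : ℝ) else 0) = v := by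
      rw [hv]
      push_cast
      rw [← sum_filter, ← sum_filter]
      refine sum_congr ?_ fun _ _ => rfl
      ext r
      simp only [Nat.mem_divisors, mem_filter, hg, Nat.dvd_gcd_iff]
      constructor
      · rintro ⟨⟨h3, h4⟩, h5, h6⟩
        exact ⟨⟨⟨(dvd_pow_self r two_ne_zero).trans h6, h3⟩, hg0.ne'⟩, h6, h5⟩
      · rintro ⟨⟨⟨h3, h4⟩, h7⟩, h5, h6⟩
        exact ⟨⟨h4, hd.ne'⟩, h6, h5⟩
    have h3 : ∑ x ∈ Icc 1 N, dens d (x ^ 2) b * (#(above M (x ^ 2) b N) : ℝ) =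
        (g : ℝ) / d * ∑ x ∈ (Icc 1 N).filter (fun x => κ ∣ x), (#(above M (x ^ 2) b N) : ℝ) := by
      rw [mul_sum, sum_filter]
      refine sum_congr rfl fun x _ => ?_
      rw [dens, ← hg]
      simp only [hiff]
      split_ifs <;> simp
    have h4 := abs_mul_sum_filter_dvd_sub_le (f := fun x => (#(above M (x ^ 2) b N) : ℝ))
      (fun x y hxy => by
        dsimp only
        exact_mod_cast card_le_card (above_mono (Nat.pow_le_pow_left hxy 2) le_rfl))
      (by positivity) (N := N) (B := N) hκ (by exact_mod_cast card_above_le _ _ _ _)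
    rw [h2, h3]
    have hgκ : (g : ℝ) = κ * v := by exact_mod_cast hκv.symm
    have h5 : (g : ℝ) / d * ∑ x ∈ (Icc 1 N).filter (fun x => κ ∣ x), (#(above M (x ^ 2) b N) : ℝ) -
        v / d * F b = v / d * (κ * ∑ x ∈ (Icc 1 N).filter (fun x => κ ∣ x),
          (#(above M (x ^ 2) b N) : ℝ) - F b) := by rw [hgκ]; ring
    rw [h5, abs_mul, abs_of_nonneg (by positivity)]
    refine (mul_le_mul_of_nonneg_left h4 (by positivity)).trans (le_of_eq ?_)
    rw [hgκ]; ring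
  have h2 : |∑ b ∈ Icc 1 N, (∑ r ∈ d.divisors,
      if r ^ 2 ∣ d ∧ r ^ 2 ∣ b then (r.totient : ℝ) else 0) / d * F b -
        sigmaDens 2 d * ∑ b ∈ Icc 1 N, F b| ≤ (N : ℝ) ^ 2 * √d * (#d.divisors : ℝ) / d := by
    have h3 : ∑ b ∈ Icc 1 N, (∑ r ∈ d.divisors,
        if r ^ 2 ∣ d ∧ r ^ 2 ∣ b then (r.totient : ℝ) else 0) / d * F b -
        sigmaDens 2 d * ∑ b ∈ Icc 1 N, F b = (∑ r ∈ d.divisors, if r ^ 2 ∣ d then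
          (r.totient : ℝ) / r ^ 2 * (((r ^ 2 : ℕ) : ℝ) *
            ∑ b ∈ (Icc 1 N).filter (fun b => r ^ 2 ∣ b), F b - ∑ b ∈ Icc 1 N, F b) else 0) / d := by
      have e1 : ∀ b ∈ Icc 1 N, (∑ r ∈ d.divisors,
          if r ^ 2 ∣ d ∧ r ^ 2 ∣ b then (r.totient : ℝ) else 0) / d * F b =
          (∑ r ∈ d.divisors, if r ^ 2 ∣ d then (r.totient : ℝ) *
            (if r ^ 2 ∣ b then F b else 0) else 0) / d := by
        intro b _
        rw [div_mul_eq_mul_div, sum_mul]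
        congr 1
        refine sum_congr rfl fun r _ => ?_
        by_cases h1 : r ^ 2 ∣ d <;> by_cases h2 : r ^ 2 ∣ b <;> simp [h1, h2]
      rw [sum_congr rfl e1, ← sum_div, sum_comm, sigmaDens, div_mul_eq_mul_div, ← sub_div, sum_mul,
        ← sum_sub_distrib]
      congr 1
      refine sum_congr rfl fun r hr => ?_
      have hr0 : (r : ℝ) ≠ 0 := by
        have := Nat.pos_of_mem_divisors hr
        positivity
      by_cases h1 : r ^ 2 ∣ d
      · simp only [h1, if_true]
        rw [← mul_sum, sum_filter]
        push_cast
        field_simp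
      · simp [h1]
    rw [h3, abs_div, abs_of_pos hd']
    apply div_le_div_of_nonneg_right _ hd'.le
    refine (abs_sum_le_sum_abs _ _).trans ?_
    rw [mul_comm, ← nsmul_eq_mul, ← sum_const]
    refine sum_le_sum fun r hr => ?_
    have hr0 := Nat.pos_of_mem_divisors hr
    have hr0' : (0 : ℝ) < r := by exact_mod_cast hr0
    by_cases h1 : r ^ 2 ∣ d
    · rw [if_pos h1, abs_mul, abs_of_nonneg (by positivity)]
      have h4 := abs_mul_sum_filter_dvd_sub_le hFmono (hF0 0) (k := r ^ 2) (by positivity) hFN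
      have hrd : (r : ℝ) ≤ √d := by
        apply Real.le_sqrt_of_sq_le
        exact_mod_cast Nat.le_of_dvd hd h1
      have hφ : (r.totient : ℝ) ≤ r := by exact_mod_cast Nat.totient_le r
      calc (r.totient : ℝ) / r ^ 2 * |((r ^ 2 : ℕ) : ℝ) *
            ∑ b ∈ (Icc 1 N).filter (fun b => r ^ 2 ∣ b), F b - ∑ b ∈ Icc 1 N, F b|
          ≤ (r.totient : ℝ) / r ^ 2 * (((r ^ 2 : ℕ) : ℝ) * N ^ 2) :=
            mul_le_mul_of_nonneg_left h4 (by positivity)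
        _ = r.totient * N ^ 2 := by push_cast; field_simp
        _ ≤ √d * N ^ 2 := by gcongr; linarith
        _ = _ := by ring
    · rw [if_neg h1, abs_zero]; positivity
  have h3 : totalAbove {1} (fun _ x => x ^ 2) M N = ∑ b ∈ Icc 1 N, F b := by
    rw [totalAbove, sum_singleton, sum_comm]
  have h4 : |densSum {1} (fun _ x => x ^ 2) (fun _ x => x ^ 2) d M N - ∑ b ∈ Icc 1 N,
      (∑ r ∈ d.divisors, if r ^ 2 ∣ d ∧ r ^ 2 ∣ b then (r.totient : ℝ) else 0) / d * F b| ≤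
        (N : ℝ) ^ 2 * (#d.divisors : ℝ) / d := by
    rw [densSum, sum_singleton, sum_comm, ← sum_sub_distrib]
    refine (abs_sum_le_sum_abs _ _).trans ((sum_le_sum h1).trans ?_)
    rw [← sum_mul, ← sum_div]
    have := sum_gcd_le hd.ne' N
    calc _ ≤ (N * (#d.divisors : ℝ)) / d * N := by gcongr
      _ = _ := by ring
  rw [h3]
  have h5 : (N : ℝ) ^ 2 * (1 + √d) * (#d.divisors : ℝ) / d =
    (N : ℝ) ^ 2 * (#d.divisors : ℝ) / d + (N : ℝ) ^ 2 * √d * (#d.divisors : ℝ) / d := by ring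
  rw [h5]
  exact (abs_sub_le _ _ _).trans (add_le_add h4 h2)

/-- The two variables are averaged one after the other, each at the cost `r * N * B`. -/
lemma abs_sum_sum_filter_dvd_sub_le {F : ℕ → ℕ → ℝ} (h1 : ∀ b, Monotone fun a => F a b)
    (h2 : ∀ a, Monotone (F a)) (h0 : ∀ a b, 0 ≤ F a b) {r N : ℕ} (hr : 0 < r) {B : ℝ}
    (hB : F N N ≤ B) :
    |(r : ℝ) ^ 2 * (∑ a ∈ (Icc 1 N).filter (fun a => r ∣ a),
        ∑ b ∈ (Icc 1 N).filter (fun b => r ∣ b), F a b) - ∑ a ∈ Icc 1 N, ∑ b ∈ Icc 1 N, F a b| ≤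
      2 * (r * N * B) := by
  have hr' : (0 : ℝ) < r := by exact_mod_cast hr
  have hFB : ∀ a ≤ N, F a N ≤ B := fun a ha => (h1 N ha).trans hB
  have hB0 : 0 ≤ B := (h0 N N).trans hB
  have e1 : ∀ a ∈ Icc 1 N, |r * ∑ b ∈ (Icc 1 N).filter (fun b => r ∣ b), F a b -
      ∑ b ∈ Icc 1 N, F a b| ≤ r * B := fun a ha =>
    abs_mul_sum_filter_dvd_sub_le (h2 a) (h0 a 0) hr (hFB a (mem_Icc.1 ha).2)
  have e2 : ∀ b ∈ Icc 1 N, |r * ∑ a ∈ (Icc 1 N).filter (fun a => r ∣ a), F a b -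
      ∑ a ∈ Icc 1 N, F a b| ≤ r * B := fun b hb =>
    abs_mul_sum_filter_dvd_sub_le (h1 b) (h0 0 b) hr
      (((h2 N) (mem_Icc.1 hb).2).trans hB)
  set G := (Icc 1 N).filter (fun a => r ∣ a) with hG
  have e3 : (r : ℝ) ^ 2 * (∑ a ∈ G, ∑ b ∈ G, F a b) - ∑ a ∈ Icc 1 N, ∑ b ∈ Icc 1 N, F a b =
      r * ∑ b ∈ G, (r * ∑ a ∈ G, F a b - ∑ a ∈ Icc 1 N, F a b) +
        ∑ a ∈ Icc 1 N, (r * ∑ b ∈ G, F a b - ∑ b ∈ Icc 1 N, F a b) := by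
    rw [sum_sub_distrib, sum_sub_distrib, ← mul_sum, ← mul_sum, sum_comm (s := G) (t := G),
      sum_comm (s := G) (t := Icc 1 N)]
    ring
  have e4 : |r * ∑ b ∈ G, (r * ∑ a ∈ G, F a b - ∑ a ∈ Icc 1 N, F a b)| ≤ r * N * B := by
    rw [abs_mul, abs_of_pos hr']
    have : |∑ b ∈ G, (r * ∑ a ∈ G, F a b - ∑ a ∈ Icc 1 N, F a b)| ≤ N * B := by
      refine (abs_sum_le_sum_abs _ _).trans ?_
      refine (sum_le_sum fun b hb => e2 b (mem_filter.1 hb).1).trans ?_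
      rw [sum_const, nsmul_eq_mul, card_filter_dvd_Icc, ← mul_assoc]
      apply mul_le_mul_of_nonneg_right _ hB0
      exact_mod_cast Nat.div_mul_le_self N r
    calc _ ≤ r * (N * B) := mul_le_mul_of_nonneg_left this hr'.le
      _ = _ := by ring
  have e5 : |∑ a ∈ Icc 1 N, (r * ∑ b ∈ G, F a b - ∑ b ∈ Icc 1 N, F a b)| ≤ r * N * B := by
    refine (abs_sum_le_sum_abs _ _).trans ((sum_le_sum e1).trans (le_of_eq ?_))
    rw [sum_const, nsmul_eq_mul, Nat.card_Icc, Nat.add_sub_cancel]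
    ring
  rw [e3]
  exact (abs_add_le _ _).trans (by linarith)

/-- Averaging over `x` gives the weight `gcd(a, b, d) / d`, which is a sum of `φ(r) / d` over `r`
dividing `a`, `b` and `d`. Averaging over `a` and `b` then yields the factor `1 / r²` of `sigmaDens
1`. -/
lemma abs_densSum_mul_sub_le {d : ℕ} (hd : 0 < d) (M N : ℕ) :
    |densSum (Icc 1 N) (fun a x => a * x) (fun a x => a * x) d M N -
        sigmaDens 1 d * totalAbove (Icc 1 N) (fun a x => a * x) M N| ≤
      3 * (N : ℝ) ^ 3 * (#d.divisors : ℝ) / d := by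
  have hd' : (0 : ℝ) < d := by exact_mod_cast hd
  set F : ℕ → ℕ → ℝ := fun a b => ∑ x ∈ Icc 1 N, (#(above M (a * x) b N) : ℝ) with hF
  have hm1 : ∀ b, Monotone fun a => F a b := fun b a a' ha => sum_le_sum fun x _ => by
    exact_mod_cast card_le_card (above_mono (Nat.mul_le_mul_right x ha) le_rfl)
  have hm2 : ∀ a, Monotone (F a) := fun a b b' hb => sum_le_sum fun x _ => by
    exact_mod_cast card_le_card (above_mono le_rfl hb)
  have hF0 : ∀ a b, 0 ≤ F a b := fun a b => sum_nonneg fun _ _ => by positivity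
  have hFN : F N N ≤ (N : ℝ) ^ 2 := by
    have : F N N ≤ ∑ x ∈ Icc 1 N, (N : ℝ) := sum_le_sum fun x _ => by
      exact_mod_cast card_above_le _ _ _ _
    refine this.trans (le_of_eq ?_)
    simp [sq]
  have h1 : ∀ a ∈ Icc 1 N, ∀ b ∈ Icc 1 N,
      |∑ x ∈ Icc 1 N, dens d (a * x) b * (#(above M (a * x) b N) : ℝ) -
      (Nat.gcd a (Nat.gcd b d) : ℝ) / d * F a b| ≤ (Nat.gcd b d : ℝ) / d * N := by
    intro a _ b _
    set g := Nat.gcd b d with hg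
    have hg0 : 0 < g := Nat.gcd_pos_of_pos_right _ hd
    obtain ⟨c, a', κ, hc, hco, ha', hκ'⟩ := Nat.exists_coprime' (m := a) (n := g)
        (Nat.gcd_pos_of_pos_right _ hg0)
    have hκ : 0 < κ := Nat.pos_of_mul_pos_right (show 0 < κ * c by rw [← hκ']; exact hg0)
    have hiff : ∀ x, g ∣ a * x ↔ κ ∣ x := by
      intro x
      rw [ha', hκ', show a' * c * x = (a' * x) * c by ring, Nat.mul_dvd_mul_iff_right hc,
        Nat.Coprime.dvd_mul_left (Nat.coprime_comm.1 hco)]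
    have hgc : Nat.gcd a g = c := by
      rw [ha', hκ', Nat.gcd_mul_right, hco.gcd_eq_one, one_mul]
    have h3 : ∑ x ∈ Icc 1 N, dens d (a * x) b * (#(above M (a * x) b N) : ℝ) =
        (g : ℝ) / d * ∑ x ∈ (Icc 1 N).filter (fun x => κ ∣ x), (#(above M (a * x) b N) : ℝ) := by
      rw [mul_sum, sum_filter]
      refine sum_congr rfl fun x _ => ?_
      rw [dens, ← hg]
      simp only [hiff]
      split_ifs <;> simp
    have h4 := abs_mul_sum_filter_dvd_sub_le (f := fun x => (#(above M (a * x) b N) : ℝ))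
      (fun x y hxy => by
        dsimp only
        exact_mod_cast card_le_card (above_mono (Nat.mul_le_mul_left a hxy) le_rfl))
      (by positivity) (N := N) (B := N) hκ (by exact_mod_cast card_above_le _ _ _ _)
    rw [hgc, h3]
    have hgκ : (g : ℝ) = κ * c := by exact_mod_cast hκ'
    have h5 : (g : ℝ) / d * ∑ x ∈ (Icc 1 N).filter (fun x => κ ∣ x), (#(above M (a * x) b N) : ℝ) -
        c / d * F a b = c / d * (κ * ∑ x ∈ (Icc 1 N).filter (fun x => κ ∣ x),
          (#(above M (a * x) b N) : ℝ) - F a b) := by rw [hgκ]; ring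
    rw [h5, abs_mul, abs_of_nonneg (by positivity)]
    refine (mul_le_mul_of_nonneg_left h4 (by positivity)).trans (le_of_eq ?_)
    rw [hgκ]; ring
  have h2 : |∑ a ∈ Icc 1 N, ∑ b ∈ Icc 1 N, (Nat.gcd a (Nat.gcd b d) : ℝ) / d * F a b -
        sigmaDens 1 d * ∑ a ∈ Icc 1 N, ∑ b ∈ Icc 1 N, F a b| ≤
          2 * (N : ℝ) ^ 3 * (#d.divisors : ℝ) / d := by
    have e1 : ∀ a ∈ Icc 1 N, ∀ b ∈ Icc 1 N, (Nat.gcd a (Nat.gcd b d) : ℝ) / d * F a b =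
        (∑ r ∈ d.divisors, (r.totient : ℝ) *
          (if r ∣ a then (if r ∣ b then F a b else 0) else 0)) / d := by
      intro a _ b _
      rw [← Nat.gcd_assoc, gcd_eq_sum_totient hd.ne', div_mul_eq_mul_div]
      push_cast
      rw [sum_mul]
      congr 1
      refine sum_congr rfl fun r _ => ?_
      by_cases h1 : r ∣ a <;> by_cases h2 : r ∣ b <;> simp [h1, h2, Nat.dvd_gcd_iff]
    have e2 : ∑ a ∈ Icc 1 N, ∑ b ∈ Icc 1 N, (Nat.gcd a (Nat.gcd b d) : ℝ) / d * F a b =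
        (∑ r ∈ d.divisors, (r.totient : ℝ) * ∑ a ∈ (Icc 1 N).filter (fun a => r ∣ a),
          ∑ b ∈ (Icc 1 N).filter (fun b => r ∣ b), F a b) / d := by
      rw [sum_congr rfl fun a ha => sum_congr rfl fun b hb => e1 a ha b hb]
      simp_rw [← sum_div]
      congr 1
      rw [sum_congr rfl fun a _ => sum_comm, sum_comm]
      refine sum_congr rfl fun r _ => ?_
      simp_rw [← mul_sum]
      congr 1
      rw [sum_filter]
      refine sum_congr rfl fun a _ => ?_
      rw [sum_filter]
      split_ifs <;> simp
    have h3 : ∑ a ∈ Icc 1 N, ∑ b ∈ Icc 1 N, (Nat.gcd a (Nat.gcd b d) : ℝ) / d * F a b -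
        sigmaDens 1 d * ∑ a ∈ Icc 1 N, ∑ b ∈ Icc 1 N, F a b = (∑ r ∈ d.divisors,
          (r.totient : ℝ) / r ^ 2 * ((r : ℝ) ^ 2 * (∑ a ∈ (Icc 1 N).filter (fun a => r ∣ a),
          ∑ b ∈ (Icc 1 N).filter (fun b => r ∣ b), F a b) -
            ∑ a ∈ Icc 1 N, ∑ b ∈ Icc 1 N, F a b)) / d := by
      rw [e2, sigmaDens, div_mul_eq_mul_div, ← sub_div, sum_mul, ← sum_sub_distrib]
      congr 1
      refine sum_congr rfl fun r hr => ?_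
      have hr0 : (r : ℝ) ≠ 0 := by
        have := Nat.pos_of_mem_divisors hr
        positivity
      rw [pow_one, if_pos (Nat.dvd_of_mem_divisors hr)]
      field_simp
    rw [h3, abs_div, abs_of_pos hd']
    apply div_le_div_of_nonneg_right _ hd'.le
    refine (abs_sum_le_sum_abs _ _).trans ?_
    rw [mul_comm, ← nsmul_eq_mul, ← sum_const]
    refine sum_le_sum fun r hr => ?_
    have hr0 := Nat.pos_of_mem_divisors hr
    have hr0' : (0 : ℝ) < r := by exact_mod_cast hr0
    rw [abs_mul, abs_of_nonneg (by positivity)]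
    have h4 := abs_sum_sum_filter_dvd_sub_le hm1 hm2 hF0 hr0 hFN
    have hφ : (r.totient : ℝ) ≤ r := by exact_mod_cast Nat.totient_le r
    calc _ ≤ (r.totient : ℝ) / r ^ 2 * (2 * (r * N * (N : ℝ) ^ 2)) :=
          mul_le_mul_of_nonneg_left h4 (by positivity)
      _ ≤ (r : ℝ) / r ^ 2 * (2 * (r * N * (N : ℝ) ^ 2)) := by gcongr
      _ = _ := by field_simp
  have h3 : totalAbove (Icc 1 N) (fun a x => a * x) M N = ∑ a ∈ Icc 1 N, ∑ b ∈ Icc 1 N, F a b :=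
    sum_congr rfl fun a _ => sum_comm
  have h4 : |densSum (Icc 1 N) (fun a x => a * x) (fun a x => a * x) d M N -
      ∑ a ∈ Icc 1 N, ∑ b ∈ Icc 1 N, (Nat.gcd a (Nat.gcd b d) : ℝ) / d * F a b| ≤
        (N : ℝ) ^ 3 * (#d.divisors : ℝ) / d := by
    rw [densSum, ← sum_sub_distrib]
    have e1 : ∀ a ∈ Icc 1 N, |∑ x ∈ Icc 1 N, ∑ b ∈ Icc 1 N, dens d (a * x) b *
        (#(above M (a * x) b N) : ℝ) - ∑ b ∈ Icc 1 N, (Nat.gcd a (Nat.gcd b d) : ℝ) / d * F a b| ≤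
          (N : ℝ) ^ 2 * (#d.divisors : ℝ) / d := by
      intro a ha
      rw [sum_comm, ← sum_sub_distrib]
      refine (abs_sum_le_sum_abs _ _).trans ((sum_le_sum (h1 a ha)).trans ?_)
      rw [← sum_mul, ← sum_div]
      have := sum_gcd_le hd.ne' N
      calc _ ≤ (N * (#d.divisors : ℝ)) / d * N := by gcongr
        _ = _ := by ring
    refine (abs_sum_le_sum_abs _ _).trans ((sum_le_sum e1).trans (le_of_eq ?_))
    rw [sum_const, nsmul_eq_mul, Nat.card_Icc, Nat.add_sub_cancel]
    ring
  rw [h3]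
  have h5 : 3 * (N : ℝ) ^ 3 * (#d.divisors : ℝ) / d =
    (N : ℝ) ^ 3 * (#d.divisors : ℝ) / d + 2 * (N : ℝ) ^ 3 * (#d.divisors : ℝ) / d := by ring
  rw [h5]
  exact (abs_sub_le _ _ _).trans (add_le_add h4 h2)

/-! ### The hyperbola method -/

/-- The involution `d ↦ n / d` exchanges `d² > n` and `d² < n`; the latter is written `d² + 1 ≤ n`,
so that both halves have the shape `M ≤ n` used in `above`. -/
lemma card_divisors_eq {n D : ℕ} (hn : 0 < n) (hD : n ≤ D ^ 2) :
    #n.divisors = #((Icc 1 D).filter fun d => d ^ 2 ≤ n ∧ d ∣ n) +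
      #((Icc 1 D).filter fun d => d ^ 2 + 1 ≤ n ∧ d ∣ n) := by
  have hle : ∀ d, d ^ 2 ≤ n → d ≤ D := fun d hd => by
    rw [← Nat.pow_le_pow_iff_left two_ne_zero]
    exact hd.trans hD
  rw [← card_filter_add_card_filter_not (s := n.divisors) (fun d => d ^ 2 ≤ n)]
  congr 1
  · congr 1
    ext d
    simp only [mem_filter, Nat.mem_divisors, mem_Icc]
    constructor
    · rintro ⟨⟨h1, h2⟩, h3⟩
      exact ⟨⟨Nat.pos_of_dvd_of_pos h1 hn, hle d h3⟩, h3, h1⟩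
    · rintro ⟨_, h3, h1⟩
      exact ⟨⟨h1, hn.ne'⟩, h3⟩
  · have hdiv : ∀ d, d ∣ n → (n < d ^ 2 ↔ (n / d) ^ 2 + 1 ≤ n) := by
      rintro d ⟨e, rfl⟩
      have hd : 0 < d := Nat.pos_of_mul_pos_right hn
      have he : 0 < e := Nat.pos_of_mul_pos_left hn
      rw [Nat.mul_div_cancel_left _ hd, Nat.succ_le_iff, sq, sq, Nat.mul_lt_mul_left hd,
        Nat.mul_lt_mul_right he]
    refine card_nbij' (fun d => n / d) (fun d => n / d) ?_ ?_ ?_ ?_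
    · intro d hd
      simp only [coe_filter, Nat.mem_divisors, Set.mem_ofPred_eq, not_le, mem_Icc] at hd ⊢
      have h1 := (hdiv d hd.1.1).1 hd.2
      have h2 := Nat.div_dvd_of_dvd hd.1.1
      exact ⟨⟨Nat.pos_of_dvd_of_pos h2 hn, hle _ (by omega)⟩, h1, h2⟩
    · intro d hd
      simp only [coe_filter, Nat.mem_divisors, Set.mem_ofPred_eq, not_le, mem_Icc] at hd ⊢
      have h2 := Nat.div_dvd_of_dvd hd.2.2
      refine ⟨⟨h2, hn.ne'⟩, ?_⟩
      rw [hdiv _ h2, Nat.div_div_self hd.2.2 hn.ne']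
      exact hd.2.1
    · intro d hd
      simp only [coe_filter, Nat.mem_divisors, Set.mem_ofPred_eq] at hd
      exact Nat.div_div_self hd.1.1 hn.ne'
    · intro d hd
      simp only [coe_filter, Set.mem_ofPred_eq] at hd
      exact Nat.div_div_self hd.2.2 hn.ne'

/-- The sum of the number of divisors of `P a x + b t`. -/
noncomputable def tauSum (A : Finset ℕ) (P : ℕ → ℕ → ℕ) (N : ℕ) : ℝ :=
  ∑ a ∈ A, ∑ x ∈ Icc 1 N, ∑ b ∈ Icc 1 N, ∑ t ∈ Icc 1 N, (#(P a x + b * t).divisors : ℝ)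

lemma sum_hitSum (A : Finset ℕ) (P : ℕ → ℕ → ℕ) (D N : ℕ) (M : ℕ → ℕ) :
    ∑ d ∈ Icc 1 D, hitSum A P P d (M d) N = ∑ a ∈ A, ∑ x ∈ Icc 1 N, ∑ b ∈ Icc 1 N, ∑ t ∈ Icc 1 N,
      (#((Icc 1 D).filter fun d => M d ≤ P a x + b * t ∧ d ∣ P a x + b * t) : ℝ) := by
  simp only [hitSum]
  rw [sum_comm]
  refine sum_congr rfl fun a _ => ?_
  rw [sum_comm]
  refine sum_congr rfl fun x _ => ?_
  rw [sum_comm]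
  refine sum_congr rfl fun b _ => ?_
  simp only [above, sum_filter]
  rw [sum_comm]
  refine sum_congr rfl fun t _ => ?_
  rw [card_filter]
  push_cast
  refine sum_congr rfl fun d _ => ?_
  by_cases h1 : M d ≤ P a x + b * t <;> by_cases h2 : d ∣ P a x + b * t <;> simp [h1, h2]

lemma tauSum_eq (A : Finset ℕ) (P : ℕ → ℕ → ℕ) (N : ℕ)
    (hP : ∀ a ∈ A, ∀ x ∈ Icc 1 N, P a x ≤ N ^ 2) :
    tauSum A P N = ∑ d ∈ Icc 1 (2 * N), hitSum A P P d (d ^ 2) N +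
      ∑ d ∈ Icc 1 (2 * N), hitSum A P P d (d ^ 2 + 1) N := by
  rw [sum_hitSum, sum_hitSum, tauSum]
  simp_rw [← sum_add_distrib]
  refine sum_congr rfl fun a ha => sum_congr rfl fun x hx => sum_congr rfl fun b hb =>
    sum_congr rfl fun t ht => ?_
  have h1 := hP a ha x hx
  rw [mem_Icc] at hb ht
  have h2 : 0 < b * t := Nat.mul_pos hb.1 ht.1
  have h3 : b * t ≤ N * N := Nat.mul_le_mul hb.2 ht.2
  -- Here `n ≤ 2 N² ≤ (2 N)²`, so `D = 2 N` is large enough.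
  exact_mod_cast card_divisors_eq (D := 2 * N) (by omega) (by nlinarith)

lemma sum_totalAbove (A : Finset ℕ) (P : ℕ → ℕ → ℕ) (D N : ℕ) (M : ℕ → ℕ) (σ : ℕ → ℝ) :
    ∑ d ∈ Icc 1 D, σ d * totalAbove A P (M d) N =
      ∑ a ∈ A, ∑ x ∈ Icc 1 N, ∑ b ∈ Icc 1 N, ∑ t ∈ Icc 1 N,
        ∑ d ∈ (Icc 1 D).filter (fun d => M d ≤ P a x + b * t), σ d := by
  simp only [totalAbove, mul_sum]
  rw [sum_comm]
  refine sum_congr rfl fun a _ => ?_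
  rw [sum_comm]
  refine sum_congr rfl fun x _ => ?_
  rw [sum_comm]
  refine sum_congr rfl fun b _ => ?_
  simp only [above, card_filter, sum_filter]
  push_cast
  simp only [mul_sum]
  rw [sum_comm]
  refine sum_congr rfl fun t _ => sum_congr rfl fun d _ => ?_
  split_ifs <;> simp

lemma sum_filter_dvd_Icc {M : Type*} [AddCommMonoid M] {q : ℕ} (hq : 0 < q) (n : ℕ) (f : ℕ → M) :
    ∑ d ∈ (Icc 1 n).filter (fun d => q ∣ d), f d = ∑ m ∈ Icc 1 (n / q), f (q * m) := by
  symm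
  refine sum_nbij (fun m => q * m) ?_ ?_ ?_ ?_
  · intro m hm
    simp only [mem_filter, mem_Icc] at hm ⊢
    exact ⟨⟨Nat.mul_pos hq hm.1, (Nat.mul_le_mul_left q hm.2).trans (Nat.mul_div_le n q)⟩,
      dvd_mul_right _ _⟩
  · intro i _ j _ hij
    exact Nat.eq_of_mul_eq_mul_left hq hij
  · intro d hd
    simp only [coe_filter, mem_Icc, Set.mem_ofPred_eq] at hd
    obtain ⟨⟨h1, h2⟩, m, rfl⟩ := hd
    refine ⟨m, ?_, rfl⟩
    simp only [coe_Icc, Set.mem_Icc]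
    exact ⟨Nat.pos_of_mul_pos_left h1, (Nat.le_div_iff_mul_le hq).2 (by rwa [mul_comm])⟩
  · intros; rfl

/-! ### Summing the error over `d` -/

/-- Writing `d = r m` for each divisor `r` bounds the sum by the square of a harmonic sum. -/
lemma sum_card_divisors_div_le (D : ℕ) :
    ∑ d ∈ Icc 1 D, (#d.divisors : ℝ) / d ≤ (1 + Real.log D) ^ 2 := by
  have h1 : ∀ d ∈ Icc 1 D, (#d.divisors : ℝ) / d =
      ∑ r ∈ Icc 1 D, if r ∣ d then 1 / (d : ℝ) else 0 := by
    intro d hd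
    rw [← sum_filter, sum_const, nsmul_eq_mul, mul_one_div]
    congr 3
    ext r
    simp only [Nat.mem_divisors, mem_filter, mem_Icc] at hd ⊢
    constructor
    · rintro ⟨h, _⟩
      exact ⟨⟨Nat.pos_of_dvd_of_pos h hd.1, (Nat.le_of_dvd hd.1 h).trans hd.2⟩, h⟩
    · rintro ⟨_, h⟩
      exact ⟨h, by omega⟩
  have h0 : 0 ≤ ∑ m ∈ Icc 1 D, 1 / (m : ℝ) := sum_nonneg fun _ _ => by positivity
  calc _ = ∑ r ∈ Icc 1 D, ∑ m ∈ Icc 1 (D / r), 1 / ((r * m : ℕ) : ℝ) := by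
        rw [sum_congr rfl h1, sum_comm]
        refine sum_congr rfl fun r hr => ?_
        rw [← sum_filter, sum_filter_dvd_Icc (mem_Icc.1 hr).1]
    _ ≤ ∑ r ∈ Icc 1 D, ∑ m ∈ Icc 1 D, 1 / (r : ℝ) * (1 / m) := by
        refine sum_le_sum fun r _ => ?_
        calc _ = ∑ m ∈ Icc 1 (D / r), 1 / (r : ℝ) * (1 / m) := by
              refine sum_congr rfl fun m _ => ?_
              push_cast
              rw [one_div_mul_one_div]
          _ ≤ _ := sum_le_sum_of_subset_of_nonneg (Icc_subset_Icc_right (Nat.div_le_self D r))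
              (fun _ _ _ => by positivity)
    _ = (∑ r ∈ Icc 1 D, 1 / (r : ℝ)) ^ 2 := by
        rw [sq, sum_mul_sum]
    _ ≤ _ := pow_le_pow_left₀ h0 (sum_inv_le_one_add_log D) 2

lemma card_divisors_pos {d : ℕ} (hd : 0 < d) : (1 : ℝ) ≤ #d.divisors := by
  exact_mod_cast card_pos.2 ⟨1, Nat.one_mem_divisors.2 hd.ne'⟩

set_option maxHeartbeats 800000 in
/-- Sum over `d ≤ 2 N` of the errors in counting the solutions of `d ∣ P a x + b t`. -/
theorem sum_abs_hitSum_sub_le {A : Finset ℕ} {P : ℕ → ℕ → ℕ} {k N : ℕ} (hN : 0 < N)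
    (hP : ∀ a, Monotone (P a))
    (hcoll : ∀ d K : ℕ, 0 < d → 0 < K → K ≤ N →
      collisions A P d N K ≤ #A * N * (1 + 6 * (K * (#d.divisors : ℝ) / d)))
    (hdens : ∀ d M : ℕ, 0 < d → d ≤ 2 * N → |densSum A P P d M N - sigmaDens k d *
      totalAbove A P M N| ≤ 3 * #A * (N : ℝ) ^ 2 * (N : ℝ) ^ (2 / 3 : ℝ) * (#d.divisors : ℝ) / d)
    (M : ℕ → ℕ) :
    |∑ d ∈ Icc 1 (2 * N), hitSum A P P d (M d) N -
        ∑ d ∈ Icc 1 (2 * N), sigmaDens k d * totalAbove A P (M d) N| ≤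
      100 * (#A * (N : ℝ) ^ 2 * (N : ℝ) ^ (2 / 3 : ℝ) * (1 + Real.log (2 * N)) ^ 3) := by
  have hN1 : (1 : ℝ) ≤ N := by exact_mod_cast hN
  have hN0 : (0 : ℝ) < N := by linarith
  set κ : ℝ := (N : ℝ) ^ (2 / 3 : ℝ) with hκ
  set ℓ : ℝ := 1 + Real.log (2 * N) with hℓ
  have hℓ1 : 1 ≤ ℓ := by
    have : 0 ≤ Real.log (2 * N) := Real.log_nonneg (by linarith)
    linarith
  have hκ1 : 1 ≤ κ := Real.one_le_rpow hN1 (by norm_num)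
  have hκN : κ ≤ N := by
    calc κ ≤ (N : ℝ) ^ (1 : ℝ) := Real.rpow_le_rpow_of_exponent_le hN1 (by norm_num)
      _ = N := Real.rpow_one _
  have hκs : √N ≤ κ := by
    rw [Real.sqrt_eq_rpow]
    exact Real.rpow_le_rpow_of_exponent_le hN1 (by norm_num)
  set K : ℕ := ⌈κ⌉₊ with hK
  have hKκ : κ ≤ K := Nat.le_ceil κ
  have hK2 : (K : ℝ) ≤ 2 * κ := by
    have := Nat.ceil_lt_add_one (by linarith : 0 ≤ κ)
    linarith
  have hK0 : 0 < K := Nat.ceil_pos.2 (by linarith)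
  have hKN : K ≤ N := Nat.ceil_le.2 hκN
  have hKr : (0 : ℝ) < K := by exact_mod_cast hK0
  have hKN' : (K : ℝ) ≤ N := by exact_mod_cast hKN
  have hNK : (N : ℝ) / √K ≤ κ := by
    have h1 : √κ ≤ √K := Real.sqrt_le_sqrt hKκ
    have h2 : κ * √κ = N := by
      rw [Real.sqrt_eq_rpow, hκ, ← Real.rpow_mul hN0.le, ← Real.rpow_add hN0]
      norm_num
    rw [div_le_iff₀ (Real.sqrt_pos.2 hKr)]
    calc (N : ℝ) = κ * √κ := h2.symm
      _ ≤ κ * √K := by gcongr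
  have key : ∀ d ∈ Icc 1 (2 * N), |hitSum A P P d (M d) N -
      sigmaDens k d * totalAbove A P (M d) N| ≤
        #A * (N : ℝ) ^ 2 * ℓ * (6 / √K) +
          #A * (N : ℝ) ^ 2 * κ * ℓ * (53 * ((#d.divisors : ℝ) / d)) := by
    intro d hd
    rw [mem_Icc] at hd
    have hd0 : 0 < d := hd.1
    have hd' : (0 : ℝ) < d := by exact_mod_cast hd0
    have hd2 : (d : ℝ) ≤ 2 * N := by exact_mod_cast hd.2
    have hτ := card_divisors_pos hd0
    set τ : ℝ := (#d.divisors : ℝ) with hτdef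
    have h1 := abs_hitSum_sub_densSum_le A hP hd0 hK0 (M d) N
    have h2 := hdens d (M d) hd0 hd.2
    have hc := hcoll d K hd0 hK0 hKN
    have h3 : √(#A * (N / K + 1 : ℕ) * collisions A P d N K) ≤
        #A * N * (2 / √K + 4 * (τ / √d)) := by
      have e1 : ((N / K + 1 : ℕ) : ℝ) ≤ 2 * (N / K) := by
        have : ((N / K : ℕ) : ℝ) ≤ N / K := Nat.cast_div_le
        have h' : (1 : ℝ) ≤ N / K := by rw [le_div_iff₀ hKr]; linarith
        push_cast
        linarith
      rw [Real.sqrt_le_left (by positivity)]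
      have hsK : √(K : ℝ) ^ 2 = K := Real.sq_sqrt hKr.le
      have hsd : √(d : ℝ) ^ 2 = d := Real.sq_sqrt hd'.le
      have hsK0 : 0 < √(K : ℝ) := Real.sqrt_pos.2 hKr
      have hsd0 : 0 < √(d : ℝ) := Real.sqrt_pos.2 hd'
      calc #A * ((N / K + 1 : ℕ) : ℝ) * collisions A P d N K
          ≤ #A * (2 * (N / K)) * (#A * N * (1 + 6 * (K * τ / d))) := by
            apply mul_le_mul _ hc
            · exact sum_nonneg fun _ _ => by positivity
            · positivity
            · gcongr
        _ = (#A * N) ^ 2 * (2 / K + 12 * (τ / d)) := by field_simp; ring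
        _ ≤ (#A * N) ^ 2 * (2 / √K + 4 * (τ / √d)) ^ 2 := by
            apply mul_le_mul_of_nonneg_left _ (by positivity)
            have e2 : (2 / √(K : ℝ)) ^ 2 = 4 / K := by rw [div_pow, hsK]; norm_num
            have e3 : (4 * (τ / √(d : ℝ))) ^ 2 = 16 * (τ * (τ / d)) := by
              rw [mul_pow, div_pow, hsd]; ring
            have e4 : 0 ≤ τ / d := by positivity
            have e5 : 0 ≤ (2 / √(K : ℝ)) * (4 * (τ / √d)) := by positivity
            have e6 : 2 / (K : ℝ) ≤ 4 / K := by gcongr; norm_num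
            -- Because `τ ≥ 1`, the term `12 τ / d` fits under the square of `4 τ / √d`, which
            -- removes the square root without a cross term.
            have e7 : τ / d ≤ τ * (τ / d) := le_mul_of_one_le_left e4 hτ
            nlinarith
        _ = _ := by ring
    have h4 : ((N : ℝ) + d) * (1 + Real.log d) ≤ 3 * N * ℓ := by
      have : Real.log d ≤ Real.log (2 * N) := Real.log_le_log hd' hd2
      have h0 : 0 ≤ Real.log d := Real.log_natCast_nonneg d
      apply mul_le_mul <;> linarith
    -- As `√d ≤ 2 √N`, a power of `d` is traded for `κ`, and every error of this kind becomes a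
    -- multiple of `τ(d) / d`, whose sum over `d` is logarithmic.
    have h5 : τ / √d ≤ 4 * κ * (τ / d) := by
      have hsd : √(d : ℝ) * √d = d := Real.mul_self_sqrt hd'.le
      have hsd0 : 0 < √(d : ℝ) := Real.sqrt_pos.2 hd'
      have e1 : √(d : ℝ) ≤ 4 * κ := by
        calc √(d : ℝ) ≤ √(4 * N) := Real.sqrt_le_sqrt (by linarith)
          _ = 2 * √N := by
            rw [Real.sqrt_mul (by norm_num), show (4 : ℝ) = 2 ^ 2 by norm_num,
              Real.sqrt_sq (by norm_num)]
          _ ≤ _ := by linarith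
      calc τ / √d = √d * (τ / d) := by
            rw [div_eq_iff hsd0.ne', mul_right_comm, hsd, mul_div_cancel₀ _ hd'.ne']
        _ ≤ _ := by gcongr
    have h6 : √(#A * (N / K + 1 : ℕ) * collisions A P d N K) * ((N + d) * (1 + Real.log d)) ≤
        #A * N * (2 / √K + 4 * (4 * κ * (τ / d))) * (3 * N * ℓ) := by
      apply mul_le_mul _ h4
      · have : 0 ≤ Real.log d := Real.log_natCast_nonneg d
        positivity
      · positivity
      · refine h3.trans ?_
        gcongr
    have h7 : #A * (N : ℝ) ^ 2 * K * τ / d ≤ #A * (N : ℝ) ^ 2 * κ * ℓ * (2 * (τ / d)) := by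
      calc #A * (N : ℝ) ^ 2 * K * τ / d = #A * (N : ℝ) ^ 2 * K * 1 * (τ / d) := by ring
        _ ≤ #A * (N : ℝ) ^ 2 * (2 * κ) * ℓ * (τ / d) := by gcongr
        _ = _ := by ring
    have h8 : 3 * #A * (N : ℝ) ^ 2 * κ * τ / d ≤ #A * (N : ℝ) ^ 2 * κ * ℓ * (3 * (τ / d)) := by
      calc 3 * #A * (N : ℝ) ^ 2 * κ * τ / d = #A * (N : ℝ) ^ 2 * κ * 1 * (3 * (τ / d)) := by ring
        _ ≤ _ := by gcongr
    refine (abs_sub_le _ (densSum A P P d (M d) N) _).trans ((add_le_add h1 h2).trans ?_)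
    have h9 : #A * N * (2 / √K + 4 * (4 * κ * (τ / d))) * (3 * N * ℓ) =
      #A * (N : ℝ) ^ 2 * ℓ * (6 / √K) + #A * (N : ℝ) ^ 2 * κ * ℓ * (48 * (τ / d)) := by ring
    -- The constant `53` collects `48` from the coincidences, `2` from the freezing and `3` from
    -- `hdens`.
    have h10 : #A * (N : ℝ) ^ 2 * κ * ℓ * (53 * (τ / d)) =
        #A * (N : ℝ) ^ 2 * κ * ℓ * (48 * (τ / d)) + #A * (N : ℝ) ^ 2 * κ * ℓ * (2 * (τ / d)) +
        #A * (N : ℝ) ^ 2 * κ * ℓ * (3 * (τ / d)) := by ring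
    linarith
  rw [← sum_sub_distrib]
  refine (abs_sum_le_sum_abs _ _).trans ((sum_le_sum key).trans ?_)
  rw [sum_add_distrib, ← mul_sum, ← mul_sum, sum_const, Nat.card_Icc, nsmul_eq_mul,
    Nat.add_sub_cancel]
  have hT := sum_card_divisors_div_le (2 * N)
  push_cast at hT ⊢
  have e1 : 2 * (N : ℝ) * (#A * (N : ℝ) ^ 2 * ℓ * (6 / √K)) =
      12 * (#A * (N : ℝ) ^ 2 * ℓ * (N / √K)) := by ring
  have e2 : #A * (N : ℝ) ^ 2 * ℓ * (N / √K) ≤ #A * (N : ℝ) ^ 2 * ℓ * κ := by gcongr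
  have e3 : #A * (N : ℝ) ^ 2 * ℓ * κ ≤ #A * (N : ℝ) ^ 2 * κ * ℓ ^ 3 := by
    calc #A * (N : ℝ) ^ 2 * ℓ * κ = #A * (N : ℝ) ^ 2 * κ * (ℓ * 1) := by ring
      _ ≤ #A * (N : ℝ) ^ 2 * κ * (ℓ * ℓ ^ 2) := by
        have : 1 ≤ ℓ ^ 2 := one_le_pow₀ hℓ1
        gcongr
      _ = _ := by ring
  have e4 : #A * (N : ℝ) ^ 2 * κ * ℓ * (53 * ∑ d ∈ Icc 1 (2 * N), (#d.divisors : ℝ) / d) ≤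
      #A * (N : ℝ) ^ 2 * κ * ℓ * (53 * ℓ ^ 2) := by gcongr
  have e5 : #A * (N : ℝ) ^ 2 * κ * ℓ * (53 * ℓ ^ 2) = 53 * (#A * (N : ℝ) ^ 2 * κ * ℓ ^ 3) := by ring
  have e6 : 0 ≤ #A * (N : ℝ) ^ 2 * κ * ℓ ^ 3 := by positivity
  rw [← mul_sum]
  linarith

/-! ### Summing the density over `d` -/

lemma one_add_log_le_two_sqrt {x : ℝ} (hx : 0 < x) : 1 + Real.log x ≤ 2 * √x := by
  have h1 : Real.log x = 2 * Real.log √x := by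
    rw [Real.log_sqrt hx.le]; ring
  have h2 := Real.log_le_sub_one_of_pos (Real.sqrt_pos.2 hx)
  have h3 := Real.sqrt_nonneg x
  rw [h1]
  linarith

/-- The range `y < 1`, where the sum is empty, is included on purpose: there `1 / √y` dominates
`|log y|`. The estimate can therefore be inserted at `T / r ^ k` for every `r ≥ 1`. -/
lemma abs_sum_inv_floor_sub_le {y : ℝ} (hy : 0 < y) :
    |∑ m ∈ Icc 1 ⌊y⌋₊, 1 / (m : ℝ) - Real.log y - Real.eulerMascheroniConstant| ≤ 3 / √y := by
  have hs : 0 < √y := Real.sqrt_pos.2 hy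
  rcases lt_or_ge y 1 with h | h
  · rw [Nat.floor_eq_zero.2 h]
    have h1 : (1 : ℝ) ≤ 1 / √y := by
      rw [le_div_iff₀ hs, one_mul, Real.sqrt_le_one]
      exact h.le
    have h2 : Real.log y ≤ 0 := Real.log_nonpos hy.le h.le
    have h3 : -Real.log y ≤ 2 / √y - 1 := by
      have := one_add_log_le_two_sqrt (inv_pos.2 hy)
      rw [Real.log_inv, Real.sqrt_inv] at this
      rw [div_eq_mul_inv]; linarith
    have h4 := Real.one_half_lt_eulerMascheroniConstant
    have h5 := Real.eulerMascheroniConstant_lt_two_thirds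
    have h6 : 3 / √y = 1 / √y + 2 / √y := by ring
    simp only [Icc_eq_empty_of_lt zero_lt_one, sum_empty]
    rw [abs_le]
    constructor <;> linarith
  · set n := ⌊y⌋₊ with hn
    have hn1 : 1 ≤ n := Nat.one_le_floor_iff _ |>.2 h
    have hn0 : (0 : ℝ) < n := by exact_mod_cast hn1
    have hny : (n : ℝ) ≤ y := Nat.floor_le hy.le
    have hyn : y < n + 1 := Nat.lt_floor_add_one y
    have h1 := Real.eulerMascheroniSeq_lt_eulerMascheroniConstant n
    have h2 := Real.eulerMascheroniConstant_lt_eulerMascheroniSeq' n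
    rw [Real.eulerMascheroniSeq] at h1
    rw [Real.eulerMascheroniSeq', if_neg (by omega)] at h2
    have h3 : ((harmonic n : ℚ) : ℝ) = ∑ m ∈ Icc 1 n, 1 / (m : ℝ) := by
      rw [harmonic_eq_sum_Icc]; simp
    rw [h3] at h1 h2
    have h4 : Real.log (n + 1) - Real.log n ≤ 1 / n := by
      rw [← Real.log_div (by positivity) (by positivity)]
      have := Real.log_le_sub_one_of_pos (x := (n + 1 : ℝ) / n) (by positivity)
      refine this.trans (le_of_eq ?_)
      field_simp
      ring
    have h5 : Real.log n ≤ Real.log y := Real.log_le_log hn0 hny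
    have h6 : Real.log y ≤ Real.log (n + 1) := Real.log_le_log hy hyn.le
    have h7 : 1 / (n : ℝ) ≤ 3 / √y := by
      rw [div_le_div_iff₀ hn0 hs]
      have : √y ≤ y := by
        rw [Real.sqrt_le_left hy.le]
        nlinarith
      have : (1 : ℝ) ≤ n := by exact_mod_cast hn1
      linarith
    rw [abs_le]
    constructor <;> linarith

/-- `∑ φ(r) / r^(k+2)`. -/
noncomputable def sigL (k : ℕ) : ℝ := ∑' r : ℕ, (r.totient : ℝ) / r ^ (k + 2)

/-- `k ∑ φ(r) log r / r^(k+2)`. -/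
noncomputable def sigM (k : ℕ) : ℝ := ∑' r : ℕ, (r.totient : ℝ) / r ^ (k + 2) * (k * Real.log r)

lemma totient_div_pow_le {k r : ℕ} (hr : 0 < r) :
    (r.totient : ℝ) / r ^ (k + 2) ≤ 1 / (r : ℝ) ^ (k + 1) := by
  have hr' : (0 : ℝ) < r := by exact_mod_cast hr
  have hφ : (r.totient : ℝ) ≤ r := by exact_mod_cast Nat.totient_le r
  rw [div_le_div_iff₀ (by positivity) (by positivity), one_mul, pow_succ _ (k + 1), mul_comm]
  gcongr

/-- The factor `√(r ^ k)` is the loss when the harmonic estimate is used at `T / r ^ k` instead of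
`T`; the weight still decays like `r^(-3/2)`. The same bound makes the series defining `sigL` and
`sigM` converge. -/
lemma totient_div_pow_mul_sqrt_le {k : ℕ} (hk : 1 ≤ k) (r : ℕ) :
    (r.totient : ℝ) / r ^ (k + 2) * √((r : ℝ) ^ k) ≤ (r : ℝ) ^ (-(3 / 2) : ℝ) := by
  rcases Nat.eq_zero_or_pos r with rfl | hr
  · simp [Real.zero_rpow (by norm_num : (-(3 / 2) : ℝ) ≠ 0)]
  have hr' : (0 : ℝ) < r := by exact_mod_cast hr
  have hr1 : (1 : ℝ) ≤ r := by exact_mod_cast hr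
  calc (r.totient : ℝ) / r ^ (k + 2) * √((r : ℝ) ^ k) ≤ 1 / (r : ℝ) ^ (k + 1) * √((r : ℝ) ^ k) := by
        exact mul_le_mul_of_nonneg_right (totient_div_pow_le hr) (Real.sqrt_nonneg _)
    _ = (r : ℝ) ^ (-((k : ℝ) + 1) + k / 2) := by
        rw [Real.sqrt_eq_rpow, ← Real.rpow_natCast, ← Real.rpow_natCast, ← Real.rpow_mul hr'.le,
          one_div, ← Real.rpow_neg hr'.le, ← Real.rpow_add hr']
        push_cast
        ring_nf
    _ ≤ _ := by
        apply Real.rpow_le_rpow_of_exponent_le hr1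
        have : (1 : ℝ) ≤ k := by exact_mod_cast hk
        linarith

lemma summable_rpow_neg_three_halves : Summable fun r : ℕ => (r : ℝ) ^ (-(3 / 2) : ℝ) :=
  Real.summable_nat_rpow.2 (by norm_num)

lemma summable_totient_div_pow {k : ℕ} (hk : 1 ≤ k) :
    Summable fun r : ℕ => (r.totient : ℝ) / r ^ (k + 2) := by
  refine Summable.of_nonneg_of_le (fun r => by positivity) (fun r => ?_)
    summable_rpow_neg_three_halves
  refine le_trans ?_ (totient_div_pow_mul_sqrt_le hk r)
  rcases Nat.eq_zero_or_pos r with rfl | hr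
  · simp
  · have hr1 : (1 : ℝ) ≤ r := by exact_mod_cast hr
    apply le_mul_of_one_le_right (by positivity)
    rw [Real.one_le_sqrt]
    exact one_le_pow₀ hr1

lemma summable_totient_div_pow_mul_log {k : ℕ} (hk : 1 ≤ k) :
    Summable fun r : ℕ => (r.totient : ℝ) / r ^ (k + 2) * (k * Real.log r) := by
  refine Summable.of_nonneg_of_le (fun r => ?_) (fun r => ?_)
    (summable_rpow_neg_three_halves.mul_left (2 * k : ℝ))
  · have := Real.log_natCast_nonneg r
    positivity
  · have h1 := totient_div_pow_mul_sqrt_le hk r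
    rcases Nat.eq_zero_or_pos r with rfl | hr
    · simp [Real.zero_rpow (by norm_num : (-(3 / 2) : ℝ) ≠ 0)]
    have hr' : (0 : ℝ) < r := by exact_mod_cast hr
    have hr1 : (1 : ℝ) ≤ r := by exact_mod_cast hr
    have h2 : √(r : ℝ) ≤ √((r : ℝ) ^ k) :=
      Real.sqrt_le_sqrt (le_self_pow₀ hr1 (by omega))
    have h3 := one_add_log_le_two_sqrt hr'
    calc (r.totient : ℝ) / r ^ (k + 2) * (k * Real.log r)
        ≤ (r.totient : ℝ) / r ^ (k + 2) * (k * (2 * √((r : ℝ) ^ k))) := by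
          gcongr
          linarith
      _ = 2 * k * ((r.totient : ℝ) / r ^ (k + 2) * √((r : ℝ) ^ k)) := by ring
      _ ≤ _ := by gcongr

/-- Substitute `d = r ^ k * m` and exchange the order of summation. -/
lemma sum_sigmaDens_eq {k : ℕ} (hk : 1 ≤ k) (n : ℕ) :
    ∑ d ∈ Icc 1 n, sigmaDens k d = ∑ r ∈ Icc 1 n, (r.totient : ℝ) / r ^ (k + 2) *
      ∑ m ∈ Icc 1 (n / r ^ k), 1 / (m : ℝ) := by
  have h1 : ∀ d ∈ Icc 1 n, sigmaDens k d =
      ∑ r ∈ Icc 1 n, if r ^ k ∣ d then (r.totient : ℝ) / r ^ 2 * (1 / d) else 0 := by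
    intro d hd
    rw [mem_Icc] at hd
    rw [sigmaDens, ← sum_filter, ← sum_filter, sum_div]
    refine sum_congr ?_ fun r _ => by rw [mul_one_div]
    ext r
    simp only [Nat.mem_divisors, mem_filter, mem_Icc]
    constructor
    · rintro ⟨⟨h, _⟩, h2⟩
      exact ⟨⟨Nat.pos_of_dvd_of_pos h hd.1, (Nat.le_of_dvd hd.1 h).trans hd.2⟩, h2⟩
    · rintro ⟨_, h2⟩
      exact ⟨⟨(dvd_pow_self r (by omega)).trans h2, by omega⟩, h2⟩
  rw [sum_congr rfl h1, sum_comm]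
  refine sum_congr rfl fun r hr => ?_
  have hr0 : 0 < r := (mem_Icc.1 hr).1
  have hr' : (0 : ℝ) < r := by exact_mod_cast hr0
  rw [← sum_filter, sum_filter_dvd_Icc (pow_pos hr0 k), mul_sum]
  refine sum_congr rfl fun m _ => ?_
  push_cast
  rw [pow_add]
  field_simp

/-- The harmonic sum up to `T / r ^ k` is `log T - k log r + γ` with error `3 √(r ^ k) / √T`.
Weighted by `φ(r) / r^(k+2)` and summed over all `r`, the main terms give `sigL` and `sigM`, and the
errors converge. -/
lemma exists_abs_sum_sigmaDens_sub_le {k : ℕ} (hk : 1 ≤ k) :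
    ∃ C : ℝ, 0 ≤ C ∧ ∀ T : ℝ, 0 < T → |∑ d ∈ Icc 1 ⌊T⌋₊, sigmaDens k d -
      (sigL k * (Real.log T + Real.eulerMascheroniConstant) - sigM k)| ≤ C / √T := by
  refine ⟨3 * ∑' r : ℕ, (r : ℝ) ^ (-(3 / 2) : ℝ),
    mul_nonneg (by norm_num) (tsum_nonneg fun r => by positivity), fun T hT => ?_⟩
  set w : ℕ → ℝ := fun r => (r.totient : ℝ) / r ^ (k + 2) with hw
  have hw0 : ∀ r, 0 ≤ w r := fun r => by simp only [hw]; positivity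
  set γ := Real.eulerMascheroniConstant with hγ
  have hsT : 0 < √T := Real.sqrt_pos.2 hT
  have h1 : HasSum (fun r : ℕ => w r * ∑ m ∈ Icc 1 ⌊T / r ^ k⌋₊, 1 / (m : ℝ))
      (∑ d ∈ Icc 1 ⌊T⌋₊, sigmaDens k d) := by
    rw [sum_sigmaDens_eq hk]
    have e1 : ∀ r ∈ Icc 1 ⌊T⌋₊, (r.totient : ℝ) / r ^ (k + 2) *
        ∑ m ∈ Icc 1 (⌊T⌋₊ / r ^ k), 1 / (m : ℝ) =
          w r * ∑ m ∈ Icc 1 ⌊T / r ^ k⌋₊, 1 / (m : ℝ) := by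
      intro r _
      rw [← Nat.floor_div_natCast]
      push_cast
      rfl
    rw [sum_congr rfl e1]
    -- For `r > T` one has `T / r ^ k < 1` and the inner sum is empty, so the finite sum is also the
    -- sum over all `r`.
    apply hasSum_sum_of_ne_finset_zero
    intro r hr
    rcases Nat.eq_zero_or_pos r with rfl | hr0
    · simp [hw]
    · have h2 : ⌊T⌋₊ < r := by
        by_contra h3
        exact hr (mem_Icc.2 ⟨hr0, by omega⟩)
      have hr1 : (1 : ℝ) ≤ r := by exact_mod_cast hr0
      have h3 : ⌊T / r ^ k⌋₊ = 0 := by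
        rw [Nat.floor_eq_zero, div_lt_one (by positivity)]
        calc T < r := (Nat.floor_lt hT.le).1 h2
          _ ≤ (r : ℝ) ^ k := le_self_pow₀ hr1 (by omega)
      rw [h3]
      simp
  have h2 : HasSum (fun r : ℕ => w r * (Real.log T + γ) - w r * (k * Real.log r))
      (sigL k * (Real.log T + γ) - sigM k) :=
    ((summable_totient_div_pow hk).hasSum.mul_right _).sub
      (summable_totient_div_pow_mul_log hk).hasSum
  have h3 := h1.sub h2
  have h4 : ∀ r : ℕ, ‖w r * ∑ m ∈ Icc 1 ⌊T / r ^ k⌋₊, 1 / (m : ℝ) -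
      (w r * (Real.log T + γ) - w r * (k * Real.log r))‖ ≤
        3 / √T * (r : ℝ) ^ (-(3 / 2) : ℝ) := by
    intro r
    rcases Nat.eq_zero_or_pos r with rfl | hr0
    · simp [hw, Real.zero_rpow (by norm_num : (-(3 / 2) : ℝ) ≠ 0)]
    have hr' : (0 : ℝ) < r := by exact_mod_cast hr0
    have e1 := abs_sum_inv_floor_sub_le (y := T / r ^ k) (by positivity)
    rw [Real.log_div hT.ne' (by positivity), Real.log_pow, Real.sqrt_div hT.le] at e1
    have e2 : w r * ∑ m ∈ Icc 1 ⌊T / r ^ k⌋₊, 1 / (m : ℝ) -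
        (w r * (Real.log T + γ) - w r * (k * Real.log r)) = w r *
      (∑ m ∈ Icc 1 ⌊T / r ^ k⌋₊, 1 / (m : ℝ) - (Real.log T - k * Real.log r) - γ) := by ring
    rw [e2, norm_mul, Real.norm_of_nonneg (hw0 r), Real.norm_eq_abs]
    calc _ ≤ w r * (3 / (√T / √((r : ℝ) ^ k))) := mul_le_mul_of_nonneg_left e1 (hw0 r)
      _ = 3 / √T * (w r * √((r : ℝ) ^ k)) := by field_simp
      _ ≤ _ := by
        gcongr
        exact totient_div_pow_mul_sqrt_le hk r
  have h5 := h3.norm_le_of_bounded (summable_rpow_neg_three_halves.mul_left (3 / √T)).hasSum h4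
  rw [Real.norm_eq_abs, tsum_mul_left] at h5
  refine h5.trans (le_of_eq (by ring))

/-- The density is `O(log d / d)`; this crude form is what is needed for the single term `d² = Q`.
-/
lemma sigmaDens_le {k d : ℕ} (hd : 0 < d) : |sigmaDens k d| ≤ 2 / √d := by
  have hd' : (0 : ℝ) < d := by exact_mod_cast hd
  have hs : 0 < √(d : ℝ) := Real.sqrt_pos.2 hd'
  have h0 : 0 ≤ sigmaDens k d := by
    apply div_nonneg (sum_nonneg fun r _ => _) hd'.le
    intro r _
    split_ifs <;> positivity
  rw [abs_of_nonneg h0, sigmaDens, div_le_div_iff₀ hd' hs]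
  have h1 : (∑ r ∈ d.divisors, if r ^ k ∣ d then (r.totient : ℝ) / r ^ 2 else 0) ≤ 2 * √d := by
    calc _ ≤ ∑ r ∈ d.divisors, 1 / (r : ℝ) := by
          refine sum_le_sum fun r hr => ?_
          have hr0 := Nat.pos_of_mem_divisors hr
          split_ifs
          · simpa using totient_div_pow_le (k := 0) hr0
          · positivity
      _ ≤ ∑ r ∈ Icc 1 d, 1 / (r : ℝ) := by
          apply sum_le_sum_of_subset_of_nonneg
          · intro r hr
            exact mem_Icc.2 ⟨Nat.pos_of_mem_divisors hr, Nat.divisor_le hr⟩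
          · intros; positivity
      _ ≤ 1 + Real.log d := sum_inv_le_one_add_log d
      _ ≤ _ := one_add_log_le_two_sqrt hd'
  calc _ ≤ 2 * √(d : ℝ) * √d := by gcongr
    _ = 2 * d := by rw [mul_assoc, Real.mul_self_sqrt hd'.le]

/-- Both sums run over `d ≤ √Q` and differ at most in the term `d² = Q`. Doubling the asymptotics at
`T = √Q` turns `½ log Q` into `log Q`. -/
lemma exists_abs_sum_filter_sigmaDens_sub_le {k : ℕ} (hk : 1 ≤ k) :
    ∃ C : ℝ, 0 ≤ C ∧ ∀ (Q D : ℕ), 0 < Q → Q ≤ D ^ 2 →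
      |∑ d ∈ (Icc 1 D).filter (fun d => d ^ 2 ≤ Q), sigmaDens k d +
        ∑ d ∈ (Icc 1 D).filter (fun d => d ^ 2 + 1 ≤ Q), sigmaDens k d -
      (sigL k * Real.log Q + 2 * (sigL k * Real.eulerMascheroniConstant - sigM k))| ≤
        C / √√(Q : ℝ) := by
  obtain ⟨C, hC, h⟩ := exists_abs_sum_sigmaDens_sub_le hk
  refine ⟨2 * C + 2, by positivity, fun Q D hQ hQD => ?_⟩
  have hQ' : (0 : ℝ) < Q := by exact_mod_cast hQ
  have hs : 0 < √(Q : ℝ) := Real.sqrt_pos.2 hQ'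
  have h1 : (Icc 1 D).filter (fun d => d ^ 2 ≤ Q) = Icc 1 ⌊√(Q : ℝ)⌋₊ := by
    ext d
    simp only [mem_filter, mem_Icc]
    rw [Nat.le_floor_iff hs.le, Real.le_sqrt (by positivity) hQ'.le]
    have h2 : (d : ℝ) ^ 2 ≤ Q ↔ d ^ 2 ≤ Q := by exact_mod_cast Iff.rfl
    rw [h2]
    constructor
    · rintro ⟨⟨h3, _⟩, h4⟩; exact ⟨h3, h4⟩
    · rintro ⟨h3, h4⟩
      refine ⟨⟨h3, ?_⟩, h4⟩
      rw [← Nat.pow_le_pow_iff_left two_ne_zero]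
      exact h4.trans hQD
  have h2 : |∑ d ∈ (Icc 1 D).filter (fun d => d ^ 2 ≤ Q), sigmaDens k d -
      ∑ d ∈ (Icc 1 D).filter (fun d => d ^ 2 + 1 ≤ Q), sigmaDens k d| ≤ 2 / √√(Q : ℝ) := by
    have e1 : (Icc 1 D).filter (fun d => d ^ 2 + 1 ≤ Q) ⊆ (Icc 1 D).filter (fun d => d ^ 2 ≤ Q) := by
      intro d hd
      rw [mem_filter] at hd ⊢
      exact ⟨hd.1, by omega⟩
    rw [← sum_sdiff e1, add_sub_cancel_right]
    have e2 : ∀ d ∈ (Icc 1 D).filter (fun d => d ^ 2 ≤ Q) \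
        (Icc 1 D).filter (fun d => d ^ 2 + 1 ≤ Q), 0 < d ∧ d ^ 2 = Q := by
      intro d hd
      simp only [mem_sdiff, mem_filter, mem_Icc, not_and, not_le] at hd
      have := hd.2 hd.1.1
      exact ⟨hd.1.1.1, by omega⟩
    rcases ((Icc 1 D).filter (fun d => d ^ 2 ≤ Q) \
        (Icc 1 D).filter (fun d => d ^ 2 + 1 ≤ Q)).eq_empty_or_nonempty with h0 | ⟨d, hd⟩
    · rw [h0, sum_empty, abs_zero]; positivity
    · have e3 : (Icc 1 D).filter (fun d => d ^ 2 ≤ Q) \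
        (Icc 1 D).filter (fun d => d ^ 2 + 1 ≤ Q) = {d} := by
        rw [eq_singleton_iff_unique_mem]
        refine ⟨hd, fun d' hd' => ?_⟩
        have := (e2 d' hd').2.trans (e2 d hd).2.symm
        exact Nat.pow_left_injective two_ne_zero this
      rw [e3, sum_singleton]
      refine (sigmaDens_le (e2 d hd).1).trans (le_of_eq ?_)
      rw [← (e2 d hd).2]
      push_cast
      rw [Real.sqrt_sq (by positivity)]
  have h3 := h (√Q) hs
  rw [← h1, Real.log_sqrt hQ'.le] at h3
  have h4 : (2 * C + 2) / √√(Q : ℝ) = 2 * (C / √√Q) + 2 / √√Q := by ring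
  rw [h4]
  set a := ∑ d ∈ (Icc 1 D).filter (fun d => d ^ 2 ≤ Q), sigmaDens k d
  set b := ∑ d ∈ (Icc 1 D).filter (fun d => d ^ 2 + 1 ≤ Q), sigmaDens k d
  have h5 : a + b - (sigL k * Real.log Q + 2 * (sigL k * Real.eulerMascheroniConstant - sigM k)) =
      2 * (a - (sigL k * (Real.log Q / 2 + Real.eulerMascheroniConstant) - sigM k)) - (a - b) := by
    ring
  rw [h5]
  refine (abs_sub _ _).trans ?_
  rw [abs_mul, abs_two]
  linarith

/-! ### Reduction of the divisor sum to a sum of logarithms -/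

/-- The sum of `log (P a x + b t)`. -/
noncomputable def logSum (A : Finset ℕ) (P : ℕ → ℕ → ℕ) (N : ℕ) : ℝ :=
  ∑ a ∈ A, ∑ x ∈ Icc 1 N, ∑ b ∈ Icc 1 N, ∑ t ∈ Icc 1 N, Real.log ((P a x + b * t : ℕ) : ℝ)

lemma sum_one_div_sqrt_le (N : ℕ) : ∑ b ∈ Icc 1 N, 1 / √(b : ℝ) ≤ 2 * √N := by
  induction N with
  | zero => simp
  | succ n ih =>
    rw [sum_Icc_succ_top (by omega)]
    have h0 : (0 : ℝ) ≤ n := by positivity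
    have hs : 0 < √((n : ℝ) + 1) := Real.sqrt_pos.2 (by positivity)
    have h1 : √(n : ℝ) ^ 2 = n := Real.sq_sqrt h0
    have h2 : √((n : ℝ) + 1) ^ 2 = n + 1 := Real.sq_sqrt (by positivity)
    push_cast
    have h3 : 1 / √((n : ℝ) + 1) ≤ 2 * √((n : ℝ) + 1) - 2 * √n := by
      rw [div_le_iff₀ hs]
      nlinarith [sq_nonneg (√((n : ℝ) + 1) - √n)]
    linarith

/-- Since `√(b t) ≥ min b t`, the fourth root is at least the square root of the smaller variable;
the sum on the right is easy to add up over `b` and `t`. -/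
lemma one_div_sqrt_sqrt_mul_le {b t : ℕ} (hb : 0 < b) (ht : 0 < t) {Q : ℝ} (hQ : (b * t : ℝ) ≤ Q) :
    1 / √√Q ≤ 1 / √(b : ℝ) + 1 / √(t : ℝ) := by
  have hb' : (0 : ℝ) < b := by exact_mod_cast hb
  have ht' : (0 : ℝ) < t := by exact_mod_cast ht
  have h1 : √√(b * t : ℝ) ≤ √√Q := Real.sqrt_le_sqrt (Real.sqrt_le_sqrt hQ)
  have h2 : 0 < √√(b * t : ℝ) := by positivity
  refine (one_div_le_one_div_of_le h2 h1).trans ?_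
  rcases le_total b t with h | h
  · refine le_add_of_le_of_nonneg (one_div_le_one_div_of_le (by positivity) ?_) (by positivity)
    apply Real.sqrt_le_sqrt
    apply Real.le_sqrt_of_sq_le
    have : (b : ℝ) ≤ t := by exact_mod_cast h
    nlinarith
  · refine le_add_of_nonneg_of_le (by positivity) (one_div_le_one_div_of_le (by positivity) ?_)
    apply Real.sqrt_le_sqrt
    apply Real.le_sqrt_of_sq_le
    have : (t : ℝ) ≤ b := by exact_mod_cast h
    nlinarith

/-- The asymptotics of `tauSum` in terms of `logSum`. -/
theorem exists_abs_tauSum_sub_le {k : ℕ} (hk : 1 ≤ k) :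
    ∃ C : ℝ, ∀ (A : Finset ℕ) (P : ℕ → ℕ → ℕ) (N : ℕ), 0 < N → (∀ a, Monotone (P a)) →
    (∀ a ∈ A, ∀ x ∈ Icc 1 N, P a x ≤ N ^ 2) →
    (∀ d K : ℕ, 0 < d → 0 < K → K ≤ N →
      collisions A P d N K ≤ #A * N * (1 + 6 * (K * (#d.divisors : ℝ) / d))) →
    (∀ d M : ℕ, 0 < d → d ≤ 2 * N → |densSum A P P d M N - sigmaDens k d *
      totalAbove A P M N| ≤
        3 * #A * (N : ℝ) ^ 2 * (N : ℝ) ^ (2 / 3 : ℝ) * (#d.divisors : ℝ) / d) →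
    |tauSum A P N - (sigL k * logSum A P N +
      2 * (sigL k * Real.eulerMascheroniConstant - sigM k) * (#A * (N : ℝ) ^ 3))| ≤
      C * (#A * (N : ℝ) ^ 2 * (N : ℝ) ^ (2 / 3 : ℝ) * (1 + Real.log (2 * N)) ^ 3) := by
  obtain ⟨C, hC, h⟩ := exists_abs_sum_filter_sigmaDens_sub_le hk
  refine ⟨200 + 4 * C, fun A P N hN hP hPN hcoll hdens => ?_⟩
  have hN1 : (1 : ℝ) ≤ N := by exact_mod_cast hN
  set κ : ℝ := (N : ℝ) ^ (2 / 3 : ℝ) with hκ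
  set ℓ : ℝ := 1 + Real.log (2 * N) with hℓ
  have hℓ1 : 1 ≤ ℓ := by
    have : 0 ≤ Real.log (2 * N) := Real.log_nonneg (by linarith)
    linarith
  have hκs : √N ≤ κ := by
    rw [Real.sqrt_eq_rpow]
    exact Real.rpow_le_rpow_of_exponent_le hN1 (by norm_num)
  have h1 := sum_abs_hitSum_sub_le hN hP hcoll hdens (fun d => d ^ 2)
  have h2 := sum_abs_hitSum_sub_le hN hP hcoll hdens (fun d => d ^ 2 + 1)
  have h3 : |∑ d ∈ Icc 1 (2 * N), sigmaDens k d * totalAbove A P (d ^ 2) N +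
      ∑ d ∈ Icc 1 (2 * N), sigmaDens k d * totalAbove A P (d ^ 2 + 1) N -
      (sigL k * logSum A P N +
        2 * (sigL k * Real.eulerMascheroniConstant - sigM k) * (#A * (N : ℝ) ^ 3))| ≤
      4 * C * (#A * (N : ℝ) ^ 2 * κ) := by
    have e1 : 2 * (sigL k * Real.eulerMascheroniConstant - sigM k) * (#A * (N : ℝ) ^ 3) =
        ∑ a ∈ A, ∑ x ∈ Icc 1 N, ∑ b ∈ Icc 1 N, ∑ t ∈ Icc 1 N,
          2 * (sigL k * Real.eulerMascheroniConstant - sigM k) := by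
      simp only [sum_const, Nat.card_Icc, Nat.add_sub_cancel, nsmul_eq_mul]
      ring
    rw [sum_totalAbove A P (2 * N) N (fun d => d ^ 2),
      sum_totalAbove A P (2 * N) N (fun d => d ^ 2 + 1), e1, logSum]
    simp only [mul_sum]
    simp_rw [← sum_add_distrib, ← sum_sub_distrib]
    calc _ ≤ ∑ a ∈ A, ∑ x ∈ Icc 1 N, ∑ b ∈ Icc 1 N, ∑ t ∈ Icc 1 N,
          C * (1 / √(b : ℝ) + 1 / √(t : ℝ)) := by
          refine (abs_sum_le_sum_abs _ _).trans (sum_le_sum fun a ha => ?_)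
          refine (abs_sum_le_sum_abs _ _).trans (sum_le_sum fun x hx => ?_)
          refine (abs_sum_le_sum_abs _ _).trans (sum_le_sum fun b hb => ?_)
          refine (abs_sum_le_sum_abs _ _).trans (sum_le_sum fun t ht => ?_)
          have hp := hPN a ha x hx
          rw [mem_Icc] at hb ht
          have e2 : 0 < b * t := Nat.mul_pos hb.1 ht.1
          have e3 : b * t ≤ N * N := Nat.mul_le_mul hb.2 ht.2
          refine (h (P a x + b * t) (2 * N) (by omega) (by nlinarith)).trans ?_
          rw [div_eq_mul_one_div]
          apply mul_le_mul_of_nonneg_left _ hC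
          apply one_div_sqrt_sqrt_mul_le hb.1 ht.1
          push_cast
          have : (0 : ℝ) ≤ P a x := by positivity
          linarith
      _ = C * (#A * N * (2 * (N * ∑ b ∈ Icc 1 N, 1 / √(b : ℝ)))) := by
          simp only [mul_add, sum_add_distrib, sum_const, Nat.card_Icc, Nat.add_sub_cancel,
            nsmul_eq_mul, ← mul_sum]
          ring
      _ ≤ C * (#A * N * (2 * (N * (2 * κ)))) := by
          have := (sum_one_div_sqrt_le N).trans (mul_le_mul_of_nonneg_left hκs two_pos.le)
          gcongr
      _ = _ := by ring
  have h4 : #A * (N : ℝ) ^ 2 * κ ≤ #A * (N : ℝ) ^ 2 * κ * ℓ ^ 3 :=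
    le_mul_of_one_le_right (by positivity) (one_le_pow₀ hℓ1)
  have h5 : 4 * C * (#A * (N : ℝ) ^ 2 * κ) ≤ 4 * C * (#A * (N : ℝ) ^ 2 * κ * ℓ ^ 3) := by gcongr
  rw [tauSum_eq A P N hPN]
  rw [abs_le] at h1 h2 h3 ⊢
  constructor <;> linarith [h1.1, h1.2, h2.1, h2.2, h3.1, h3.2]

/-! ### Riemann sums of elementary functions -/

/-- Integral comparison for monotone `g`, with the integral over `[n, n + 1]` expressed as a value
of `g` by the mean value theorem. Monotonicity is asked only on `(0, N]`, so `g` may be singular at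
`0`, as `log` is. -/
lemma sum_sub_antideriv_mem {g G : ℝ → ℝ} {N : ℕ} (hN : 0 < N)
    (hG : ContinuousOn G (Set.Icc 0 N)) (hd : ∀ x ∈ Set.Ioo (0 : ℝ) N, HasDerivAt G (g x) x)
    (hg : MonotoneOn g (Set.Ioc 0 N)) :
    0 ≤ ∑ x ∈ Icc 1 N, g x - (G N - G 0) ∧
      ∑ x ∈ Icc 1 N, g x - (G N - G 0) ≤ g N - (G 1 - G 0) := by
  have mvt : ∀ n : ℕ, n < N → ∃ ξ : ℝ, (n : ℝ) < ξ ∧ ξ < n + 1 ∧ g ξ = G (n + 1) - G n := by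
    intro n hn
    have hnN : (n : ℝ) + 1 ≤ N := by exact_mod_cast hn
    have hn0 : (0 : ℝ) ≤ n := by positivity
    obtain ⟨ξ, hξ, h⟩ := exists_hasDerivAt_eq_slope G g (lt_add_one (n : ℝ))
      (hG.mono (Set.Icc_subset_Icc hn0 hnN))
      (fun x hx => hd x ⟨hn0.trans_lt hx.1, hx.2.trans_le hnN⟩)
    refine ⟨ξ, hξ.1, hξ.2, ?_⟩
    rw [h]; simp
  have lower : ∀ n ≤ N, G n - G 0 ≤ ∑ x ∈ Icc 1 n, g x := by
    intro n
    induction n with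
    | zero => intro _; simp
    | succ n ih =>
      intro hn
      obtain ⟨ξ, h1, h2, h3⟩ := mvt n hn
      have hnN : (n : ℝ) + 1 ≤ N := by exact_mod_cast hn
      have hn0 : (0 : ℝ) ≤ n := by positivity
      rw [sum_Icc_succ_top (by omega)]
      have h4 := hg (a := ξ) (b := n + 1) ⟨by linarith, by linarith⟩ ⟨by linarith, hnN⟩ h2.le
      have h5 := ih (by omega)
      push_cast
      linarith
  have upper : ∀ n, 1 ≤ n → n ≤ N → ∑ x ∈ Icc 1 n, g x ≤ G n - G 1 + g n := by
    intro n h1n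
    induction n, h1n using Nat.le_induction with
    | base => intro _; simp
    | succ n h1n ih =>
      intro hn
      obtain ⟨ξ, h1, h2, h3⟩ := mvt n hn
      have hnN : (n : ℝ) + 1 ≤ N := by exact_mod_cast hn
      have hn0 : (1 : ℝ) ≤ n := by exact_mod_cast h1n
      rw [sum_Icc_succ_top (by omega)]
      have h4 := hg (a := n) (b := ξ) ⟨by linarith, by linarith⟩ ⟨by linarith, by linarith⟩ h1.le
      have h5 := ih (by omega)
      push_cast
      linarith
  have h1 := lower N le_rfl
  have h2 := upper N hN le_rfl
  constructor <;> linarith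

lemma abs_sum_div_sub_le_of_monotoneOn {χ X : ℝ → ℝ} {B : ℝ}
    (hX : ContinuousOn X (Set.Icc 0 1)) (hd : ∀ x ∈ Set.Ioo (0 : ℝ) 1, HasDerivAt X (χ x) x)
    (hχ : MonotoneOn χ (Set.Ioc 0 1)) (hB : ∀ x ∈ Set.Ioc (0 : ℝ) 1, |χ x| ≤ B) {N : ℕ}
    (hN : 0 < N) :
    |∑ y ∈ Icc 1 N, χ (y / N) - N * (X 1 - X 0)| ≤ 2 * B := by
  have hN' : (0 : ℝ) < N := by exact_mod_cast hN
  have hN1 : (1 : ℝ) ≤ N := by exact_mod_cast hN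
  have hdiv : ∀ x : ℝ, 0 < x → x ≤ N → x / N ∈ Set.Ioc (0 : ℝ) 1 := fun x h1 h2 =>
    ⟨by positivity, (div_le_one hN').2 h2⟩
  have h := sum_sub_antideriv_mem (g := fun x => χ (x / N)) (G := fun x => N * X (x / N)) hN
    (by
      apply ContinuousOn.mul continuousOn_const
      apply hX.comp (continuousOn_id.div_const _)
      intro x hx
      exact ⟨div_nonneg hx.1 hN'.le, (div_le_one hN').2 hx.2⟩)
    (by
      intro x hx
      have h1 := (hd (x / N) ⟨div_pos hx.1 hN', (div_lt_one hN').2 hx.2⟩).comp x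
        ((hasDerivAt_id x).div_const (N : ℝ))
      have h2 := h1.const_mul (N : ℝ)
      refine h2.congr_deriv ?_
      field_simp)
    (by
      intro x hx y hy hxy
      exact hχ (hdiv x hx.1 hx.2) (hdiv y hy.1 hy.2) (div_le_div_of_nonneg_right hxy hN'.le))
  -- The first interval `[0, 1/N]` enters the comparison only through `N (X (1/N) - X 0)`, which is
  -- a value of `χ` and so bounded by `B`.
  obtain ⟨ξ, hξ, h1⟩ := exists_hasDerivAt_eq_slope X χ (one_div_pos.2 hN')
    (hX.mono (Set.Icc_subset_Icc le_rfl ((div_le_one hN').2 hN1)))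
    (fun x hx => hd x ⟨hx.1, hx.2.trans_le ((div_le_one hN').2 hN1)⟩)
  have h2 : (N : ℝ) * X (1 / N) - N * X 0 = χ ξ := by
    rw [h1]; field_simp; ring
  have h3 := hB ξ ⟨hξ.1, hξ.2.le.trans ((div_le_one hN').2 hN1)⟩
  have h4 := hB 1 ⟨one_pos, le_rfl⟩
  simp only [div_self hN'.ne', zero_div] at h
  rw [h2] at h
  rw [abs_le] at h3 h4 ⊢
  constructor <;> nlinarith [h.1, h.2, h3.1, h3.2, h4.1, h4.2]

/-- The Riemann sums of `χ` over `(0, 1]` approximate `I` with error `O(1/N)`. -/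
def RiemannApprox (χ : ℝ → ℝ) (I : ℝ) : Prop :=
  ∃ B : ℝ, ∀ N : ℕ, 0 < N → |∑ y ∈ Icc 1 N, χ (y / N) - N * I| ≤ B

lemma RiemannApprox.add {χ χ' : ℝ → ℝ} {I I' : ℝ} (h : RiemannApprox χ I)
    (h' : RiemannApprox χ' I') : RiemannApprox (fun x => χ x + χ' x) (I + I') := by
  obtain ⟨B, hB⟩ := h
  obtain ⟨B', hB'⟩ := h'
  refine ⟨B + B', fun N hN => ?_⟩
  rw [sum_add_distrib, mul_add, add_sub_add_comm]
  exact (abs_add_le _ _).trans (add_le_add (hB N hN) (hB' N hN))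

lemma RiemannApprox.const_mul {χ : ℝ → ℝ} {I : ℝ} (h : RiemannApprox χ I) (c : ℝ) :
    RiemannApprox (fun x => c * χ x) (c * I) := by
  obtain ⟨B, hB⟩ := h
  refine ⟨|c| * B, fun N hN => ?_⟩
  rw [← mul_sum, mul_left_comm, ← mul_sub, abs_mul]
  exact mul_le_mul_of_nonneg_left (hB N hN) (abs_nonneg c)

lemma RiemannApprox.congr {χ χ' : ℝ → ℝ} {I I' : ℝ} (h : RiemannApprox χ I)
    (hχ : ∀ x ∈ Set.Ioc (0 : ℝ) 1, χ' x = χ x) (hI : I' = I) : RiemannApprox χ' I' := by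
  obtain ⟨B, hB⟩ := h
  refine ⟨B, fun N hN => ?_⟩
  have hN' : (0 : ℝ) < N := by exact_mod_cast hN
  rw [hI, sum_congr rfl (g := fun y : ℕ => χ (y / N))]
  · exact hB N hN
  · intro y hy
    rw [mem_Icc] at hy
    apply hχ
    have h1 : (0 : ℝ) < y := by exact_mod_cast hy.1
    exact ⟨by positivity, (div_le_one hN').2 (by exact_mod_cast hy.2)⟩

lemma riemannApprox_of_monotoneOn {χ X : ℝ → ℝ} {B : ℝ}
    (hX : ContinuousOn X (Set.Icc 0 1)) (hd : ∀ x ∈ Set.Ioo (0 : ℝ) 1, HasDerivAt X (χ x) x)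
    (hχ : MonotoneOn χ (Set.Ioc 0 1)) (hB : ∀ x ∈ Set.Ioc (0 : ℝ) 1, |χ x| ≤ B) :
    RiemannApprox χ (X 1 - X 0) :=
  ⟨2 * B, fun _ hN => abs_sum_div_sub_le_of_monotoneOn hX hd hχ hB hN⟩

lemma riemannApprox_of_antitoneOn {χ X : ℝ → ℝ} {B : ℝ}
    (hX : ContinuousOn X (Set.Icc 0 1)) (hd : ∀ x ∈ Set.Ioo (0 : ℝ) 1, HasDerivAt X (χ x) x)
    (hχ : AntitoneOn χ (Set.Ioc 0 1)) (hB : ∀ x ∈ Set.Ioc (0 : ℝ) 1, |χ x| ≤ B) :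
    RiemannApprox χ (X 1 - X 0) := by
  have h := (riemannApprox_of_monotoneOn (χ := fun x => -χ x) (X := fun x => -X x) hX.neg
    (fun x hx => (hd x hx).neg) hχ.neg (B := B) (fun x hx => by rw [abs_neg]; exact hB x hx))
  refine (h.const_mul (-1)).congr (fun x _ => by ring) (by ring)

lemma riemannApprox_pow (p : ℕ) : RiemannApprox (fun u => u ^ p) (1 / (p + 1)) := by
  have hp : ((p : ℝ) + 1) ≠ 0 := by positivity
  refine (riemannApprox_of_monotoneOn (X := fun u => u ^ (p + 1) / (p + 1)) (B := 1) ?_ ?_ ?_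
    ?_).congr (fun _ _ => rfl) (by simp)
  · fun_prop
  · intro x _
    refine ((hasDerivAt_pow (p + 1) x).div_const ((p : ℝ) + 1)).congr_deriv ?_
    push_cast
    field_simp
  · intro x hx y _ hxy
    exact pow_le_pow_left₀ hx.1.le hxy p
  · intro x hx
    rw [abs_of_nonneg (pow_nonneg hx.1.le p)]
    exact pow_le_one₀ hx.1.le hx.2

lemma continuous_pow_succ_mul_log (p : ℕ) : Continuous fun u : ℝ => u ^ (p + 1) * Real.log u := by
  have h : (fun u : ℝ => u ^ (p + 1) * Real.log u) = fun u => u ^ p * (u * Real.log u) := by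
    ext u; ring
  rw [h]
  exact (continuous_pow p).mul Real.continuous_mul_log

lemma abs_mul_log_le {x : ℝ} (hx : x ∈ Set.Ioc (0 : ℝ) 1) : |x * Real.log x| ≤ 1 :=
  (Real.abs_log_mul_self_lt x hx.1 hx.2).le.trans' (by rw [mul_comm])

/-- `u ^ p log u` is not monotone on `(0, 1]`, but subtracting `u ^ p / p` leaves the derivative `p
u^(p-1) log u ≤ 0`. -/
lemma riemannApprox_pow_mul_log {p : ℕ} (hp : 1 ≤ p) :
    RiemannApprox (fun u => u ^ p * Real.log u) (-(1 / ((p : ℝ) + 1) ^ 2)) := by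
  have hp0 : (0 : ℝ) < p := by exact_mod_cast hp
  have hp1 : ((p : ℝ) + 1) ≠ 0 := by positivity
  have h1 : RiemannApprox (fun u => u ^ p * Real.log u - 1 / p * u ^ p)
      ((fun u : ℝ => u ^ (p + 1) * Real.log u / (p + 1) - u ^ (p + 1) / (p + 1) ^ 2 -
        1 / p * (u ^ (p + 1) / (p + 1))) 1 - (fun u : ℝ => u ^ (p + 1) * Real.log u / (p + 1) -
          u ^ (p + 1) / (p + 1) ^ 2 - 1 / p * (u ^ (p + 1) / (p + 1))) 0) := by
    refine riemannApprox_of_antitoneOn (X := fun u : ℝ => u ^ (p + 1) * Real.log u / (p + 1) -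
      u ^ (p + 1) / (p + 1) ^ 2 - 1 / p * (u ^ (p + 1) / (p + 1))) (B := 1 + 1 / p) ?_ ?_ ?_ ?_
    · apply Continuous.continuousOn
      exact (((continuous_pow_succ_mul_log p).div_const _).sub (by fun_prop)).sub (by fun_prop)
    · intro x hx
      have hx0 : x ≠ 0 := hx.1.ne'
      have e1 := (((hasDerivAt_pow (p + 1) x).mul (Real.hasDerivAt_log hx0)).div_const
        ((p : ℝ) + 1)).sub ((hasDerivAt_pow (p + 1) x).div_const (((p : ℝ) + 1) ^ 2))
      have e2 := e1.sub (((hasDerivAt_pow (p + 1) x).div_const ((p : ℝ) + 1)).const_mul (1 / (p : ℝ)))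
      refine e2.congr_deriv ?_
      push_cast
      rw [pow_succ]
      field_simp
      ring
    · apply antitoneOn_of_deriv_nonpos (convex_Ioc 0 1)
      · apply ContinuousOn.sub
        · apply ContinuousOn.mul (by fun_prop)
          exact Real.continuousOn_log.mono fun x hx => hx.1.ne'
        · fun_prop
      · intro x hx
        rw [interior_Ioc] at hx
        have := hx.1.ne'
        apply DifferentiableAt.differentiableWithinAt
        fun_prop (disch := assumption)
      · intro x hx
        rw [interior_Ioc] at hx
        have hx0 : x ≠ 0 := hx.1.ne'
        have e1 := ((hasDerivAt_pow p x).mul (Real.hasDerivAt_log hx0)).sub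
          ((hasDerivAt_pow p x).const_mul (1 / (p : ℝ)))
        have e1' : HasDerivAt (fun u : ℝ => u ^ p * Real.log u - 1 / p * u ^ p) _ x := e1
        rw [e1'.deriv]
        have e2 : x ^ p = x ^ (p - 1) * x := by rw [← pow_succ, Nat.sub_add_cancel hp]
        have e3 : (p : ℝ) * x ^ (p - 1) * Real.log x + x ^ p * x⁻¹ -
            1 / p * (p * x ^ (p - 1)) = p * x ^ (p - 1) * Real.log x := by
          rw [e2]; field_simp; ring
        rw [e3]
        have := Real.log_nonpos hx.1.le hx.2.le
        have h0 : 0 ≤ p * x ^ (p - 1) := mul_nonneg hp0.le (pow_nonneg hx.1.le _)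
        exact mul_nonpos_of_nonneg_of_nonpos h0 this
    · intro x hx
      refine (abs_sub _ _).trans (add_le_add ?_ ?_)
      · have e2 : x ^ p = x ^ (p - 1) * x := by rw [← pow_succ, Nat.sub_add_cancel hp]
        rw [e2, mul_assoc, abs_mul, abs_of_nonneg (pow_nonneg hx.1.le _)]
        exact mul_le_one₀ (pow_le_one₀ hx.1.le hx.2) (abs_nonneg _) (abs_mul_log_le hx)
      · rw [abs_mul, abs_of_nonneg (pow_nonneg hx.1.le _), abs_of_nonneg (by positivity)]
        exact mul_le_of_le_one_right (by positivity) (pow_le_one₀ hx.1.le hx.2)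
  refine (h1.add ((riemannApprox_pow p).const_mul (1 / p))).congr (fun x _ => by ring) ?_
  simp

/-- The sign of the derivative is that of `u / (1 + u) - log (1 + u)`, which is nonpositive. -/
lemma antitoneOn_log_one_add_div : AntitoneOn (fun u : ℝ => Real.log (1 + u) / u) (Set.Ioc 0 1) := by
  apply antitoneOn_of_deriv_nonpos (convex_Ioc 0 1)
  · apply ContinuousOn.div
    · apply ContinuousOn.log (by fun_prop)
      intro x hx
      linarith [hx.1]
    · fun_prop
    · intro x hx; exact hx.1.ne'
  · intro x hx
    rw [interior_Ioc] at hx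
    have h1 : x ≠ 0 := hx.1.ne'
    have h2 : 1 + x ≠ 0 := by linarith [hx.1]
    apply DifferentiableAt.differentiableWithinAt
    fun_prop (disch := assumption)
  · intro x hx
    rw [interior_Ioc] at hx
    have h1 : x ≠ 0 := hx.1.ne'
    have h2 : 1 + x ≠ 0 := by linarith [hx.1]
    have e1 := ((((hasDerivAt_id x).const_add 1).log h2).div (hasDerivAt_id x) h1).deriv
    simp only [id] at e1
    have h3 : x / (1 + x) ≤ Real.log (1 + x) := by
      have h4 := Real.one_sub_inv_le_log_of_pos (by linarith [hx.1] : (0 : ℝ) < 1 + x)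
      refine le_trans (le_of_eq ?_) h4
      field_simp
      ring
    have e2 : (fun u : ℝ => Real.log (1 + u) / u) = (fun y => Real.log (1 + y)) / id := rfl
    rw [e2, e1]
    apply div_nonpos_of_nonpos_of_nonneg _ (by positivity)
    have : 1 / (1 + x) * x = x / (1 + x) := by ring
    linarith

/-- The function `∑ (-1)^n x^(n+1) / (n+1)²`, an antiderivative of `log (1 + x) / x`. -/
noncomputable def altDilog (x : ℝ) : ℝ := ∑' n : ℕ, (-1) ^ n * x ^ (n + 1) / ((n : ℝ) + 1) ^ 2

lemma summable_one_div_succ_sq : Summable fun n : ℕ => 1 / ((n : ℝ) + 1) ^ 2 := by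
  have h := (summable_nat_add_iff 1).2 (Real.summable_one_div_nat_pow.2 one_lt_two)
  simpa using h

lemma continuousOn_altDilog : ContinuousOn altDilog (Set.Icc 0 1) := by
  apply continuousOn_tsum (u := fun n : ℕ => 1 / ((n : ℝ) + 1) ^ 2)
  · intro n; fun_prop
  · exact summable_one_div_succ_sq
  · intro n x hx
    rw [norm_div, norm_mul, norm_pow, norm_neg, norm_one, one_pow, one_mul, norm_pow, norm_pow]
    rw [Real.norm_of_nonneg hx.1, Real.norm_of_nonneg (by positivity : (0 : ℝ) ≤ (n : ℝ) + 1)]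
    gcongr
    exact pow_le_one₀ hx.1 hx.2

/-- Termwise differentiation on `(-r, r)` with `x < r < 1`, where the differentiated series is
dominated by the geometric series in `r`. -/
lemma hasDerivAt_altDilog {x : ℝ} (hx : x ∈ Set.Ioo (0 : ℝ) 1) :
    HasDerivAt altDilog (Real.log (1 + x) / x) x := by
  set r : ℝ := (x + 1) / 2 with hr
  have hr1 : r < 1 := by linarith [hx.2]
  have hr0 : 0 < r := by linarith [hx.1]
  have hxr : x < r := by linarith [hx.2]
  have h1 := hasDerivAt_tsum_of_isPreconnected (𝕜 := ℝ) (u := fun n : ℕ => r ^ n)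
    (g := fun (n : ℕ) (x : ℝ) => (-1) ^ n * x ^ (n + 1) / ((n : ℝ) + 1) ^ 2)
    (g' := fun (n : ℕ) (x : ℝ) => (-1) ^ n * x ^ n / ((n : ℝ) + 1)) (t := Set.Ioo (-r) r) (y₀ := 0)
    (summable_geometric_of_lt_one hr0.le hr1) isOpen_Ioo isPreconnected_Ioo ?_ ?_
    (by constructor <;> simp [hr0]) (by simp) (y := x)
    ⟨by linarith [hx.1], hxr⟩
  · refine h1.congr_deriv ?_
    have h2 := Real.hasSum_pow_div_log_of_abs_lt_one (x := -x) (by rw [abs_neg, abs_of_pos hx.1]; exact hx.2)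
    have h3 := h2.mul_left (-x⁻¹)
    rw [sub_neg_eq_add] at h3
    have h4 : (fun n : ℕ => -x⁻¹ * ((-x) ^ (n + 1) / ((n : ℝ) + 1))) =
        fun n : ℕ => (-1) ^ n * x ^ n / ((n : ℝ) + 1) := by
      ext n
      rw [neg_pow x (n + 1), pow_succ x n, pow_succ (-1 : ℝ) n]
      have := hx.1.ne'
      field_simp
    rw [h4] at h3
    rw [h3.tsum_eq]
    ring
  · intro n y _
    have h2 := ((hasDerivAt_pow (n + 1) y).const_mul ((-1 : ℝ) ^ n)).div_const (((n : ℝ) + 1) ^ 2)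
    refine h2.congr_deriv ?_
    push_cast
    have : (n : ℝ) + 1 ≠ 0 := by positivity
    field_simp
  · intro n y hy
    rw [norm_div, norm_mul, norm_pow, norm_neg, norm_one, one_pow, one_mul, norm_pow,
      Real.norm_of_nonneg (by positivity : (0 : ℝ) ≤ (n : ℝ) + 1)]
    have h2 : ‖y‖ ≤ r := by rw [Real.norm_eq_abs, abs_le]; exact ⟨hy.1.le, hy.2.le⟩
    calc ‖y‖ ^ n / ((n : ℝ) + 1) ≤ ‖y‖ ^ n := div_le_self (by positivity) (by linarith [(Nat.cast_nonneg n : (0 : ℝ) ≤ n)])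
      _ ≤ r ^ n := pow_le_pow_left₀ (norm_nonneg _) h2 n

lemma altDilog_zero : altDilog 0 = 0 := by simp [altDilog]

/-- The terms with even denominators make up a quarter of `π² / 6`; changing their sign subtracts
half of `π² / 6`. -/
lemma altDilog_one : altDilog 1 = Real.pi ^ 2 / 12 := by
  set f : ℕ → ℝ := fun n => 1 / ((n : ℝ) + 1) ^ 2 with hf
  have h1 : HasSum f (Real.pi ^ 2 / 6) := by
    have := (hasSum_nat_add_iff' 1).2 hasSum_zeta_two
    simpa [hf] using this
  have hodd : ∀ n, f (2 * n + 1) = 1 / 4 * f n := by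
    intro n
    have : (n : ℝ) + 1 ≠ 0 := by positivity
    have h : ((2 * n + 1 : ℕ) + 1 : ℝ) = 2 * (n + 1) := by push_cast; ring
    simp only [hf]
    rw [h]
    field_simp
    norm_num
  have h2 : HasSum (fun n => f (2 * n + 1)) (1 / 4 * (Real.pi ^ 2 / 6)) := by
    simp_rw [hodd]
    exact h1.mul_left (1 / 4)
  have h3 : Summable fun n => f (2 * n) :=
    h1.summable.comp_injective (i := fun n : ℕ => 2 * n) fun a b h => by simpa using h
  have h4 := (HasSum.even_add_odd (f := f) h3.hasSum h2).unique h1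
  set F : ℕ → ℝ := fun n => (-1) ^ n * f n with hF
  have h5 : HasSum (fun n => F (2 * n)) (∑' n : ℕ, f (2 * n)) := by
    have e : ∀ n, F (2 * n) = f (2 * n) := fun n => by simp only [hF]; rw [pow_mul]; simp
    simp_rw [e]
    exact h3.hasSum
  have h6 : HasSum (fun n => F (2 * n + 1)) (-(1 / 4 * (Real.pi ^ 2 / 6))) := by
    have e : ∀ n, F (2 * n + 1) = -f (2 * n + 1) := fun n => by
      simp only [hF]; rw [pow_succ, pow_mul]; simp
    simp_rw [e]
    exact h2.neg
  have h7 := HasSum.even_add_odd (f := F) h5 h6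
  have h8 : altDilog 1 = ∑' n, F n := by
    rw [altDilog]
    refine tsum_congr fun n => ?_
    simp only [hF, hf, one_pow, mul_one, mul_one_div]
  rw [h8, h7.tsum_eq]
  linarith

lemma riemannApprox_log_one_add_div :
    RiemannApprox (fun u => Real.log (1 + u) / u) (Real.pi ^ 2 / 12) := by
  refine (riemannApprox_of_antitoneOn (X := altDilog) (B := 1) continuousOn_altDilog
    (fun x hx => hasDerivAt_altDilog hx) antitoneOn_log_one_add_div ?_).congr (fun _ _ => rfl)
    (by rw [altDilog_zero, altDilog_one, sub_zero])
  intro x hx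
  have h0 : 0 ≤ Real.log (1 + x) := Real.log_nonneg (by linarith [hx.1])
  rw [abs_of_nonneg (div_nonneg h0 hx.1.le), div_le_one hx.1]
  have := Real.log_le_sub_one_of_pos (by linarith [hx.1] : (0 : ℝ) < 1 + x)
  linarith

lemma riemannApprox_log_one_add :
    RiemannApprox (fun u => Real.log (1 + u)) (2 * Real.log 2 - 1) := by
  refine (riemannApprox_of_monotoneOn (X := fun u => (1 + u) * Real.log (1 + u) - u) (B := 1)
    ?_ ?_ ?_ ?_).congr (fun _ _ => rfl) (by norm_num)
  · apply ContinuousOn.sub _ continuousOn_id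
    apply ContinuousOn.mul (by fun_prop)
    apply ContinuousOn.log (by fun_prop)
    intro x hx
    linarith [hx.1]
  · intro x hx
    have h2 : 1 + x ≠ 0 := by linarith [hx.1]
    have h := (((hasDerivAt_id x).const_add 1).mul (((hasDerivAt_id x).const_add 1).log h2)).sub
      (hasDerivAt_id x)
    refine h.congr_deriv ?_
    simp only [id]
    field_simp
    ring
  · intro x hx y hy hxy
    exact Real.log_le_log (by linarith [hx.1]) (by linarith)
  · intro x hx
    have h0 : 0 ≤ Real.log (1 + x) := Real.log_nonneg (by linarith [hx.1])
    rw [abs_of_nonneg h0]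
    have := Real.log_le_sub_one_of_pos (by linarith [hx.1] : (0 : ℝ) < 1 + x)
    linarith [hx.2]

lemma riemannApprox_mul_log_one_add :
    RiemannApprox (fun u => u * Real.log (1 + u)) (1 / 4) := by
  refine (riemannApprox_of_monotoneOn
    (X := fun u => (u ^ 2 - 1) / 2 * Real.log (1 + u) - u ^ 2 / 4 + u / 2) (B := 1)
    ?_ ?_ ?_ ?_).congr (fun _ _ => rfl) (by norm_num)
  · apply ContinuousOn.add _ (by fun_prop)
    apply ContinuousOn.sub _ (by fun_prop)
    apply ContinuousOn.mul (by fun_prop)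
    apply ContinuousOn.log (by fun_prop)
    intro x hx
    linarith [hx.1]
  · intro x hx
    have h2 : 1 + x ≠ 0 := by linarith [hx.1]
    have h := ((((((hasDerivAt_id x).pow 2).sub_const 1).div_const 2).mul
      (((hasDerivAt_id x).const_add 1).log h2)).sub (((hasDerivAt_id x).pow 2).div_const 4)).add
      ((hasDerivAt_id x).div_const 2)
    refine h.congr_deriv ?_
    simp only [id, Pi.pow_apply]
    field_simp
    ring
  · intro x hx y hy hxy
    have h0 : 0 ≤ Real.log (1 + x) := Real.log_nonneg (by linarith [hx.1])
    exact mul_le_mul hxy (Real.log_le_log (by linarith [hx.1]) (by linarith)) h0 hy.1.le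
  · intro x hx
    have h0 : 0 ≤ Real.log (1 + x) := Real.log_nonneg (by linarith [hx.1])
    rw [abs_of_nonneg (mul_nonneg hx.1.le h0)]
    have := Real.log_le_sub_one_of_pos (by linarith [hx.1] : (0 : ℝ) < 1 + x)
    exact mul_le_one₀ hx.2 h0 (by linarith [hx.2])

/-! ### Sums of logarithms over the faces of the cube -/

lemma sum_log_add_approx {c : ℝ} (hc : 0 ≤ c) {N : ℕ} (hN : 0 < N) :
    |∑ x ∈ Icc 1 N, Real.log ((x : ℝ) + c) -
      ((N + c) * Real.log (N + c) - c * Real.log c - N)| ≤ Real.log (N + c) + 1 := by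
  have h := sum_sub_antideriv_mem (g := fun x => Real.log (x + c))
    (G := fun x => (x + c) * Real.log (x + c) - x) hN
    (((Real.continuous_mul_log.comp (continuous_id.add_const c)).sub continuous_id).continuousOn)
    (by
      intro x hx
      have h2 : x + c ≠ 0 := by linarith [hx.1]
      have h := (((hasDerivAt_id x).add_const c).mul (((hasDerivAt_id x).add_const c).log h2)).sub
        (hasDerivAt_id x)
      refine h.congr_deriv ?_
      simp only [id]
      field_simp
      ring)
    (by
      intro x hx y hy hxy
      exact Real.log_le_log (by linarith [hx.1]) (by linarith))
  -- This keeps the end term `G 1 - G 0` above `-1`, whence the `+ 1` in the error.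
  have h1 : c * Real.log c ≤ (1 + c) * Real.log (1 + c) := by
    rcases hc.eq_or_lt with rfl | hc
    · simp
    · have h2 : Real.log c ≤ Real.log (1 + c) := Real.log_le_log hc (by linarith)
      have h3 : 0 ≤ Real.log (1 + c) := Real.log_nonneg (by linarith)
      nlinarith
  simp only [zero_add] at h
  rw [abs_le]
  constructor <;> linarith [h.1, h.2]

/-- `∫₀¹ log (x + s) dx`. -/
noncomputable def phi (s : ℝ) : ℝ := (1 + s) * Real.log (1 + s) - s * Real.log s - 1

/-- An antiderivative of `phi`. -/
noncomputable def psi (s : ℝ) : ℝ :=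
  (1 + s) ^ 2 / 2 * Real.log (1 + s) - s ^ 2 / 2 * Real.log s - 3 / 2 * s

lemma hasDerivAt_phi {s : ℝ} (hs : 0 < s) :
    HasDerivAt phi (Real.log (1 + s) - Real.log s) s := by
  have h1 : 1 + s ≠ 0 := by linarith
  have h := ((((hasDerivAt_id s).const_add 1).mul (((hasDerivAt_id s).const_add 1).log h1)).sub
    ((hasDerivAt_id s).mul (Real.hasDerivAt_log hs.ne'))).sub_const 1
  refine h.congr_deriv ?_
  simp only [id]
  field_simp
  ring

lemma hasDerivAt_psi {s : ℝ} (hs : 0 < s) : HasDerivAt psi (phi s) s := by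
  have h1 : 1 + s ≠ 0 := by linarith
  have h := ((((((hasDerivAt_id s).const_add 1).pow 2).div_const 2).mul
    (((hasDerivAt_id s).const_add 1).log h1)).sub
    ((((hasDerivAt_id s).pow 2).div_const 2).mul (Real.hasDerivAt_log hs.ne'))).sub
    ((hasDerivAt_id s).const_mul (3 / 2))
  refine h.congr_deriv ?_
  simp only [id, Pi.pow_apply, phi]
  field_simp
  ring

lemma continuous_sq_div_mul_log : Continuous fun s : ℝ => s ^ 2 / 2 * Real.log s := by
  have h : (fun s : ℝ => s ^ 2 / 2 * Real.log s) = fun s => s / 2 * (s * Real.log s) := by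
    ext s; ring
  rw [h]
  exact (by fun_prop : Continuous fun s : ℝ => s / 2).mul Real.continuous_mul_log

lemma continuousOn_psi : ContinuousOn psi (Set.Icc 0 1) := by
  apply ContinuousOn.sub _ (by fun_prop)
  apply ContinuousOn.sub _ continuous_sq_div_mul_log.continuousOn
  apply ContinuousOn.mul (by fun_prop)
  apply ContinuousOn.log (by fun_prop)
  intro x hx
  linarith [hx.1]

lemma monotoneOn_phi : MonotoneOn phi (Set.Ioc 0 1) := by
  apply monotoneOn_of_deriv_nonneg (convex_Ioc 0 1)
  · intro x hx
    exact (hasDerivAt_phi hx.1).continuousAt.continuousWithinAt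
  · intro x hx
    rw [interior_Ioc] at hx
    exact (hasDerivAt_phi hx.1).differentiableAt.differentiableWithinAt
  · intro x hx
    rw [interior_Ioc] at hx
    rw [(hasDerivAt_phi hx.1).deriv, sub_nonneg]
    exact Real.log_le_log hx.1 (by linarith)

lemma abs_phi_le {s : ℝ} (hs : s ∈ Set.Ioc (0 : ℝ) 1) : |phi s| ≤ 1 := by
  have hs0 := hs.1
  have h1 : 0 ≤ Real.log (1 + s) := Real.log_nonneg (by linarith)
  have h2 : Real.log (1 + s) ≤ s := by
    have := Real.log_le_sub_one_of_pos (by linarith : 0 < 1 + s); linarith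
  have h3 : Real.log s ≤ Real.log (1 + s) := Real.log_le_log hs0 (by linarith)
  have h4 : s * (Real.log (1 + s) - Real.log s) ≤ 1 := by
    rw [← Real.log_div (by linarith) hs0.ne']
    have h5 := Real.log_le_sub_one_of_pos (by positivity : 0 < (1 + s) / s)
    calc s * Real.log ((1 + s) / s) ≤ s * ((1 + s) / s - 1) := by gcongr
      _ = 1 := by field_simp; ring
  have h5 : 0 ≤ s * (Real.log (1 + s) - Real.log s) := mul_nonneg hs0.le (by linarith)
  have h6 : phi s = Real.log (1 + s) + s * (Real.log (1 + s) - Real.log s) - 1 := by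
    rw [phi]; ring
  rw [h6, abs_le]
  constructor <;> linarith [hs.2]

/-- Scaling out `N²` from `N x + w` leaves `log (x / N + s)` with `s = w / N²`, whose integral over
the unit interval is `phi s`. -/
lemma sum_log_mul_add_approx {w : ℝ} {N : ℕ} (hN : 0 < N) (hw : 0 < w) (hwN : w ≤ (N : ℝ) ^ 2) :
    |∑ x ∈ Icc 1 N, Real.log (N * x + w) - N * (2 * Real.log N + phi (w / N ^ 2))| ≤
      1 + Real.log (2 * N) := by
  have hN' : (0 : ℝ) < N := by exact_mod_cast hN
  set c : ℝ := w / N with hc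
  have hc0 : 0 < c := by positivity
  have hcN : c ≤ N := by rw [hc, div_le_iff₀ hN']; linarith [sq (N : ℝ)]
  have h1 := sum_log_add_approx hc0.le hN
  have h2 : ∑ x ∈ Icc 1 N, Real.log (N * x + w) =
      N * Real.log N + ∑ x ∈ Icc 1 N, Real.log ((x : ℝ) + c) := by
    have : ∀ x ∈ Icc 1 N, Real.log ((N : ℝ) * x + w) = Real.log N + Real.log ((x : ℝ) + c) := by
      intro x _
      rw [← Real.log_mul hN'.ne' (by positivity)]
      congr 1
      rw [hc]; field_simp
    rw [sum_congr rfl this, sum_add_distrib]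
    simp
  set s : ℝ := w / N ^ 2 with hs
  have hs0 : 0 < s := by positivity
  have hcs : c = N * s := by rw [hc, hs]; field_simp
  have h3 : (N + c) * Real.log (N + c) - c * Real.log c - N = N * (Real.log N + phi s) := by
    rw [hcs, show (N : ℝ) + N * s = N * (1 + s) by ring, Real.log_mul hN'.ne' (by positivity),
      Real.log_mul hN'.ne' hs0.ne', phi]
    ring
  rw [h3] at h1
  rw [h2]
  have h4 : Real.log (N + c) ≤ Real.log (2 * N) := Real.log_le_log (by positivity) (by linarith)
  have h5 : N * Real.log N + ∑ x ∈ Icc 1 N, Real.log ((x : ℝ) + c) -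
      N * (2 * Real.log N + phi s) =
      ∑ x ∈ Icc 1 N, Real.log ((x : ℝ) + c) - N * (Real.log N + phi s) := by ring
  rw [h5]
  linarith

lemma div_mem_Ioc {y N : ℕ} (hy : y ∈ Icc 1 N) : (y : ℝ) / N ∈ Set.Ioc (0 : ℝ) 1 := by
  rw [mem_Icc] at hy
  have h1 : (0 : ℝ) < y := by exact_mod_cast hy.1
  have h2 : (y : ℝ) ≤ N := by exact_mod_cast hy.2
  have h3 : (0 : ℝ) < N := h1.trans_le h2
  exact ⟨by positivity, (div_le_one h3).2 h2⟩

/-- The integral of `phi (u v)` over `v ∈ [0, 1]` is `psi u / u`; the error is uniform in `u`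
because `|phi| ≤ 1` on `(0, 1]`. -/
lemma sum_phi_mul_approx {u : ℝ} (hu : u ∈ Set.Ioc (0 : ℝ) 1) {N : ℕ} (hN : 0 < N) :
    |∑ z ∈ Icc 1 N, phi (u * (z / N)) - N * (psi u / u)| ≤ 2 := by
  have hu0 := hu.1
  have hmem : ∀ v ∈ Set.Ioc (0 : ℝ) 1, u * v ∈ Set.Ioc (0 : ℝ) 1 := fun v hv =>
    ⟨mul_pos hu0 hv.1, mul_le_one₀ hu.2 hv.1.le hv.2⟩
  have h := abs_sum_div_sub_le_of_monotoneOn (χ := fun v => phi (u * v))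
    (X := fun v => psi (u * v) / u) (B := 1)
    (by
      apply ContinuousOn.div_const
      apply continuousOn_psi.comp (by fun_prop)
      intro v hv
      exact ⟨mul_nonneg hu0.le hv.1, mul_le_one₀ hu.2 hv.1 hv.2⟩)
    (by
      intro v hv
      have h1 := ((hasDerivAt_psi (mul_pos hu0 hv.1)).comp v
        ((hasDerivAt_id v).const_mul u)).div_const u
      refine h1.congr_deriv ?_
      field_simp)
    (fun v hv v' hv' hvv' => monotoneOn_phi (hmem v hv) (hmem v' hv')
      (mul_le_mul_of_nonneg_left hvv' hu0.le))
    (fun v hv => abs_phi_le (hmem v hv)) hN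
  simpa [psi] using h

/-- Expanding `(1 + u)² / (2 u)` splits `psi u / u` into elementary pieces; the only transcendental
one is `log (1 + u) / u`. -/
lemma riemannApprox_psi_div :
    RiemannApprox (fun u => psi u / u) (Real.pi ^ 2 / 24 - 9 / 4 + 2 * Real.log 2) := by
  refine ((((riemannApprox_log_one_add_div.const_mul (1 / 2)).add riemannApprox_log_one_add).add
    ((riemannApprox_mul_log_one_add.const_mul (1 / 2)))).add
    (((riemannApprox_pow_mul_log le_rfl).const_mul (-(1 / 2))).add
      ((riemannApprox_pow 0).const_mul (-(3 / 2))))).congr ?_ ?_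
  · intro u hu
    have := hu.1.ne'
    simp only [psi]
    field_simp
    ring
  · norm_num
    ring

lemma riemannApprox_phi_sq :
    RiemannApprox (fun u => phi (u ^ 2)) (4 / 3 * Real.log 2 - 7 / 3 + Real.pi / 3) := by
  refine (riemannApprox_of_monotoneOn (X := fun u => (u + u ^ 3 / 3) * Real.log (1 + u ^ 2) -
    7 / 3 * u + 4 / 3 * Real.arctan u - 2 / 3 * (u ^ 3 * Real.log u)) (B := 1)
    ?_ ?_ ?_ ?_).congr (fun _ _ => rfl) ?_
  · apply Continuous.continuousOn
    refine Continuous.sub (Continuous.add (Continuous.sub ?_ (by fun_prop)) ?_)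
      ((continuous_pow_succ_mul_log 2).const_mul _)
    · apply Continuous.mul (by fun_prop)
      apply Continuous.log (by fun_prop)
      intro x
      positivity
    · exact Real.continuous_arctan.const_mul _
  · intro x hx
    have h1 : (1 + x ^ 2) ≠ 0 := by positivity
    have e1 := (((hasDerivAt_id x).add (((hasDerivAt_id x).pow 3).div_const 3)).mul
      ((((hasDerivAt_id x).pow 2).const_add 1).log (by simpa using h1))).sub
        ((hasDerivAt_id x).const_mul (7 / 3))
    have e2 := (e1.add ((Real.hasDerivAt_arctan x).const_mul (4 / 3))).sub
      (((((hasDerivAt_id x).pow 3)).mul (Real.hasDerivAt_log hx.1.ne')).const_mul (2 / 3))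
    refine e2.congr_deriv ?_
    have := hx.1.ne'
    simp only [id, Pi.pow_apply, Pi.add_apply, phi, Real.log_pow]
    field_simp
    push_cast
    ring
  · intro x hx y hy hxy
    exact monotoneOn_phi ⟨pow_pos hx.1 2, pow_le_one₀ hx.1.le hx.2⟩
      ⟨pow_pos hy.1 2, pow_le_one₀ hy.1.le hy.2⟩ (pow_le_pow_left₀ hx.1.le hxy 2)
  · intro x hx
    exact abs_phi_le ⟨pow_pos hx.1 2, pow_le_one₀ hx.1.le hx.2⟩
  · simp only [Real.arctan_one, Real.log_one, Real.arctan_zero, Real.log_zero]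
    norm_num

lemma sum_log_one_add_mul_approx {u : ℝ} (hu : u ∈ Set.Ioc (0 : ℝ) 1) {N : ℕ} (hN : 0 < N) :
    |∑ z ∈ Icc 1 N, Real.log (1 + u * (z / N)) -
      N * (Real.log (1 + u) / u + Real.log (1 + u) - 1)| ≤ 2 := by
  have hu0 := hu.1
  have h := abs_sum_div_sub_le_of_monotoneOn (χ := fun v => Real.log (1 + u * v))
    (X := fun v => ((1 + u * v) * Real.log (1 + u * v) - u * v) / u) (B := 1)
    (by
      apply ContinuousOn.div_const
      apply ContinuousOn.sub _ (by fun_prop)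
      apply ContinuousOn.mul (by fun_prop)
      apply ContinuousOn.log (by fun_prop)
      intro v hv
      have := mul_nonneg hu0.le hv.1
      linarith)
    (by
      intro v hv
      have h0 := mul_pos hu0 hv.1
      have h2 : 1 + u * v ≠ 0 := by linarith
      have e0 := ((hasDerivAt_id v).const_mul u)
      have e1 := (((e0.const_add 1).mul ((e0.const_add 1).log h2)).sub e0).div_const u
      refine e1.congr_deriv ?_
      simp only [id]
      field_simp
      ring)
    (by
      intro v hv v' hv' hvv'
      have h0 := mul_pos hu0 hv.1
      exact Real.log_le_log (by linarith) (by nlinarith))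
    (by
      intro v hv
      have h0 := mul_pos hu0 hv.1
      have h1 : u * v ≤ 1 := mul_le_one₀ hu.2 hv.1.le hv.2
      rw [abs_of_nonneg (Real.log_nonneg (by linarith))]
      have := Real.log_le_sub_one_of_pos (by linarith : 0 < 1 + u * v)
      linarith) hN
  have e : ((1 + u * 1) * Real.log (1 + u * 1) - u * 1) / u -
      ((1 + u * 0) * Real.log (1 + u * 0) - u * 0) / u =
      Real.log (1 + u) / u + Real.log (1 + u) - 1 := by
    simp
    field_simp
  rw [e] at h
  simpa using h

lemma RiemannApprox.mono_bound {χ : ℝ → ℝ} {I : ℝ} (h : RiemannApprox χ I) :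
    ∃ B : ℝ, 0 ≤ B ∧ ∀ N : ℕ, 0 < N → |∑ y ∈ Icc 1 N, χ (y / N) - N * I| ≤ B := by
  obtain ⟨B, hB⟩ := h
  exact ⟨B, (abs_nonneg _).trans (hB 1 one_pos), hB⟩

lemma one_le_one_add_log {N : ℕ} (hN : 0 < N) : 1 ≤ 1 + Real.log (2 * N) := by
  have hN1 : (1 : ℝ) ≤ N := by exact_mod_cast hN
  have : 0 ≤ Real.log (2 * N) := Real.log_nonneg (by linarith)
  linarith

/-- A face of the four-dimensional cube: one variable equals `N`. The sums are carried out in turn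
over `x` (giving `phi`), over `z` (giving `psi u / u`) and over `y`. -/
lemma exists_abs_sum_log_face_mul :
    ∃ C : ℝ, ∀ N : ℕ, 0 < N →
      |∑ y ∈ Icc 1 N, ∑ z ∈ Icc 1 N, ∑ x ∈ Icc 1 N, Real.log ((N * x + y * z : ℕ) : ℝ) -
        (N : ℝ) ^ 3 * (2 * Real.log N + (Real.pi ^ 2 / 24 - 9 / 4 + 2 * Real.log 2))| ≤
      C * ((N : ℝ) ^ 2 * (1 + Real.log (2 * N))) := by
  obtain ⟨B, hB0, hB⟩ := riemannApprox_psi_div.mono_bound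
  refine ⟨3 + B, fun N hN => ?_⟩
  have hN' : (0 : ℝ) < N := by exact_mod_cast hN
  have hℓ := one_le_one_add_log hN
  set ℓ := 1 + Real.log (2 * N) with hℓdef
  set I : ℝ := Real.pi ^ 2 / 24 - 9 / 4 + 2 * Real.log 2 with hI
  have h1 : ∀ y ∈ Icc 1 N, |∑ z ∈ Icc 1 N, ∑ x ∈ Icc 1 N, Real.log ((N * x + y * z : ℕ) : ℝ) -
      (N : ℝ) ^ 2 * (2 * Real.log N + psi (y / N) / (y / N))| ≤ 3 * (N * ℓ) := by
    intro y hy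
    have hu := div_mem_Ioc hy
    have h2 := sum_phi_mul_approx hu hN
    have h3 : |∑ z ∈ Icc 1 N, (∑ x ∈ Icc 1 N, Real.log ((N * x + y * z : ℕ) : ℝ) -
        N * (2 * Real.log N + phi (y / N * (z / N))))| ≤ N * ℓ := by
      refine (abs_sum_le_sum_abs _ _).trans ?_
      calc _ ≤ ∑ z ∈ Icc 1 N, ℓ := by
            refine sum_le_sum fun z hz => ?_
            rw [mem_Icc] at hy hz
            have hyz : ((y : ℝ) * z) ≤ (N : ℝ) ^ 2 := by
              rw [sq]
              exact_mod_cast Nat.mul_le_mul hy.2 hz.2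
            have hyz0 : (0 : ℝ) < y * z := by exact_mod_cast Nat.mul_pos hy.1 hz.1
            have := sum_log_mul_add_approx hN hyz0 hyz
            rw [show (y : ℝ) / N * (z / N) = y * z / N ^ 2 by field_simp]
            push_cast
            exact this
        _ = N * ℓ := by simp
    have h4 : ∑ z ∈ Icc 1 N, ∑ x ∈ Icc 1 N, Real.log ((N * x + y * z : ℕ) : ℝ) -
      (N : ℝ) ^ 2 * (2 * Real.log N + psi (y / N) / (y / N)) =
      ∑ z ∈ Icc 1 N, (∑ x ∈ Icc 1 N, Real.log ((N * x + y * z : ℕ) : ℝ) -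
        N * (2 * Real.log N + phi (y / N * (z / N)))) +
      N * (∑ z ∈ Icc 1 N, phi (y / N * (z / N)) - N * (psi (y / N) / (y / N))) := by
      rw [sum_sub_distrib, ← mul_sum, sum_add_distrib]
      simp only [sum_const, Nat.card_Icc, Nat.add_sub_cancel, nsmul_eq_mul]
      ring
    rw [h4]
    refine (abs_add_le _ _).trans ?_
    rw [abs_mul, abs_of_pos hN']
    have h5 : N * |∑ z ∈ Icc 1 N, phi (y / N * (z / N)) - N * (psi (y / N) / (y / N))| ≤
      N * (2 * ℓ) := by gcongr; linarith
    linarith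
  have h2 := hB N hN
  have h3 : |∑ y ∈ Icc 1 N, (∑ z ∈ Icc 1 N, ∑ x ∈ Icc 1 N, Real.log ((N * x + y * z : ℕ) : ℝ) -
      (N : ℝ) ^ 2 * (2 * Real.log N + psi (y / N) / (y / N)))| ≤ N * (3 * (N * ℓ)) := by
    refine (abs_sum_le_sum_abs _ _).trans ((sum_le_sum h1).trans (le_of_eq ?_))
    simp
  have h4 : ∑ y ∈ Icc 1 N, ∑ z ∈ Icc 1 N, ∑ x ∈ Icc 1 N, Real.log ((N * x + y * z : ℕ) : ℝ) -
        (N : ℝ) ^ 3 * (2 * Real.log N + I) =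
      ∑ y ∈ Icc 1 N, (∑ z ∈ Icc 1 N, ∑ x ∈ Icc 1 N, Real.log ((N * x + y * z : ℕ) : ℝ) -
      (N : ℝ) ^ 2 * (2 * Real.log N + psi (y / N) / (y / N))) +
      (N : ℝ) ^ 2 * (∑ y ∈ Icc 1 N, psi (y / N) / (y / N) - N * I) := by
    rw [sum_sub_distrib, ← mul_sum, sum_add_distrib]
    simp only [sum_const, Nat.card_Icc, Nat.add_sub_cancel, nsmul_eq_mul]
    ring
  rw [h4]
  refine (abs_add_le _ _).trans ?_
  rw [abs_mul, abs_of_pos (by positivity : (0 : ℝ) < (N : ℝ) ^ 2)]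
  have h5 : (N : ℝ) ^ 2 * |∑ y ∈ Icc 1 N, psi (y / N) / (y / N) - N * I| ≤
      (N : ℝ) ^ 2 * (B * ℓ) := by
    have : B ≤ B * ℓ := le_mul_of_one_le_right hB0 hℓ
    gcongr
    linarith
  refine (add_le_add h3 h5).trans (le_of_eq ?_)
  ring

/-- The faces on which one factor of the product equals `N`; the sum over `y` gives `phi ((x /
N)²)`. -/
lemma exists_abs_sum_log_face_sq :
    ∃ C : ℝ, ∀ N : ℕ, 0 < N →
      |∑ x ∈ Icc 1 N, ∑ y ∈ Icc 1 N, Real.log ((x ^ 2 + N * y : ℕ) : ℝ) -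
        (N : ℝ) ^ 2 * (2 * Real.log N + (4 / 3 * Real.log 2 - 7 / 3 + Real.pi / 3))| ≤
      C * (N * (1 + Real.log (2 * N))) := by
  obtain ⟨B, hB0, hB⟩ := riemannApprox_phi_sq.mono_bound
  refine ⟨1 + B, fun N hN => ?_⟩
  have hN' : (0 : ℝ) < N := by exact_mod_cast hN
  have hℓ := one_le_one_add_log hN
  set ℓ := 1 + Real.log (2 * N) with hℓdef
  set I : ℝ := 4 / 3 * Real.log 2 - 7 / 3 + Real.pi / 3 with hI
  have h3 : |∑ x ∈ Icc 1 N, (∑ y ∈ Icc 1 N, Real.log ((x ^ 2 + N * y : ℕ) : ℝ) -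
      N * (2 * Real.log N + phi ((x / N) ^ 2)))| ≤ N * ℓ := by
    refine (abs_sum_le_sum_abs _ _).trans ?_
    calc _ ≤ ∑ x ∈ Icc 1 N, ℓ := by
          refine sum_le_sum fun x hx => ?_
          rw [mem_Icc] at hx
          have hx1 : (x : ℝ) ^ 2 ≤ (N : ℝ) ^ 2 := by exact_mod_cast Nat.pow_le_pow_left hx.2 2
          have hx0 : (0 : ℝ) < (x : ℝ) ^ 2 := by
            have : (0 : ℝ) < x := by exact_mod_cast hx.1
            positivity
          have := sum_log_mul_add_approx hN hx0 hx1
          rw [div_pow]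
          push_cast
          simp_rw [add_comm ((x : ℝ) ^ 2)]
          exact this
      _ = N * ℓ := by simp
  have h4 : ∑ x ∈ Icc 1 N, ∑ y ∈ Icc 1 N, Real.log ((x ^ 2 + N * y : ℕ) : ℝ) -
        (N : ℝ) ^ 2 * (2 * Real.log N + I) =
      ∑ x ∈ Icc 1 N, (∑ y ∈ Icc 1 N, Real.log ((x ^ 2 + N * y : ℕ) : ℝ) -
      N * (2 * Real.log N + phi ((x / N) ^ 2))) +
      N * (∑ x ∈ Icc 1 N, phi ((x / N) ^ 2) - N * I) := by
    rw [sum_sub_distrib, ← mul_sum, sum_add_distrib]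
    simp only [sum_const, Nat.card_Icc, Nat.add_sub_cancel, nsmul_eq_mul]
    ring
  rw [h4]
  refine (abs_add_le _ _).trans ?_
  rw [abs_mul, abs_of_pos hN']
  have h5 : N * |∑ x ∈ Icc 1 N, phi ((x / N) ^ 2) - N * I| ≤ N * (B * ℓ) := by
    have : B ≤ B * ℓ := le_mul_of_one_le_right hB0 hℓ
    have := hB N hN
    gcongr
    linarith
  refine (add_le_add h3 h5).trans (le_of_eq ?_)
  ring

/-- The face on which the squared variable equals `N`; scaling out `N²` leaves `log (1 + u v)`. -/
lemma exists_abs_sum_log_face_const :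
    ∃ C : ℝ, ∀ N : ℕ, 0 < N →
      |∑ y ∈ Icc 1 N, ∑ z ∈ Icc 1 N, Real.log ((N ^ 2 + y * z : ℕ) : ℝ) -
        (N : ℝ) ^ 2 * (2 * Real.log N + (Real.pi ^ 2 / 12 + 2 * Real.log 2 - 2))| ≤
      C * (N * (1 + Real.log (2 * N))) := by
  have hR : RiemannApprox (fun u => Real.log (1 + u) / u + Real.log (1 + u) - 1)
      (Real.pi ^ 2 / 12 + 2 * Real.log 2 - 2) := by
    refine ((riemannApprox_log_one_add_div.add riemannApprox_log_one_add).add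
      ((riemannApprox_pow 0).const_mul (-1))).congr (fun u _ => by simp; ring) (by norm_num; ring)
  obtain ⟨B, hB0, hB⟩ := hR.mono_bound
  refine ⟨2 + B, fun N hN => ?_⟩
  have hN' : (0 : ℝ) < N := by exact_mod_cast hN
  have hℓ := one_le_one_add_log hN
  set ℓ := 1 + Real.log (2 * N) with hℓdef
  set I : ℝ := Real.pi ^ 2 / 12 + 2 * Real.log 2 - 2 with hI
  set χ : ℝ → ℝ := fun u => Real.log (1 + u) / u + Real.log (1 + u) - 1 with hχ
  have h1 : ∀ y ∈ Icc 1 N, |∑ z ∈ Icc 1 N, Real.log ((N ^ 2 + y * z : ℕ) : ℝ) -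
      N * (2 * Real.log N + χ (y / N))| ≤ 2 := by
    intro y hy
    have h2 := sum_log_one_add_mul_approx (div_mem_Ioc hy) hN
    have h3 : ∑ z ∈ Icc 1 N, Real.log ((N ^ 2 + y * z : ℕ) : ℝ) =
        N * (2 * Real.log N) + ∑ z ∈ Icc 1 N, Real.log (1 + (y : ℝ) / N * (z / N)) := by
      have : ∀ z ∈ Icc 1 N, Real.log ((N ^ 2 + y * z : ℕ) : ℝ) =
          2 * Real.log N + Real.log (1 + (y : ℝ) / N * (z / N)) := by
        intro z _
        have e : ((N ^ 2 + y * z : ℕ) : ℝ) = (N : ℝ) ^ 2 * (1 + (y : ℝ) / N * (z / N)) := by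
          push_cast; field_simp
        rw [e, Real.log_mul (by positivity) (by positivity), Real.log_pow]
        norm_num
      rw [sum_congr rfl this, sum_add_distrib]
      simp
    rw [h3, mul_add, add_sub_add_left_eq_sub]
    exact h2
  have h3 : |∑ y ∈ Icc 1 N, (∑ z ∈ Icc 1 N, Real.log ((N ^ 2 + y * z : ℕ) : ℝ) -
      N * (2 * Real.log N + χ (y / N)))| ≤ N * 2 := by
    refine (abs_sum_le_sum_abs _ _).trans ((sum_le_sum h1).trans (le_of_eq ?_))
    simp
  have h4 : ∑ y ∈ Icc 1 N, ∑ z ∈ Icc 1 N, Real.log ((N ^ 2 + y * z : ℕ) : ℝ) -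
        (N : ℝ) ^ 2 * (2 * Real.log N + I) =
      ∑ y ∈ Icc 1 N, (∑ z ∈ Icc 1 N, Real.log ((N ^ 2 + y * z : ℕ) : ℝ) -
      N * (2 * Real.log N + χ (y / N))) +
      N * (∑ y ∈ Icc 1 N, χ (y / N) - N * I) := by
    rw [sum_sub_distrib, ← mul_sum, sum_add_distrib]
    simp only [sum_const, Nat.card_Icc, Nat.add_sub_cancel, nsmul_eq_mul]
    ring
  rw [h4]
  refine (abs_add_le _ _).trans ?_
  rw [abs_mul, abs_of_pos hN']
  have h5 : N * |∑ y ∈ Icc 1 N, χ (y / N) - N * I| ≤ N * (B * ℓ) := by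
    have : B ≤ B * ℓ := le_mul_of_one_le_right hB0 hℓ
    gcongr
    exact (hB N hN).trans this
  have h6 : (N : ℝ) * 2 ≤ N * (2 * ℓ) := by gcongr; linarith
  refine (add_le_add (h3.trans h6) h5).trans (le_of_eq ?_)
  ring

/-! ### From the faces to the full cube -/

lemma sum_sum_Icc_succ_sub (h : ℕ → ℕ → ℝ) (n : ℕ) :
    ∑ b ∈ Icc 1 (n + 1), ∑ t ∈ Icc 1 (n + 1), h b t - ∑ b ∈ Icc 1 n, ∑ t ∈ Icc 1 n, h b t =
      ∑ t ∈ Icc 1 (n + 1), h (n + 1) t + ∑ b ∈ Icc 1 (n + 1), h b (n + 1) - h (n + 1) (n + 1) := by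
  have e : ∀ f : ℕ → ℝ, ∑ b ∈ Icc 1 (n + 1), f b = ∑ b ∈ Icc 1 n, f b + f (n + 1) := fun f =>
    sum_Icc_succ_top (by omega) f
  simp only [e, sum_add_distrib]
  ring

lemma sum_Icc_mem {f : ℕ → ℝ} {n : ℕ} {Λ : ℝ} (h : ∀ x ∈ Icc 1 n, 0 ≤ f x ∧ f x ≤ Λ) :
    0 ≤ ∑ x ∈ Icc 1 n, f x ∧ ∑ x ∈ Icc 1 n, f x ≤ n * Λ := by
  refine ⟨sum_nonneg fun x hx => (h x hx).1, (sum_le_sum fun x hx => (h x hx).2).trans ?_⟩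
  simp

/-- Inclusion-exclusion: the new points are three faces, less three edges, plus a corner. -/
lemma abs_cube_three_succ_sub_le {f : ℕ → ℕ → ℕ → ℝ} {n : ℕ} {Λ : ℝ}
    (hf : ∀ x ∈ Icc 1 (n + 1), ∀ b ∈ Icc 1 (n + 1), ∀ t ∈ Icc 1 (n + 1),
      0 ≤ f x b t ∧ f x b t ≤ Λ) :
    |∑ x ∈ Icc 1 (n + 1), ∑ b ∈ Icc 1 (n + 1), ∑ t ∈ Icc 1 (n + 1), f x b t -
      ∑ x ∈ Icc 1 n, ∑ b ∈ Icc 1 n, ∑ t ∈ Icc 1 n, f x b t -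
      (∑ b ∈ Icc 1 (n + 1), ∑ t ∈ Icc 1 (n + 1), f (n + 1) b t +
        ∑ x ∈ Icc 1 (n + 1), ∑ t ∈ Icc 1 (n + 1), f x (n + 1) t +
        ∑ x ∈ Icc 1 (n + 1), ∑ b ∈ Icc 1 (n + 1), f x b (n + 1))| ≤
      3 * ((n + 1 : ℕ) * Λ) := by
  have hz : n + 1 ∈ Icc 1 (n + 1) := by simp
  set z := n + 1 with hzdef
  have h1 : ∑ x ∈ Icc 1 n, ∑ b ∈ Icc 1 n, ∑ t ∈ Icc 1 n, f x b t =
      ∑ x ∈ Icc 1 n, ∑ b ∈ Icc 1 z, ∑ t ∈ Icc 1 z, f x b t -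
        (∑ x ∈ Icc 1 n, ∑ t ∈ Icc 1 z, f x z t + ∑ x ∈ Icc 1 n, ∑ b ∈ Icc 1 z, f x b z -
          ∑ x ∈ Icc 1 n, f x z z) := by
    rw [← sum_add_distrib, ← sum_sub_distrib, ← sum_sub_distrib]
    refine sum_congr rfl fun x _ => ?_
    rw [← sum_sum_Icc_succ_sub (f x) n]
    ring
  have e : ∀ g : ℕ → ℝ, ∑ b ∈ Icc 1 n, g b = ∑ b ∈ Icc 1 z, g b - g z := fun g => by
    rw [hzdef, sum_Icc_succ_top (by omega)]; ring
  rw [h1]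
  simp only [e (fun x => ∑ b ∈ Icc 1 z, ∑ t ∈ Icc 1 z, f x b t),
    e (fun x => ∑ t ∈ Icc 1 z, f x z t), e (fun x => ∑ b ∈ Icc 1 z, f x b z),
    e (fun x => f x z z)]
  have h2 := sum_Icc_mem (f := fun t => f z z t) (n := z) fun t ht => hf z hz z hz t ht
  have h3 := sum_Icc_mem (f := fun b => f z b z) (n := z) fun b hb => hf z hz b hb z hz
  have h4 := sum_Icc_mem (f := fun x => f x z z) (n := z) fun x hx => hf x hx z hz z hz
  have h5 := hf z hz z hz z hz
  have h6 : Λ ≤ (z : ℝ) * Λ := by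
    apply le_mul_of_one_le_left (h5.1.trans h5.2)
    exact_mod_cast (mem_Icc.1 hz).1
  rw [abs_le]
  constructor <;> linarith [h2.1, h2.2, h3.1, h3.2, h4.1, h4.2, h5.1, h5.2]

/-- The new points are four faces up to their pairwise intersections, of which there are six. The
inclusion-exclusion is done for two pairs of variables separately. -/
lemma abs_cube_four_succ_sub_le {f : ℕ → ℕ → ℕ → ℕ → ℝ} {n : ℕ} {Λ : ℝ}
    (hf : ∀ a ∈ Icc 1 (n + 1), ∀ x ∈ Icc 1 (n + 1), ∀ b ∈ Icc 1 (n + 1), ∀ t ∈ Icc 1 (n + 1),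
      0 ≤ f a x b t ∧ f a x b t ≤ Λ) :
    |∑ a ∈ Icc 1 (n + 1), ∑ x ∈ Icc 1 (n + 1), ∑ b ∈ Icc 1 (n + 1), ∑ t ∈ Icc 1 (n + 1), f a x b t -
      ∑ a ∈ Icc 1 n, ∑ x ∈ Icc 1 n, ∑ b ∈ Icc 1 n, ∑ t ∈ Icc 1 n, f a x b t -
      (∑ x ∈ Icc 1 (n + 1), ∑ b ∈ Icc 1 (n + 1), ∑ t ∈ Icc 1 (n + 1), f (n + 1) x b t +
        ∑ a ∈ Icc 1 (n + 1), ∑ b ∈ Icc 1 (n + 1), ∑ t ∈ Icc 1 (n + 1), f a (n + 1) b t +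
        ∑ a ∈ Icc 1 (n + 1), ∑ x ∈ Icc 1 (n + 1), ∑ t ∈ Icc 1 (n + 1), f a x (n + 1) t +
        ∑ a ∈ Icc 1 (n + 1), ∑ x ∈ Icc 1 (n + 1), ∑ b ∈ Icc 1 (n + 1), f a x b (n + 1))| ≤
      6 * (((n + 1 : ℕ) : ℝ) ^ 2 * Λ) := by
  have hz : n + 1 ∈ Icc 1 (n + 1) := by simp
  set z := n + 1 with hzdef
  have hzr : (1 : ℝ) ≤ z := by exact_mod_cast (mem_Icc.1 hz).1
  have h5 := hf z hz z hz z hz z hz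
  have hΛ : 0 ≤ Λ := h5.1.trans h5.2
  have h1 := fun a x => sum_sum_Icc_succ_sub (f a x) n
  have h2 := sum_sum_Icc_succ_sub (fun a x => ∑ b ∈ Icc 1 z, ∑ t ∈ Icc 1 z, f a x b t) n
  have h3 := sum_sum_Icc_succ_sub (fun a x => ∑ t ∈ Icc 1 z, f a x z t +
    ∑ b ∈ Icc 1 z, f a x b z - f a x z z) n
  have h4 : ∑ a ∈ Icc 1 n, ∑ x ∈ Icc 1 n, ∑ b ∈ Icc 1 n, ∑ t ∈ Icc 1 n, f a x b t =
      ∑ a ∈ Icc 1 n, ∑ x ∈ Icc 1 n, ∑ b ∈ Icc 1 z, ∑ t ∈ Icc 1 z, f a x b t -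
      ∑ a ∈ Icc 1 n, ∑ x ∈ Icc 1 n, (∑ t ∈ Icc 1 z, f a x z t +
        ∑ b ∈ Icc 1 z, f a x b z - f a x z z) := by
    rw [← sum_sub_distrib]
    refine sum_congr rfl fun a _ => ?_
    rw [← sum_sub_distrib]
    refine sum_congr rfl fun x _ => ?_
    rw [← h1 a x]; ring
  have hrow : ∀ a ∈ Icc 1 z, ∀ x ∈ Icc 1 z, 0 ≤ ∑ t ∈ Icc 1 z, f a x z t +
      ∑ b ∈ Icc 1 z, f a x b z - f a x z z ∧ ∑ t ∈ Icc 1 z, f a x z t +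
      ∑ b ∈ Icc 1 z, f a x b z - f a x z z ≤ 2 * (z * Λ) := by
    intro a ha x hx
    have e1 := sum_Icc_mem (f := fun t => f a x z t) (n := z) fun t ht => hf a ha x hx z hz t ht
    have e2 := sum_Icc_mem (f := fun b => f a x b z) (n := z) fun b hb => hf a ha x hx b hb z hz
    have e3 := hf a ha x hx z hz z hz
    have e4 : f a x z z ≤ ∑ t ∈ Icc 1 z, f a x z t :=
      single_le_sum (f := fun t => f a x z t) (fun t ht => (hf a ha x hx z hz t ht).1) hz
    constructor <;> linarith [e1.1, e1.2, e2.1, e2.2, e3.1]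
  have e1 := sum_Icc_mem (n := z) fun x hx => hrow z hz x hx
  have e2 := sum_Icc_mem (n := z) fun a ha => hrow a ha z hz
  have e3 := hrow z hz z hz
  have e4 := sum_Icc_mem (f := fun a => ∑ x ∈ Icc 1 z, f a x z z) (n := z)
    fun a ha => sum_Icc_mem fun x hx => hf a ha x hx z hz z hz
  have e5 := sum_Icc_mem (f := fun b => ∑ t ∈ Icc 1 z, f z z b t) (n := z)
    fun b hb => sum_Icc_mem fun t ht => hf z hz z hz b hb t ht
  have e6 : 2 * (z * Λ) ≤ 2 * ((z : ℝ) ^ 2 * Λ) := by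
    have : (z : ℝ) ≤ z ^ 2 := by nlinarith
    gcongr
  rw [h4]
  simp only [sum_add_distrib, sum_sub_distrib] at h2 h3 e1 e2 ⊢
  rw [abs_le]
  have q1 : (z : ℝ) * (z * Λ) = z ^ 2 * Λ := by ring
  have q2 : (z : ℝ) * (2 * (z * Λ)) = 2 * (z ^ 2 * Λ) := by ring
  rw [q1] at e4 e5
  rw [q2] at e1 e2
  constructor <;>
    linarith [e1.1, e1.2, e2.1, e2.2, e3.1, e3.2, e4.1, e4.2, e5.1, e5.2, h5.1, h5.2]

/-- With `m = N (m / N)` the sum becomes Riemann sums of `u ^ p` and `u ^ p log u`; the latter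
produces the shift `-2 / (p + 1)`. -/
lemma exists_abs_sum_pow_mul_log_sub_le {p : ℕ} (hp : 1 ≤ p) :
    ∃ C : ℝ, ∀ N : ℕ, 0 < N → ∀ c : ℝ, |∑ m ∈ Icc 1 N, (m : ℝ) ^ p * (2 * Real.log m + c) -
      (N : ℝ) ^ (p + 1) / (p + 1) * (2 * Real.log N + c - 2 / (p + 1))| ≤
        C * (1 + |c|) * ((N : ℝ) ^ p * (1 + Real.log (2 * N))) := by
  obtain ⟨B, hB0, hB⟩ := (riemannApprox_pow p).mono_bound
  obtain ⟨B', hB0', hB'⟩ := (riemannApprox_pow_mul_log hp).mono_bound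
  refine ⟨2 * B + 2 * B', fun N hN c => ?_⟩
  have hN' : (0 : ℝ) < N := by exact_mod_cast hN
  have hN1 : (1 : ℝ) ≤ N := by exact_mod_cast hN
  have hp1 : (p : ℝ) + 1 ≠ 0 := by positivity
  have h1 : ∑ m ∈ Icc 1 N, (m : ℝ) ^ p * (2 * Real.log m + c) =
      (N : ℝ) ^ p * (2 * ∑ m ∈ Icc 1 N, ((m : ℝ) / N) ^ p * Real.log (m / N) +
        (2 * Real.log N + c) * ∑ m ∈ Icc 1 N, ((m : ℝ) / N) ^ p) := by
    rw [mul_sum, mul_sum, ← sum_add_distrib, mul_sum]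
    refine sum_congr rfl fun m hm => ?_
    have hm0 : (m : ℝ) ≠ 0 := by
      have := (mem_Icc.1 hm).1
      positivity
    rw [Real.log_div hm0 hN'.ne', div_pow]
    field_simp
    ring
  have h2 := hB N hN
  have h3 := hB' N hN
  set S := ∑ m ∈ Icc 1 N, ((m : ℝ) / N) ^ p
  set S' := ∑ m ∈ Icc 1 N, ((m : ℝ) / N) ^ p * Real.log (m / N)
  have h4 : (N : ℝ) ^ p * (2 * S' + (2 * Real.log N + c) * S) -
      (N : ℝ) ^ (p + 1) / (p + 1) * (2 * Real.log N + c - 2 / (p + 1)) =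
      (N : ℝ) ^ p * (2 * (S' - N * -(1 / ((p : ℝ) + 1) ^ 2)) +
        (2 * Real.log N + c) * (S - N * (1 / (p + 1)))) := by
    rw [pow_succ]
    field_simp
    ring
  rw [h1, h4, abs_mul, abs_of_pos (by positivity : (0 : ℝ) < (N : ℝ) ^ p)]
  have hlog : 0 ≤ Real.log N := Real.log_natCast_nonneg N
  have hlog2 : Real.log N ≤ Real.log (2 * N) := Real.log_le_log hN' (by linarith)
  have hc := abs_nonneg c
  have h5 : |2 * (S' - N * -(1 / ((p : ℝ) + 1) ^ 2)) +
        (2 * Real.log N + c) * (S - N * (1 / (p + 1)))| ≤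
      (2 * B + 2 * B') * (1 + |c|) * (1 + Real.log (2 * N)) := by
    refine (abs_add_le _ _).trans ?_
    rw [abs_mul, abs_mul, abs_two]
    have e1 : |2 * Real.log N + c| ≤ 2 * ((1 + |c|) * (1 + Real.log (2 * N))) := by
      refine (abs_add_le _ _).trans ?_
      rw [abs_of_nonneg (by positivity)]
      nlinarith
    have e2 : |2 * Real.log N + c| * |S - N * (1 / (p + 1))| ≤
      2 * ((1 + |c|) * (1 + Real.log (2 * N))) * B :=
      mul_le_mul e1 h2 (abs_nonneg _) ((abs_nonneg _).trans e1)
    have e3 : 1 ≤ (1 + |c|) * (1 + Real.log (2 * N)) := by nlinarith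
    have e4 : 2 * |S' - N * -(1 / ((p : ℝ) + 1) ^ 2)| ≤
        2 * B' * ((1 + |c|) * (1 + Real.log (2 * N))) := by nlinarith
    nlinarith
  calc _ ≤ (N : ℝ) ^ p * ((2 * B + 2 * B') * (1 + |c|) * (1 + Real.log (2 * N))) := by gcongr
    _ = _ := by ring

lemma abs_sub_le_of_increments {S T : ℕ → ℝ} {p : ℕ} {C : ℝ} (hC : 0 ≤ C) (hS : S 0 = 0)
    (h : ∀ n : ℕ, |S (n + 1) - S n - T (n + 1)| ≤
      C * (((n + 1 : ℕ) : ℝ) ^ p * (1 + Real.log (2 * (n + 1 : ℕ))))) {N : ℕ} :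
    |S N - ∑ m ∈ Icc 1 N, T m| ≤ C * ((N : ℝ) ^ (p + 1) * (1 + Real.log (2 * N))) := by
  have h1 : ∀ M ≤ N, |S M - ∑ m ∈ Icc 1 M, T m| ≤
      M * (C * ((N : ℝ) ^ p * (1 + Real.log (2 * N)))) := by
    intro M
    induction M with
    | zero => intro _; simp [hS]
    | succ n ih =>
      intro hn
      rw [sum_Icc_succ_top (by omega)]
      have e1 := ih (by omega)
      have e2 := h n
      have hnN : ((n + 1 : ℕ) : ℝ) ≤ N := by exact_mod_cast hn
      have hn0 : (0 : ℝ) < ((n + 1 : ℕ) : ℝ) := by positivity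
      have e3 : C * (((n + 1 : ℕ) : ℝ) ^ p * (1 + Real.log (2 * (n + 1 : ℕ)))) ≤
          C * ((N : ℝ) ^ p * (1 + Real.log (2 * N))) := by
        have : 0 ≤ Real.log (2 * (n + 1 : ℕ)) := Real.log_nonneg (by
          push_cast
          have : (0 : ℝ) ≤ n := by positivity
          linarith)
        gcongr
      have e4 : S (n + 1) - (∑ m ∈ Icc 1 n, T m + T (n + 1)) =
        (S n - ∑ m ∈ Icc 1 n, T m) + (S (n + 1) - S n - T (n + 1)) := by ring
      rw [e4]
      refine (abs_add_le _ _).trans ?_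
      push_cast
      push_cast at e2 e3
      linarith
  refine (h1 N le_rfl).trans (le_of_eq ?_)
  ring

lemma log_two_mul_sq_le {m : ℕ} (hm : 0 < m) :
    Real.log (2 * (m : ℝ) ^ 2) ≤ 2 * (1 + Real.log (2 * m)) := by
  have hm' : (0 : ℝ) < m := by exact_mod_cast hm
  have h1 : Real.log (2 * (m : ℝ) ^ 2) ≤ Real.log ((2 * m) ^ 2) :=
    Real.log_le_log (by positivity) (by nlinarith [sq_nonneg (m : ℝ)])
  rw [Real.log_pow] at h1
  push_cast at h1
  linarith

lemma log_nat_mem {Q m : ℕ} (h1 : 1 ≤ Q) (h2 : Q ≤ 2 * m ^ 2) :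
    0 ≤ Real.log Q ∧ Real.log Q ≤ 2 * (1 + Real.log (2 * m)) := by
  have hm : 0 < m := by
    rcases Nat.eq_zero_or_pos m with rfl | h
    · simp at h2; omega
    · exact h
  refine ⟨Real.log_natCast_nonneg Q, le_trans (Real.log_le_log (by exact_mod_cast h1) ?_)
    (log_two_mul_sq_le hm)⟩
  exact_mod_cast h2

/-- By symmetry all four faces have the same sum, so the increment of `logSum` is `4 m³ (2 log m +
I)` up to a smaller error. Summing over `m` replaces `I` by `I - 1/2`, which changes `-9/4` into
`-11/4`. -/
theorem exists_abs_logSum_mul_sub_le :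
    ∃ C : ℝ, ∀ N : ℕ, 0 < N → |logSum (Icc 1 N) (fun a x => a * x) N -
      (N : ℝ) ^ 4 * (2 * Real.log N + (Real.pi ^ 2 / 24 - 11 / 4 + 2 * Real.log 2))| ≤
        C * ((N : ℝ) ^ 3 * (1 + Real.log (2 * N))) := by
  obtain ⟨C₁, hC₁⟩ := exists_abs_sum_log_face_mul
  obtain ⟨C₂, hC₂⟩ := exists_abs_sum_pow_mul_log_sub_le (p := 3) (by norm_num)
  set I : ℝ := Real.pi ^ 2 / 24 - 9 / 4 + 2 * Real.log 2 with hI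
  refine ⟨4 * |C₁| + 12 + 4 * (C₂ * (1 + |I|)), fun N hN => ?_⟩
  set F : ℕ → ℝ := fun m => ∑ y ∈ Icc 1 m, ∑ z ∈ Icc 1 m, ∑ x ∈ Icc 1 m,
    Real.log ((m * x + y * z : ℕ) : ℝ) with hF
  have h1 : ∀ n : ℕ, |logSum (Icc 1 (n + 1)) (fun a x => a * x) (n + 1) -
      logSum (Icc 1 n) (fun a x => a * x) n -
        4 * (((n + 1 : ℕ) : ℝ) ^ 3 * (2 * Real.log (n + 1 : ℕ) + I))| ≤
      (4 * |C₁| + 12) * (((n + 1 : ℕ) : ℝ) ^ 2 * (1 + Real.log (2 * (n + 1 : ℕ)))) := by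
    intro n
    have e1 := abs_cube_four_succ_sub_le (n := n)
      (f := fun a x b t => Real.log ((a * x + b * t : ℕ) : ℝ))
      (Λ := 2 * (1 + Real.log (2 * (n + 1 : ℕ))))
      (by
        intro a ha x hx b hb t ht
        rw [mem_Icc] at ha hx hb ht
        apply log_nat_mem
        · have := Nat.mul_pos ha.1 hx.1
          omega
        · have q1 := Nat.mul_le_mul ha.2 hx.2
          have q2 := Nat.mul_le_mul hb.2 ht.2
          rw [sq]; omega)
    set m := n + 1 with hm
    have hm0 : 0 < m := by omega
    have f1 : ∑ x ∈ Icc 1 m, ∑ b ∈ Icc 1 m, ∑ t ∈ Icc 1 m, Real.log ((m * x + b * t : ℕ) : ℝ) =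
        F m := by
      rw [sum_comm]
      refine sum_congr rfl fun y _ => ?_
      rw [sum_comm]
    have f2 : ∑ a ∈ Icc 1 m, ∑ b ∈ Icc 1 m, ∑ t ∈ Icc 1 m, Real.log ((a * m + b * t : ℕ) : ℝ) =
        F m := by
      rw [← f1]
      simp_rw [mul_comm _ m]
    have f3 : ∑ a ∈ Icc 1 m, ∑ x ∈ Icc 1 m, ∑ t ∈ Icc 1 m, Real.log ((a * x + m * t : ℕ) : ℝ) =
        F m := by
      simp_rw [add_comm _ (m * _)]
      rfl
    have f4 : ∑ a ∈ Icc 1 m, ∑ x ∈ Icc 1 m, ∑ b ∈ Icc 1 m, Real.log ((a * x + b * m : ℕ) : ℝ) =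
        F m := by
      rw [← f3]
      simp_rw [mul_comm _ m]
    rw [f1, f2, f3, f4] at e1
    have e2 := hC₁ m hm0
    have e3 : C₁ * ((m : ℝ) ^ 2 * (1 + Real.log (2 * m))) ≤
        |C₁| * ((m : ℝ) ^ 2 * (1 + Real.log (2 * m))) := by
      have := one_le_one_add_log hm0
      gcongr
      exact le_abs_self _
    have e4 : 6 * ((m : ℝ) ^ 2 * (2 * (1 + Real.log (2 * m)))) =
      12 * ((m : ℝ) ^ 2 * (1 + Real.log (2 * m))) := by ring
    rw [e4] at e1
    change |F m - _| ≤ _ at e2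
    rw [abs_le] at e1 e2 ⊢
    simp only [logSum]
    constructor <;> linarith [e1.1, e1.2, e2.1, e2.2]
  have h2 := abs_sub_le_of_increments (S := fun n => logSum (Icc 1 n) (fun a x => a * x) n)
    (T := fun m => 4 * ((m : ℝ) ^ 3 * (2 * Real.log m + I))) (by positivity)
    (by simp [logSum]) h1 (N := N)
  have h3 := hC₂ N hN I
  rw [← mul_sum, show 2 + 1 = 3 from rfl] at h2
  have h4 : (N : ℝ) ^ 4 * (2 * Real.log N + (Real.pi ^ 2 / 24 - 11 / 4 + 2 * Real.log 2)) =
      4 * ((N : ℝ) ^ (3 + 1) / ((3 : ℕ) + 1) * (2 * Real.log N + I - 2 / ((3 : ℕ) + 1))) := by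
    rw [hI]; push_cast; ring
  rw [h4]
  rw [abs_le] at h2 h3 ⊢
  constructor <;> linarith [h2.1, h2.2, h3.1, h3.2]

/-- Two faces carry the constant `I₁` and one carries `I₂`; summing the increments replaces their
mean `I` by `I - 2/3`. -/
theorem exists_abs_logSum_sq_sub_le :
    ∃ C : ℝ, ∀ N : ℕ, 0 < N → |logSum {1} (fun _ x => x ^ 2) N -
      (N : ℝ) ^ 3 * (2 * Real.log N +
        (Real.pi ^ 2 + 8 * Real.pi - 104 + 56 * Real.log 2) / 36)| ≤
        C * ((N : ℝ) ^ 2 * (1 + Real.log (2 * N))) := by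
  obtain ⟨C₁, hC₁⟩ := exists_abs_sum_log_face_sq
  obtain ⟨C₃, hC₃⟩ := exists_abs_sum_log_face_const
  obtain ⟨C₂, hC₂⟩ := exists_abs_sum_pow_mul_log_sub_le (p := 2) (by norm_num)
  set I₁ : ℝ := 4 / 3 * Real.log 2 - 7 / 3 + Real.pi / 3 with hI₁
  set I₂ : ℝ := Real.pi ^ 2 / 12 + 2 * Real.log 2 - 2 with hI₂
  set I : ℝ := (2 * I₁ + I₂) / 3 with hI
  refine ⟨2 * |C₁| + |C₃| + 6 + 3 * (C₂ * (1 + |I|)), fun N hN => ?_⟩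
  set F : ℕ → ℝ := fun m => ∑ x ∈ Icc 1 m, ∑ y ∈ Icc 1 m,
    Real.log ((x ^ 2 + m * y : ℕ) : ℝ) with hF
  have h1 : ∀ n : ℕ, |logSum {1} (fun _ x => x ^ 2) (n + 1) -
      logSum {1} (fun _ x => x ^ 2) n -
        3 * (((n + 1 : ℕ) : ℝ) ^ 2 * (2 * Real.log (n + 1 : ℕ) + I))| ≤
      (2 * |C₁| + |C₃| + 6) * (((n + 1 : ℕ) : ℝ) ^ 1 * (1 + Real.log (2 * (n + 1 : ℕ)))) := by
    intro n
    have e1 := abs_cube_three_succ_sub_le (n := n)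
      (f := fun x b t => Real.log ((x ^ 2 + b * t : ℕ) : ℝ))
      (Λ := 2 * (1 + Real.log (2 * (n + 1 : ℕ))))
      (by
        intro x hx b hb t ht
        rw [mem_Icc] at hx hb ht
        apply log_nat_mem
        · have := Nat.mul_pos hb.1 ht.1
          omega
        · have q1 := Nat.pow_le_pow_left hx.2 2
          have q2 := Nat.mul_le_mul hb.2 ht.2
          rw [sq] at q1 ⊢
          rw [sq] at q1 ⊢
          omega)
    set m := n + 1 with hm
    have hm0 : 0 < m := by omega
    have f4 : ∑ x ∈ Icc 1 m, ∑ b ∈ Icc 1 m, Real.log ((x ^ 2 + b * m : ℕ) : ℝ) = F m := by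
      simp_rw [mul_comm _ m]
      rfl
    have e2 := hC₁ m hm0
    have e5 := hC₃ m hm0
    have hl := one_le_one_add_log hm0
    have e3 : C₁ * (m * (1 + Real.log (2 * m))) ≤ |C₁| * (m * (1 + Real.log (2 * m))) := by
      gcongr
      exact le_abs_self _
    have e6 : C₃ * (m * (1 + Real.log (2 * m))) ≤ |C₃| * (m * (1 + Real.log (2 * m))) := by
      gcongr
      exact le_abs_self _
    have e4 : 3 * ((m : ℝ) * (2 * (1 + Real.log (2 * m)))) =
      6 * ((m : ℝ) * (1 + Real.log (2 * m))) := by ring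
    rw [f4, e4] at e1
    have e7 : 3 * ((m : ℝ) ^ 2 * (2 * Real.log m + I)) =
      2 * ((m : ℝ) ^ 2 * (2 * Real.log m + I₁)) + (m : ℝ) ^ 2 * (2 * Real.log m + I₂) := by
      rw [hI]; ring
    rw [e7, pow_one]
    change |F m - _| ≤ _ at e2
    simp only [logSum, sum_singleton]
    rw [abs_le] at e1 e2 e5 ⊢
    constructor <;> linarith [e1.1, e1.2, e2.1, e2.2, e5.1, e5.2]
  have h2 := abs_sub_le_of_increments (S := fun n => logSum {1} (fun _ x => x ^ 2) n)
    (T := fun m => 3 * ((m : ℝ) ^ 2 * (2 * Real.log m + I))) (by positivity)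
    (by simp [logSum]) h1 (N := N)
  have h3 := hC₂ N hN I
  rw [← mul_sum, show 1 + 1 = 2 from rfl] at h2
  have h4 : (N : ℝ) ^ 3 * (2 * Real.log N +
        (Real.pi ^ 2 + 8 * Real.pi - 104 + 56 * Real.log 2) / 36) =
      3 * ((N : ℝ) ^ (2 + 1) / ((2 : ℕ) + 1) * (2 * Real.log N + I - 2 / ((2 : ℕ) + 1))) := by
    rw [hI, hI₁, hI₂]; push_cast; ring
  rw [h4]
  rw [abs_le] at h2 h3 ⊢
  constructor <;> linarith [h2.1, h2.2, h3.1, h3.2]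

/-! ### The Dirichlet series of `φ` and the values of the constants -/

lemma LSeriesSummable_totient {s : ℂ} (hs : 2 < s.re) :
    LSeriesSummable (fun n => (n.totient : ℂ)) s := by
  refine LSeriesSummable_of_le_const_mul_rpow hs ⟨1, fun n hn => ?_⟩
  norm_num
  exact_mod_cast Nat.totient_le n

lemma LSeries_natCast {s : ℂ} (hs : 2 < s.re) :
    LSeries (fun n => (n : ℂ)) s = riemannZeta (s - 1) := by
  have hs' : 1 < (s - 1).re := by simp; linarith
  rw [← LSeries_one_eq_riemannZeta hs', LSeries, LSeries]
  refine tsum_congr fun n => ?_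
  rcases eq_or_ne n 0 with rfl | hn
  · simp
  · have hn' : (n : ℂ) ≠ 0 := by exact_mod_cast hn
    rw [LSeries.term_of_ne_zero hn, LSeries.term_of_ne_zero hn, Complex.cpow_sub _ _ hn',
      Complex.cpow_one]
    simp

/-- The Dirichlet series of Euler's totient function. -/
theorem LSeries_totient {s : ℂ} (hs : 2 < s.re) :
    LSeries (fun n => (n.totient : ℂ)) s = riemannZeta (s - 1) / riemannZeta s := by
  have hs1 : 1 < s.re := by linarith
  rw [eq_div_iff (riemannZeta_ne_zero_of_one_lt_re hs1), ← LSeries_natCast hs,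
    ← LSeries_one_eq_riemannZeta hs1,
    ← LSeries_convolution' (LSeriesSummable_totient hs) (LSeriesSummable_one_iff.2 hs1)]
  refine LSeries_congr (fun {n} _ => ?_) s
  rw [LSeries.convolution_def]
  simp only [Pi.one_apply, mul_one]
  rw [Nat.sum_divisorsAntidiagonal (f := fun i _ => (i.totient : ℂ))]
  exact_mod_cast Nat.sum_totient n

theorem LSeriesHasSum_totient {s : ℂ} (hs : 2 < s.re) :
    LSeriesHasSum (fun n => (n.totient : ℂ)) s (riemannZeta (s - 1) / riemannZeta s) := by
  rw [← LSeries_totient hs]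
  exact (LSeriesSummable_totient hs).LSeriesHasSum

/-- The derivative of an L-series is minus the series with weight `log n`; it is compared with the
quotient rule for `ζ(s - 1) / ζ(s)`. -/
theorem LSeries_logMul_totient {s : ℂ} (hs : 2 < s.re) :
    LSeries (LSeries.logMul fun n => (n.totient : ℂ)) s =
      riemannZeta (s - 1) / riemannZeta s *
        (deriv riemannZeta s / riemannZeta s - deriv riemannZeta (s - 1) / riemannZeta (s - 1)) := by
  have habs : LSeries.abscissaOfAbsConv (fun n => (n.totient : ℂ)) < s.re := by
    refine lt_of_le_of_lt (b := ((2 : ℝ) : EReal)) ?_ (by exact_mod_cast hs)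
    refine LSeries.abscissaOfAbsConv_le_of_forall_lt_LSeriesSummable fun y hy => ?_
    exact LSeriesSummable_totient (by simpa using hy)
  have h1 := LSeries_hasDerivAt habs
  have hz : riemannZeta s ≠ 0 := riemannZeta_ne_zero_of_one_lt_re (by linarith)
  have hz' : riemannZeta (s - 1) ≠ 0 :=
    riemannZeta_ne_zero_of_one_lt_re (by simp; linarith)
  have hne : s ≠ 1 := by rintro rfl; norm_num at hs
  have hne' : s - 1 ≠ 1 := by
    intro h
    have : s = 2 := by linear_combination h
    subst this; norm_num at hs
  have d1 := (differentiableAt_riemannZeta hne).hasDerivAt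
  have d2 : HasDerivAt (fun z => riemannZeta (z - 1)) (deriv riemannZeta (s - 1)) s :=
    HasDerivAt.comp_sub_const s 1 (differentiableAt_riemannZeta hne').hasDerivAt
  have h2 := d2.div d1 hz
  have heq : (LSeries fun n => (n.totient : ℂ)) =ᶠ[nhds s]
      ((fun z => riemannZeta (z - 1)) / riemannZeta) := by
    have : {z : ℂ | 2 < z.re} ∈ nhds s :=
      (isOpen_lt continuous_const Complex.continuous_re).mem_nhds hs
    filter_upwards [this] with z hz
    exact LSeries_totient hz
  have h3 := (h2.congr_of_eventuallyEq heq).unique h1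
  rw [eq_neg_iff_add_eq_zero] at h3
  field_simp at h3 ⊢
  linear_combination h3

lemma sigL_eq_LSeries (k : ℕ) :
    (sigL k : ℂ) = LSeries (fun n => (n.totient : ℂ)) (k + 2 : ℕ) := by
  rw [sigL, Complex.ofReal_tsum, LSeries]
  refine tsum_congr fun n => ?_
  rcases eq_or_ne n 0 with rfl | hn
  · simp
  · rw [LSeries.term_of_ne_zero hn, Complex.cpow_natCast]
    push_cast; rfl

lemma sigM_eq_LSeries (k : ℕ) :
    (sigM k : ℂ) = k * LSeries (LSeries.logMul fun n => (n.totient : ℂ)) (k + 2 : ℕ) := by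
  rw [sigM, Complex.ofReal_tsum, LSeries, ← tsum_mul_left]
  refine tsum_congr fun n => ?_
  rcases eq_or_ne n 0 with rfl | hn
  · simp
  · rw [LSeries.term_of_ne_zero hn, Complex.cpow_natCast, LSeries.logMul]
    push_cast
    ring

theorem sigL_one : (sigL 1 : ℂ) = riemannZeta 2 / riemannZeta 3 := by
  rw [sigL_eq_LSeries, LSeries_totient (by norm_num)]
  norm_num

theorem sigL_two : (sigL 2 : ℂ) = riemannZeta 3 / riemannZeta 4 := by
  rw [sigL_eq_LSeries, LSeries_totient (by norm_num)]
  norm_num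

theorem sigM_one : (sigM 1 : ℂ) = riemannZeta 2 / riemannZeta 3 *
    (deriv riemannZeta 3 / riemannZeta 3 - deriv riemannZeta 2 / riemannZeta 2) := by
  rw [sigM_eq_LSeries, LSeries_logMul_totient (by norm_num)]
  norm_num

theorem sigM_two : (sigM 2 : ℂ) = 2 * (riemannZeta 3 / riemannZeta 4 *
    (deriv riemannZeta 4 / riemannZeta 4 - deriv riemannZeta 3 / riemannZeta 3)) := by
  rw [sigM_eq_LSeries, LSeries_logMul_totient (by norm_num)]
  norm_num

/-! ### From integers `N` to real `X` -/

lemma one_add_log_two_mul_pow_le {δ X : ℝ} (hδ : 0 < δ) (hX : 3 ≤ X) :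
    1 + Real.log (2 * X) ≤ (1 + 2 / δ) * X ^ δ := by
  have hX0 : 0 < X := by linarith
  have h1 : Real.log (2 * X) ≤ 2 * Real.log X := by
    rw [← Real.log_rpow hX0]
    refine Real.log_le_log (by linarith) ?_
    rw [Real.rpow_two]; nlinarith
  have h2 := Real.log_le_rpow_div hX0.le hδ
  have h3 : 1 ≤ X ^ δ := Real.one_le_rpow (by linarith) hδ.le
  have h4 : (1 + 2 / δ) * X ^ δ = X ^ δ + 2 * (X ^ δ / δ) := by ring
  rw [h4]; linarith

/-- Replacing `X` by its floor changes `X^(m+1)` by `O(X^m)` and `log X` by at most `1 / ⌊X⌋`. -/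
lemma abs_floor_pow_mul_log_sub_le (A B : ℝ) (m : ℕ) {X : ℝ} (hX : 3 ≤ X) :
    |(⌊X⌋₊ : ℝ) ^ (m + 1) * (A * Real.log ⌊X⌋₊ + B) - X ^ (m + 1) * (A * Real.log X + B)| ≤
      ((|A| + |B|) * (m + 2)) * (X ^ m * (1 + Real.log (2 * X))) := by
  set N : ℝ := (⌊X⌋₊ : ℝ) with hN
  have hX0 : 0 < X := by linarith
  have hNX : N ≤ X := Nat.floor_le hX0.le
  have hXN : X < N + 1 := Nat.lt_floor_add_one X
  have hN0 : 0 < N := by linarith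
  have hlogX : 0 ≤ Real.log X := Real.log_nonneg (by linarith)
  have hlog2 : Real.log X ≤ Real.log (2 * X) := Real.log_le_log hX0 (by linarith)
  have hlogN : Real.log N ≤ Real.log X := Real.log_le_log hN0 hNX
  have e1 : X ^ (m + 1) - N ^ (m + 1) ≤ (m + 1) * X ^ m := by
    have := abs_pow_sub_pow_le X N (m + 1)
    rw [Nat.add_sub_cancel, abs_of_nonneg (by linarith : 0 ≤ X - N), abs_of_pos hX0,
      abs_of_pos hN0, max_eq_left hNX] at this
    have h2 : (X - N) * ((m + 1 : ℕ) : ℝ) * X ^ m ≤ 1 * ((m + 1 : ℕ) : ℝ) * X ^ m := by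
      gcongr; linarith
    push_cast at *
    linarith [le_abs_self (X ^ (m + 1) - N ^ (m + 1))]
  have e1' : 0 ≤ X ^ (m + 1) - N ^ (m + 1) := by
    rw [sub_nonneg]; gcongr
  have e2 : N ^ (m + 1) * (Real.log X - Real.log N) ≤ X ^ m := by
    have h3 : Real.log X - Real.log N ≤ 1 / N := by
      rw [← Real.log_div hX0.ne' hN0.ne']
      refine (Real.log_le_sub_one_of_pos (by positivity)).trans ?_
      rw [div_sub_one hN0.ne']
      gcongr; linarith
    calc _ ≤ N ^ (m + 1) * (1 / N) := by gcongr
      _ = N ^ m := by rw [pow_succ]; field_simp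
      _ ≤ X ^ m := by gcongr
  have e2' : 0 ≤ N ^ (m + 1) * (Real.log X - Real.log N) :=
    mul_nonneg (by positivity) (by linarith)
  have e3 : N ^ (m + 1) * (A * Real.log N + B) - X ^ (m + 1) * (A * Real.log X + B) =
    -(A * ((X ^ (m + 1) - N ^ (m + 1)) * Real.log X + N ^ (m + 1) * (Real.log X - Real.log N)) +
      B * (X ^ (m + 1) - N ^ (m + 1))) := by ring
  rw [e3, abs_neg]
  refine (abs_add_le _ _).trans ?_
  rw [abs_mul, abs_mul, abs_of_nonneg e1',
    abs_of_nonneg (add_nonneg (mul_nonneg e1' hlogX) e2')]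
  have hXm : 0 < X ^ m := by positivity
  have e4 : (X ^ (m + 1) - N ^ (m + 1)) * Real.log X ≤ (m + 1) * X ^ m * Real.log (2 * X) := by
    gcongr
  have e5 : (X ^ (m + 1) - N ^ (m + 1)) * Real.log X + N ^ (m + 1) * (Real.log X - Real.log N) ≤
      (m + 2) * (X ^ m * (1 + Real.log (2 * X))) := by
    have : 0 ≤ X ^ m * Real.log (2 * X) := mul_nonneg hXm.le (hlogX.trans hlog2)
    nlinarith
  have e6 : X ^ (m + 1) - N ^ (m + 1) ≤ (m + 2) * (X ^ m * (1 + Real.log (2 * X))) := by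
    have : 0 ≤ (m + 2) * (X ^ m * Real.log (2 * X)) :=
      mul_nonneg (by positivity) (mul_nonneg hXm.le (hlogX.trans hlog2))
    nlinarith
  calc _ ≤ |A| * ((m + 2) * (X ^ m * (1 + Real.log (2 * X)))) +
      |B| * ((m + 2) * (X ^ m * (1 + Real.log (2 * X)))) := by gcongr
    _ = _ := by ring

/-- Passage from an asymptotic formula at integers to one at real numbers. -/
theorem exists_abs_floor_sub_le {T : ℕ → ℝ} {A B C : ℝ} {m : ℕ}
    (h : ∀ N : ℕ, 0 < N → |T N - (N : ℝ) ^ (m + 1) * (A * Real.log N + B)| ≤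
      C * ((N : ℝ) ^ m * (N : ℝ) ^ (2 / 3 : ℝ) * (1 + Real.log (2 * N)) ^ 3))
    {ε : ℝ} (hε : 0 < ε) :
    ∃ C' : ℝ, ∀ X : ℝ, 3 ≤ X → |T ⌊X⌋₊ - X ^ (m + 1) * (A * Real.log X + B)| ≤
      C' * X ^ (m + 2 / 3 + ε : ℝ) := by
  -- Each of the three logarithmic factors is absorbed into `X^(ε/3)` at the cost of a factor `1 + 2
  -- / (ε/3)`.
  refine ⟨(|C| + (|A| + |B|) * (m + 2)) * (1 + 2 / (ε / 3)) ^ 3, fun X hX => ?_⟩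
  have hX0 : 0 < X := by linarith
  have hN : 0 < ⌊X⌋₊ := Nat.floor_pos.2 (by linarith)
  have hNX : (⌊X⌋₊ : ℝ) ≤ X := Nat.floor_le hX0.le
  have hN1 : (1 : ℝ) ≤ ⌊X⌋₊ := by exact_mod_cast hN
  have hl : 1 ≤ 1 + Real.log (2 * X) := by
    linarith [Real.log_nonneg (by linarith : 1 ≤ 2 * X)]
  have hlN : 0 ≤ Real.log (2 * (⌊X⌋₊ : ℝ)) := Real.log_nonneg (by linarith)
  have h1 : |T ⌊X⌋₊ - (⌊X⌋₊ : ℝ) ^ (m + 1) * (A * Real.log ⌊X⌋₊ + B)| ≤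
      |C| * (X ^ m * X ^ (2 / 3 : ℝ) * (1 + Real.log (2 * X)) ^ 3) := by
    refine (h _ hN).trans ?_
    gcongr
    exact le_abs_self C
  have h2 := abs_floor_pow_mul_log_sub_le A B m hX
  have h3 : X ^ m * (1 + Real.log (2 * X)) ≤
      X ^ m * X ^ (2 / 3 : ℝ) * (1 + Real.log (2 * X)) ^ 3 := by
    rw [mul_assoc]
    have a1 : 1 ≤ X ^ (2 / 3 : ℝ) := Real.one_le_rpow (by linarith) (by norm_num)
    have a2 : 1 + Real.log (2 * X) ≤ (1 + Real.log (2 * X)) ^ 3 := le_self_pow₀ hl (by norm_num)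
    gcongr
    nlinarith
  have h4 : (1 + Real.log (2 * X)) ^ 3 ≤ (1 + 2 / (ε / 3)) ^ 3 * X ^ ε := by
    calc _ ≤ ((1 + 2 / (ε / 3)) * X ^ (ε / 3)) ^ 3 := by
          gcongr; exact one_add_log_two_mul_pow_le (by positivity) hX
      _ = _ := by
        rw [mul_pow, ← Real.rpow_natCast (X ^ (ε / 3)), ← Real.rpow_mul hX0.le]
        norm_num
  have h5 : X ^ (m + 2 / 3 + ε : ℝ) = X ^ m * X ^ (2 / 3 : ℝ) * X ^ ε := by
    rw [Real.rpow_add hX0, Real.rpow_add hX0, Real.rpow_natCast]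
  calc _ ≤ |T ⌊X⌋₊ - (⌊X⌋₊ : ℝ) ^ (m + 1) * (A * Real.log ⌊X⌋₊ + B)| +
      |(⌊X⌋₊ : ℝ) ^ (m + 1) * (A * Real.log ⌊X⌋₊ + B) -
        X ^ (m + 1) * (A * Real.log X + B)| := abs_sub_le _ _ _
    _ ≤ |C| * (X ^ m * X ^ (2 / 3 : ℝ) * (1 + Real.log (2 * X)) ^ 3) +
      (|A| + |B|) * (m + 2) * (X ^ m * X ^ (2 / 3 : ℝ) * (1 + Real.log (2 * X)) ^ 3) :=
        add_le_add h1 (h2.trans (by gcongr))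
    _ = (|C| + (|A| + |B|) * (m + 2)) * (X ^ m * X ^ (2 / 3 : ℝ)) *
        (1 + Real.log (2 * X)) ^ 3 := by ring
    _ ≤ (|C| + (|A| + |B|) * (m + 2)) * (X ^ m * X ^ (2 / 3 : ℝ)) *
        ((1 + 2 / (ε / 3)) ^ 3 * X ^ ε) := by gcongr
    _ = _ := by rw [h5]; ring

lemma abs_tauSum_sub_le_of_logSum {T S L G I C₁ C₂ : ℝ} {m N : ℕ} (hN : 0 < N)
    (h1 : |T - (L * S + G * (N : ℝ) ^ (m + 1))| ≤
      C₁ * ((N : ℝ) ^ m * (N : ℝ) ^ (2 / 3 : ℝ) * (1 + Real.log (2 * N)) ^ 3))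
    (h2 : |S - (N : ℝ) ^ (m + 1) * (2 * Real.log N + I)| ≤
      C₂ * ((N : ℝ) ^ m * (1 + Real.log (2 * N)))) :
    |T - (N : ℝ) ^ (m + 1) * (2 * L * Real.log N + (L * I + G))| ≤
      (C₁ + |L| * |C₂|) *
        ((N : ℝ) ^ m * (N : ℝ) ^ (2 / 3 : ℝ) * (1 + Real.log (2 * N)) ^ 3) := by
  have hl := one_le_one_add_log hN
  have hN1 : (1 : ℝ) ≤ N := by exact_mod_cast hN
  have h3 : (N : ℝ) ^ m * (1 + Real.log (2 * N)) ≤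
      (N : ℝ) ^ m * (N : ℝ) ^ (2 / 3 : ℝ) * (1 + Real.log (2 * N)) ^ 3 := by
    rw [mul_assoc]
    have a1 : 1 ≤ (N : ℝ) ^ (2 / 3 : ℝ) := Real.one_le_rpow hN1 (by norm_num)
    have a2 : 1 + Real.log (2 * N) ≤ (1 + Real.log (2 * N)) ^ 3 := le_self_pow₀ hl (by norm_num)
    gcongr
    nlinarith
  have e : T - (N : ℝ) ^ (m + 1) * (2 * L * Real.log N + (L * I + G)) =
      (T - (L * S + G * (N : ℝ) ^ (m + 1))) +
        L * (S - (N : ℝ) ^ (m + 1) * (2 * Real.log N + I)) := by ring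
  rw [e, add_mul]
  refine (abs_add_le _ _).trans (add_le_add h1 ?_)
  rw [abs_mul, mul_assoc]
  gcongr
  refine h2.trans ?_
  gcongr
  exact le_abs_self _

/-- The divisor sum over `a x + b t`, with real constants. -/
theorem exists_abs_tauSum_mul_sub_le : ∃ C : ℝ, ∀ N : ℕ, 0 < N →
    |tauSum (Icc 1 N) (fun a x => a * x) N - (N : ℝ) ^ (3 + 1) * (2 * sigL 1 * Real.log N +
      (sigL 1 * (Real.pi ^ 2 / 24 - 11 / 4 + 2 * Real.log 2) +
        2 * (sigL 1 * Real.eulerMascheroniConstant - sigM 1)))| ≤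
      C * ((N : ℝ) ^ 3 * (N : ℝ) ^ (2 / 3 : ℝ) * (1 + Real.log (2 * N)) ^ 3) := by
  obtain ⟨C₁, hC₁⟩ := exists_abs_tauSum_sub_le (k := 1) le_rfl
  obtain ⟨C₂, hC₂⟩ := exists_abs_logSum_mul_sub_le
  refine ⟨C₁ + |sigL 1| * |C₂|, fun N hN => abs_tauSum_sub_le_of_logSum hN ?_ (hC₂ N hN)⟩
  have hN1 : (1 : ℝ) ≤ N := by exact_mod_cast hN
  have h := hC₁ (Icc 1 N) (fun a x => a * x) N hN (fun a x y h => Nat.mul_le_mul_left a h)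
    (fun a ha x hx => by
      rw [mem_Icc] at ha hx
      rw [sq]; exact Nat.mul_le_mul ha.2 hx.2)
    (fun d K hd hK _ => by
      rw [Nat.card_Icc, Nat.add_sub_cancel]
      exact collisions_mul_le hd hK N)
    (fun d M hd _ => by
      refine (abs_densSum_mul_sub_le hd M N).trans ?_
      rw [Nat.card_Icc, Nat.add_sub_cancel]
      have a1 : 1 ≤ (N : ℝ) ^ (2 / 3 : ℝ) := Real.one_le_rpow hN1 (by norm_num)
      have e : 3 * (N : ℝ) ^ 3 = 3 * N * (N : ℝ) ^ 2 * 1 := by ring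
      rw [e]
      gcongr)
  rw [Nat.card_Icc, Nat.add_sub_cancel] at h
  have e1 : (N : ℝ) * (N : ℝ) ^ 3 = (N : ℝ) ^ (3 + 1) := by ring
  have e2 : (N : ℝ) * (N : ℝ) ^ 2 = (N : ℝ) ^ 3 := by ring
  rwa [e1, e2] at h

/-- The divisor sum over `x ^ 2 + b t`, with real constants. -/
theorem exists_abs_tauSum_sq_sub_le : ∃ C : ℝ, ∀ N : ℕ, 0 < N →
    |tauSum {1} (fun _ x => x ^ 2) N - (N : ℝ) ^ (2 + 1) * (2 * sigL 2 * Real.log N +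
      (sigL 2 * ((Real.pi ^ 2 + 8 * Real.pi - 104 + 56 * Real.log 2) / 36) +
        2 * (sigL 2 * Real.eulerMascheroniConstant - sigM 2)))| ≤
      C * ((N : ℝ) ^ 2 * (N : ℝ) ^ (2 / 3 : ℝ) * (1 + Real.log (2 * N)) ^ 3) := by
  obtain ⟨C₁, hC₁⟩ := exists_abs_tauSum_sub_le (k := 2) (by norm_num)
  obtain ⟨C₂, hC₂⟩ := exists_abs_logSum_sq_sub_le
  refine ⟨C₁ + |sigL 2| * |C₂|, fun N hN => abs_tauSum_sub_le_of_logSum hN ?_ (hC₂ N hN)⟩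
  have hN1 : (1 : ℝ) ≤ N := by exact_mod_cast hN
  have h := hC₁ {1} (fun _ x => x ^ 2) N hN (fun a x y h => Nat.pow_le_pow_left h 2)
    (fun a ha x hx => by
      rw [mem_Icc] at hx
      exact Nat.pow_le_pow_left hx.2 2)
    (fun d K hd hK hKN => by
      rw [card_singleton, Nat.cast_one, one_mul]
      exact collisions_sq_le hd hK hKN)
    (fun d M hd hdN => by
      refine (abs_densSum_sq_sub_le hd M N).trans ?_
      have a1 : 1 ≤ (N : ℝ) ^ (2 / 3 : ℝ) := Real.one_le_rpow hN1 (by norm_num)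
      -- With `d ≤ 2 N` this gives `1 + √d ≤ 3 N^(2/3)`, so the density error has the form required
      -- by the general theorem.
      have a2 : √(d : ℝ) ≤ 2 * (N : ℝ) ^ (2 / 3 : ℝ) := by
        have b1 : √(d : ℝ) ≤ √(2 ^ 2 * N) := by
          apply Real.sqrt_le_sqrt
          have : (d : ℝ) ≤ 2 * N := by exact_mod_cast hdN
          linarith
        rw [Real.sqrt_mul (by norm_num), Real.sqrt_sq (by norm_num),
            Real.sqrt_eq_rpow (N : ℝ)] at b1
        exact b1.trans (mul_le_mul_of_nonneg_left
          (Real.rpow_le_rpow_of_exponent_le hN1 (by norm_num)) (by norm_num))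
      have e : 3 * ((#({1} : Finset ℕ) : ℕ) : ℝ) * (N : ℝ) ^ 2 * (N : ℝ) ^ (2 / 3 : ℝ) =
        (N : ℝ) ^ 2 * (3 * (N : ℝ) ^ (2 / 3 : ℝ)) := by
        rw [card_singleton]; push_cast; ring
      rw [e]
      gcongr
      linarith)
  rw [card_singleton, Nat.cast_one, one_mul, one_mul] at h
  exact h

lemma tauSum_floor_eq_tauSumFT (X : ℝ) :
    tauSum (Icc 1 ⌊X⌋₊) (fun a x => a * x) ⌊X⌋₊ = tauSumFT X := by
  simp [tauSum, tauSumFT]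

lemma tauSum_floor_eq_tauSumFM (X : ℝ) :
    tauSum {1} (fun _ x => x ^ 2) ⌊X⌋₊ = tauSumFM X := by
  simp [tauSum, tauSumFM]

theorem exists_norm_tauSumFT_sub_le {ε : ℝ} (hε : 0 < ε) : ∃ C : ℝ, ∀ X : ℝ, 3 ≤ X →
    ‖(tauSumFT X : ℂ) - (2 * riemannZeta 2 / riemannZeta 3 * (X : ℂ) ^ 4 * (Real.log X : ℝ)
      + constFT * (X : ℂ) ^ 4)‖ ≤ C * X ^ (4 - 1 / 3 + ε) := by
  obtain ⟨C₀, hC₀⟩ := exists_abs_tauSum_mul_sub_le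
  obtain ⟨C, hC⟩ := exists_abs_floor_sub_le
    (T := fun N => tauSum (Icc 1 N) (fun a x => a * x) N) hC₀ hε
  refine ⟨C, fun X hX => ?_⟩
  have h := hC X hX
  rw [tauSum_floor_eq_tauSumFT, ← Real.norm_eq_abs, ← Complex.norm_real] at h
  have e : ((3 : ℕ) : ℝ) + 2 / 3 + ε = 4 - 1 / 3 + ε := by push_cast; ring
  rw [e] at h
  convert h using 2
  push_cast
  rw [sigM_one, sigL_one, constFT]
  ring

theorem exists_norm_tauSumFM_sub_le {ε : ℝ} (hε : 0 < ε) : ∃ C : ℝ, ∀ X : ℝ, 3 ≤ X →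
    ‖(tauSumFM X : ℂ) - (2 * riemannZeta 3 / riemannZeta 4 * (X : ℂ) ^ 3 * (Real.log X : ℝ)
      + constFM * (X : ℂ) ^ 3)‖ ≤ C * X ^ (3 - 1 / 5 + ε) := by
  obtain ⟨C₀, hC₀⟩ := exists_abs_tauSum_sq_sub_le
  obtain ⟨C, hC⟩ := exists_abs_floor_sub_le
    (T := fun N => tauSum {1} (fun _ x => x ^ 2) N) hC₀ hε
  refine ⟨|C|, fun X hX => ?_⟩
  have h := hC X hX
  rw [tauSum_floor_eq_tauSumFM, ← Real.norm_eq_abs, ← Complex.norm_real] at h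
  -- The exponent `2 + 2/3` obtained is smaller than the required `3 - 1/5`.
  have e : C * X ^ (((2 : ℕ) : ℝ) + 2 / 3 + ε) ≤ |C| * X ^ (3 - 1 / 5 + ε) := by
    have h1 : X ^ (((2 : ℕ) : ℝ) + 2 / 3 + ε) ≤ X ^ (3 - 1 / 5 + ε) :=
      Real.rpow_le_rpow_of_exponent_le (by linarith) (by norm_num)
    have h2 : 0 ≤ X ^ (((2 : ℕ) : ℝ) + 2 / 3 + ε) := Real.rpow_nonneg (by linarith) _
    exact mul_le_mul (le_abs_self C) h1 h2 (abs_nonneg _)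
  refine le_trans (le_of_eq ?_) (h.trans e)
  congr 1
  push_cast
  rw [sigM_two, sigL_two, constFM]
  ring

/-! ### Discriminants and complete exponential sums -/

/-- A unipotent row operation puts the identity into the upper left corner, and the Schur complement
is then minus the identity. -/
lemma det_fromBlocks_zero_one (l : ℕ) :
    (Matrix.fromBlocks 0 1 1 0 : Matrix (Fin l ⊕ Fin l) (Fin l ⊕ Fin l) ℤ).det = (-1) ^ l := by
  have h1 : (Matrix.fromBlocks 1 1 0 1 : Matrix (Fin l ⊕ Fin l) (Fin l ⊕ Fin l) ℤ) *
      Matrix.fromBlocks 0 1 1 0 = Matrix.fromBlocks 1 1 1 0 := by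
    simp [Matrix.fromBlocks_multiply]
  have h2 := congrArg Matrix.det h1
  rw [Matrix.det_mul, Matrix.det_fromBlocks_zero₂₁, Matrix.det_fromBlocks_one₁₁] at h2
  simpa [Matrix.det_neg] using h2

lemma QFT_transpose_add (l : ℕ) : (QFT l).transpose + QFT l = Matrix.fromBlocks 0 1 1 0 := by
  simp [QFT, Matrix.fromBlocks_transpose, Matrix.fromBlocks_add]

theorem firstDisc_QFT (l : ℕ) : firstDisc (QFT l) = (-1) ^ l := by
  rw [firstDisc, QFT_transpose_add, det_fromBlocks_zero_one]

theorem secondDisc_QFT (l : ℕ) : secondDisc (QFT l) = 1 := by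
  have h1 : Fintype.card (Fin l ⊕ Fin l) = l + l := by simp
  have h2 : (l + l) / 2 = l := by omega
  rw [secondDisc, QFT_transpose_add, det_fromBlocks_zero_one, h1, h2, if_pos ⟨l, rfl⟩,
    ← mul_pow]
  norm_num

theorem firstDisc_QFM (l : ℕ) : firstDisc (QFM l) = 2 * (-1) ^ l := by
  have h1 : (QFM l).transpose + QFM l =
      Matrix.fromBlocks (1 + 1) 0 0 (Matrix.fromBlocks 0 1 1 0) := by
    rw [← QFT_transpose_add]
    simp [QFM, Matrix.fromBlocks_transpose, Matrix.fromBlocks_add]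
  rw [firstDisc, h1, Matrix.det_fromBlocks_zero₂₁, det_fromBlocks_zero_one]
  simp [Matrix.det_unique]

theorem secondDisc_QFM (l : ℕ) : secondDisc (QFM l) = 0 := by
  have h1 : Fintype.card (Unit ⊕ (Fin l ⊕ Fin l)) = 2 * l + 1 := by simp; ring
  rw [secondDisc, h1, if_neg]
  rw [Nat.not_even_iff_odd]
  exact ⟨l, rfl⟩

lemma expZ_sum {ι : Type*} (d : ℕ) (s : Finset ι) (f : ι → ℤ) :
    expZ d (∑ i ∈ s, f i) = ∏ i ∈ s, expZ d (f i) := by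
  classical
  induction s using Finset.induction_on with
  | empty => simp [expZ_zero]
  | insert a s ha ih => rw [sum_insert ha, prod_insert ha, expZ_add, ih]

lemma sum_pi_prod {l q : ℕ} (F : Fin l → Fin q → ℂ) :
    ∑ h : Fin l → Fin q, ∏ i, F i (h i) = ∏ i, ∑ k : Fin q, F i k := by
  rw [Finset.prod_univ_sum, Fintype.piFinset_univ]

/-- The form is linear in the second half of the variables; summing over them forces every `u i` to
vanish modulo `q`, because `a` is a unit, and contributes a factor `q` for each. -/
lemma sum_expZ_dot {q : ℕ} (hq : 0 < q) {a : ℕ} (ha : a.Coprime q) (l : ℕ) :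
    ∑ h : Fin l ⊕ Fin l → Fin q,
      expZ q (a * ∑ i, ((h (Sum.inl i) : ℕ) : ℤ) * ((h (Sum.inr i) : ℕ) : ℤ)) = (q : ℂ) ^ l := by
  rw [← (Equiv.sumArrowEquivProdArrow (Fin l) (Fin l) (Fin q)).symm.sum_comp,
    Fintype.sum_prod_type]
  have h1 : ∀ u : Fin l → Fin q, ∑ v : Fin l → Fin q,
      expZ q (a * ∑ i, ((u i : ℕ) : ℤ) * ((v i : ℕ) : ℤ)) =
        ∏ i, if (u i : ℕ) = 0 then (q : ℂ) else 0 := by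
    intro u
    simp_rw [mul_sum, expZ_sum]
    rw [sum_pi_prod (fun i k => expZ q (a * (((u i : ℕ) : ℤ) * ((k : ℕ) : ℤ))))]
    refine prod_congr rfl fun i _ => ?_
    have h2 := sum_expZ hq.ne' (a * ((u i : ℕ) : ℤ))
    rw [sum_range (fun h : ℕ => expZ q (h * (a * ((u i : ℕ) : ℤ))))] at h2
    have h3 : (q : ℤ) ∣ a * ((u i : ℕ) : ℤ) ↔ (u i : ℕ) = 0 := by
      constructor
      · intro h
        have h' : q ∣ a * (u i : ℕ) := by exact_mod_cast h
        exact Nat.eq_zero_of_dvd_of_lt (ha.symm.dvd_of_dvd_mul_left h') (u i).2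
      · intro h; rw [h]; simp
    simp only [h3] at h2
    rw [← h2]
    refine sum_congr rfl fun k _ => ?_
    congr 1; ring
  have h4 : ∀ u : Fin l → Fin q, ∑ v : Fin l → Fin q,
      expZ q (a * ∑ i, ((((Equiv.sumArrowEquivProdArrow (Fin l) (Fin l) (Fin q)).symm (u, v)
        (Sum.inl i) : Fin q) : ℕ) : ℤ) *
          ((((Equiv.sumArrowEquivProdArrow (Fin l) (Fin l) (Fin q)).symm (u, v)
        (Sum.inr i) : Fin q) : ℕ) : ℤ)) = ∏ i, if (u i : ℕ) = 0 then (q : ℂ) else 0 := h1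
  simp_rw [h4]
  rw [sum_pi_prod (fun _ k => if (k : ℕ) = 0 then (q : ℂ) else 0)]
  have h5 : ∑ k : Fin q, (if (k : ℕ) = 0 then (q : ℂ) else 0) = q := by
    rw [← sum_range (fun k : ℕ => if k = 0 then (q : ℂ) else 0)]
    simp [hq]
  rw [h5]; simp

lemma expSum_eq {ι : Type} [Fintype ι] [DecidableEq ι] (Q : Matrix ι ι ℤ) (q : ℕ) :
    expSum Q q = (q : ℂ)⁻¹ * ∑ a ∈ (range q).filter (fun a => Nat.Coprime a q), ∑ h : ι → Fin q,
      expZ q (a * quadForm Q fun i => ((h i : ℕ) : ℤ)) := by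
  rw [expSum]
  congr 1
  refine sum_congr rfl fun a _ => sum_congr rfl fun h _ => ?_
  rw [expZ]
  congr 1
  push_cast
  ring

lemma card_filter_coprime (q : ℕ) :
    #((range q).filter fun a => Nat.Coprime a q) = q.totient := by
  rw [Nat.totient_eq_card_coprime]
  congr 1
  ext a
  simp [Nat.coprime_comm]

theorem expSum_QFT (l q : ℕ) : expSum (QFT l) q = (q : ℂ)⁻¹ * (q.totient * (q : ℂ) ^ l) := by
  rcases Nat.eq_zero_or_pos q with rfl | hq
  · simp [expSum]
  rw [expSum_eq]
  congr 1
  rw [← card_filter_coprime, ← nsmul_eq_mul]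
  refine sum_eq_card_nsmul fun a ha => ?_
  rw [mem_filter] at ha
  simp_rw [quadForm_QFT]
  exact sum_expZ_dot hq ha.2 l

/-- The sum of the quadratic Gauss sums to the modulus `q` over all units. -/
noncomputable def gaussSumTotal (q : ℕ) : ℂ :=
  ∑ a ∈ (range q).filter (fun a => Nat.Coprime a q), ∑ k ∈ range q, expZ q (a * (k : ℤ) ^ 2)

lemma expSum_QFM_eq_gaussSumTotal (l q : ℕ) :
    expSum (QFM l) q = (q : ℂ)⁻¹ * (gaussSumTotal q * (q : ℂ) ^ l) := by
  rcases Nat.eq_zero_or_pos q with rfl | hq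
  · simp [expSum]
  rw [expSum_eq, gaussSumTotal, sum_mul]
  congr 1
  refine sum_congr rfl fun a ha => ?_
  rw [mem_filter] at ha
  rw [← (Equiv.sumArrowEquivProdArrow Unit (Fin l ⊕ Fin l) (Fin q)).symm.sum_comp,
    Fintype.sum_prod_type, ← (Equiv.funUnique Unit (Fin q)).symm.sum_comp,
    sum_range (fun k : ℕ => expZ q (a * (k : ℤ) ^ 2)), sum_mul]
  refine sum_congr rfl fun k _ => ?_
  rw [← sum_expZ_dot hq ha.2 l, mul_sum]
  refine sum_congr rfl fun h _ => ?_
  rw [quadForm_QFM, mul_add, expZ_add]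
  rfl

/-- Every fraction `a / q` in `[0, 1)` has a unique form `b / d` in lowest terms with `d ∣ q`. -/
lemma sum_range_eq_sum_divisors_coprime {M : Type*} [AddCommMonoid M] {q : ℕ} (hq : 0 < q)
    (F : ℕ → M) :
    ∑ a ∈ range q, F a =
      ∑ d ∈ q.divisors, ∑ b ∈ (range d).filter (fun b => Nat.Coprime b d), F (b * (q / d)) := by
  rw [sum_sigma']
  refine (sum_nbij' (fun z : (_ : ℕ) × ℕ => z.2 * (q / z.1))
    (fun a => ⟨q / Nat.gcd a q, a / Nat.gcd a q⟩) ?_ ?_ ?_ ?_ ?_).symm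
  · rintro ⟨d, b⟩ h
    simp only [mem_sigma, Nat.mem_divisors, mem_filter, mem_range] at h ⊢
    obtain ⟨⟨⟨c, rfl⟩, h2⟩, h3, h4⟩ := h
    have hd : 0 < d := by omega
    have hc : 0 < c := Nat.pos_of_mul_pos_left hq
    rw [Nat.mul_div_cancel_left _ hd]
    exact Nat.mul_lt_mul_of_pos_right h3 hc
  · intro a ha
    simp only [mem_sigma, Nat.mem_divisors, mem_filter, mem_range] at ha ⊢
    have hg : 0 < Nat.gcd a q := Nat.gcd_pos_of_pos_right _ hq
    refine ⟨⟨Nat.div_dvd_of_dvd (Nat.gcd_dvd_right a q), hq.ne'⟩, ?_, ?_⟩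
    · exact Nat.div_lt_div_of_lt_of_dvd (Nat.gcd_dvd_right a q) ha
    · exact Nat.coprime_div_gcd_div_gcd hg
  · rintro ⟨d, b⟩ h
    simp only [mem_sigma, Nat.mem_divisors, mem_filter, mem_range] at h
    obtain ⟨⟨⟨c, rfl⟩, h2⟩, h3, h4⟩ := h
    have hd : 0 < d := by omega
    have hc : 0 < c := Nat.pos_of_mul_pos_left hq
    dsimp only
    rw [Nat.mul_div_cancel_left _ hd, Nat.gcd_mul_right, h4.gcd_eq_one, one_mul,
      Nat.mul_div_cancel _ hc, Nat.mul_div_cancel _ hc]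
  · intro a ha
    have hg : 0 < Nat.gcd a q := Nat.gcd_pos_of_pos_right _ hq
    dsimp only
    rw [Nat.div_div_self (Nat.gcd_dvd_right a q) hq.ne',
      Nat.div_mul_cancel (Nat.gcd_dvd_left a q)]
  · intro _ _; rfl

/-- Over all `a` modulo `q`, orthogonality counts the solutions of `k² ≡ 0`. Reducing `a / q` to
lowest terms `b / d` turns each inner sum into `q / d` copies of a Gauss sum modulo `d`. -/
lemma sum_gaussSumTotal_div {q : ℕ} (hq : 0 < q) :
    ∑ d ∈ q.divisors, gaussSumTotal d / d = (#((range q).filter fun k => q ∣ k ^ 2) : ℂ) := by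
  have hq' : (q : ℂ) ≠ 0 := by exact_mod_cast hq.ne'
  have h1 : ∑ a ∈ range q, ∑ k ∈ range q, expZ q (a * (k : ℤ) ^ 2) =
      q * (#((range q).filter fun k => q ∣ k ^ 2) : ℂ) := by
    rw [sum_comm]
    have h2 : ∀ k : ℕ, (q : ℤ) ∣ (k : ℤ) ^ 2 ↔ q ∣ k ^ 2 := fun k => by
      rw [← Nat.cast_pow, Int.natCast_dvd_natCast]
    simp_rw [sum_expZ hq.ne', h2]
    rw [← sum_filter, sum_const, nsmul_eq_mul, mul_comm]
  rw [sum_range_eq_sum_divisors_coprime hq] at h1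
  rw [← mul_right_inj' hq', ← h1, mul_sum]
  refine sum_congr rfl fun d hd => ?_
  obtain ⟨c, rfl⟩ := Nat.dvd_of_mem_divisors hd
  have hd0 : 0 < d := Nat.pos_of_mem_divisors hd
  have hc : 0 < c := Nat.pos_of_mul_pos_left hq
  have hd' : (d : ℂ) ≠ 0 := by exact_mod_cast hd0.ne'
  rw [gaussSumTotal, Nat.mul_div_cancel_left _ hd0]
  push_cast
  rw [show ∀ z : ℂ, (d : ℂ) * c * (z / d) = c * z by intro z; field_simp, mul_sum]
  refine sum_congr rfl fun b _ => ?_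
  have h3 : ∀ k : ℕ, expZ (d * c) ((b * c : ℤ) * (k : ℤ) ^ 2) = expZ d (b * (k : ℤ) ^ 2) := by
    intro k
    rw [mul_comm d c, ← expZ_mul_left hc.ne' d (b * (k : ℤ) ^ 2)]
    congr 1; ring
  simp_rw [h3]
  rw [sum_range_mul_of_periodic (f := fun k : ℕ => expZ d (b * (k : ℤ) ^ 2)), nsmul_eq_mul]
  intro k
  have h4 : (b : ℤ) * ((k + d : ℕ) : ℤ) ^ 2 = b * (k : ℤ) ^ 2 + d * (b * (2 * k + d)) := by
    push_cast; ring
  rw [h4, expZ_add, (expZ_eq_one_iff hd0.ne' _).2 (dvd_mul_right _ _), mul_one]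

/-- The function supported on squares with value `φ(r)` at `r ^ 2`. -/
noncomputable def sqTotient (q : ℕ) : ℂ := if IsSquare q then (q.sqrt.totient : ℂ) else 0

lemma sqTotient_sq (r : ℕ) : sqTotient (r ^ 2) = r.totient := by
  rw [sqTotient, if_pos ⟨r, sq r⟩, Nat.sqrt_eq']

/-- The solutions are the multiples of `κ` below `q = κ v`, hence `v` in number, and `v` is the sum
of `φ(r)` over `r² ∣ q`. -/
lemma sum_sqTotient {q : ℕ} (hq : 0 < q) :
    ∑ d ∈ q.divisors, sqTotient d = (#((range q).filter fun k => q ∣ k ^ 2) : ℂ) := by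
  obtain ⟨κ, v, hκv, hiff, hv⟩ := exists_dvd_sq_iff hq
  have hκ : 0 < κ := Nat.pos_of_mul_pos_right (show 0 < κ * v by rw [hκv]; exact hq)
  have h1 : #((range q).filter fun k => q ∣ k ^ 2) = v := by
    simp_rw [hiff]
    rw [← hκv]
    refine (card_nbij' (t := range v) (fun k => k / κ) (fun m => κ * m) ?_ ?_ ?_ ?_).trans
      (card_range v)
    · intro k hk
      simp only [coe_filter, mem_range, Set.mem_ofPred_eq, coe_range, Set.mem_Iio] at hk ⊢
      exact Nat.div_lt_of_lt_mul hk.1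
    · intro m hm
      simp only [coe_filter, mem_range, Set.mem_ofPred_eq, coe_range, Set.mem_Iio] at hm ⊢
      exact ⟨Nat.mul_lt_mul_of_pos_left hm hκ, dvd_mul_right _ _⟩
    · intro k hk
      simp only [coe_filter, mem_range, Set.mem_ofPred_eq] at hk
      exact Nat.mul_div_cancel' hk.2
    · intro m _
      exact Nat.mul_div_cancel_left _ hκ
  rw [h1, hv]
  push_cast
  rw [← sum_filter]
  simp only [sqTotient]
  rw [← sum_filter]
  symm
  refine sum_nbij' (fun r => r ^ 2) (fun d => d.sqrt) ?_ ?_ ?_ ?_ ?_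
  · intro r hr
    simp only [mem_filter, Nat.mem_divisors] at hr ⊢
    exact ⟨⟨hr.2, hr.1.2⟩, r, sq r⟩
  · intro d hd
    simp only [mem_filter, Nat.mem_divisors] at hd ⊢
    obtain ⟨⟨h2, h3⟩, r, rfl⟩ := hd
    rw [Nat.sqrt_eq, sq]
    exact ⟨⟨(dvd_mul_right r r).trans h2, h3⟩, h2⟩
  · intro r _
    exact Nat.sqrt_eq' r
  · intro d hd
    obtain ⟨r, rfl⟩ := (mem_filter.1 hd).2
    rw [Nat.sqrt_eq, sq]
  · intro r _
    rw [Nat.sqrt_eq']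

/-- Both `gaussSumTotal d / d` and `sqTotient d` have the same divisor sums; the induction removes
the proper divisors, which is Möbius inversion. No individual Gauss sum is evaluated. -/
theorem gaussSumTotal_eq (q : ℕ) : gaussSumTotal q = q * sqTotient q := by
  induction q using Nat.strong_induction_on with
  | _ q ih =>
    rcases Nat.eq_zero_or_pos q with rfl | hq
    · simp [gaussSumTotal]
    have h1 := (sum_gaussSumTotal_div hq).trans (sum_sqTotient hq).symm
    have hq' : (q : ℂ) ≠ 0 := by exact_mod_cast hq.ne'
    rw [← Nat.insert_self_properDivisors hq.ne', sum_insert Nat.self_notMem_properDivisors,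
      sum_insert Nat.self_notMem_properDivisors] at h1
    have h2 : ∑ d ∈ q.properDivisors, gaussSumTotal d / d = ∑ d ∈ q.properDivisors, sqTotient d := by
      refine sum_congr rfl fun d hd => ?_
      have hd0 : (d : ℂ) ≠ 0 := by
        exact_mod_cast (Nat.pos_of_mem_properDivisors hd).ne'
      rw [ih d (Nat.mem_properDivisors.1 hd).2, mul_div_cancel_left₀ _ hd0]
    rw [h2, add_left_inj, div_eq_iff hq'] at h1
    rw [h1, mul_comm]

theorem expSum_QFM {q : ℕ} (hq : 0 < q) (l : ℕ) :
    expSum (QFM l) q = sqTotient q * (q : ℂ) ^ l := by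
  have hq' : (q : ℂ) ≠ 0 := by exact_mod_cast hq.ne'
  rw [expSum_QFM_eq_gaussSumTotal, gaussSumTotal_eq]
  field_simp

theorem expSum_QFT_two_pow {l m : ℕ} (hl : 1 ≤ l) (hm : 1 ≤ m) :
    expSum (QFT l) (2 ^ m) = 2 ^ (m * l - 1) := by
  obtain ⟨k, rfl⟩ := Nat.exists_eq_add_of_le' hm
  obtain ⟨j, rfl⟩ := Nat.exists_eq_add_of_le' hl
  rw [expSum_QFT, Nat.totient_prime_pow_succ Nat.prime_two]
  have h : (k + 1) * (j + 1) = ((k + 1) * (j + 1) - 1) + 1 := by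
    have : 0 < (k + 1) * (j + 1) := by positivity
    omega
  push_cast
  rw [← pow_mul, h, pow_succ _ ((k + 1) * (j + 1) - 1), ← h]
  norm_num
  rw [pow_succ]
  field_simp

theorem expSum_QFM_two_pow (l : ℕ) {m : ℕ} (hm : 1 ≤ m) :
    expSum (QFM l) (2 ^ m) = if Even m then 2 ^ ((2 * l + 1) * m / 2 - 1) else 0 := by
  rw [expSum_QFM (by positivity)]
  split_ifs with h
  · obtain ⟨j, rfl⟩ := h
    obtain ⟨k, rfl⟩ : ∃ k, j = k + 1 := ⟨j - 1, by omega⟩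
    have h1 : (2 * l + 1) * (k + 1 + (k + 1)) / 2 - 1 = k + (k + 1 + (k + 1)) * l := by
      rw [show (2 * l + 1) * (k + 1 + (k + 1)) = 2 * (k + (k + 1 + (k + 1)) * l + 1) by ring]
      omega
    have h2 : 2 ^ (k + 1 + (k + 1)) = (2 ^ (k + 1)) ^ 2 := by rw [← pow_mul]; congr 1; ring
    rw [h1, pow_add _ k, pow_mul _ _ l]
    push_cast
    congr 1
    rw [h2, sqTotient_sq, Nat.totient_prime_pow_succ Nat.prime_two]
    norm_num
  · rw [sqTotient, if_neg, zero_mul]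
    rintro ⟨r, hr⟩
    obtain ⟨k, _, rfl⟩ := (Nat.dvd_prime_pow Nat.prime_two).1 (Dvd.intro r hr.symm)
    rw [← pow_add] at hr
    exact h ⟨k, Nat.pow_right_injective le_rfl hr⟩

/-! ### The local factor at `2` and the L-series -/

lemma norm_two_cpow_lt_one {w : ℂ} (hw : w.re < 0) : ‖(2 : ℂ) ^ w‖ < 1 := by
  have h := Complex.norm_cpow_eq_rpow_re_of_pos (x := 2) (by norm_num) w
  push_cast at h
  rw [h]
  exact Real.rpow_lt_one_of_one_lt_of_neg (by norm_num) hw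

lemma hasSum_pow_succ {x : ℂ} (hx : ‖x‖ < 1) :
    HasSum (fun m : ℕ => x ^ (m + 1) / 2) (x / (2 * (1 - x))) := by
  have h := (hasSum_geometric_of_norm_lt_one hx).mul_left (x / 2)
  have e : (fun m : ℕ => x ^ (m + 1) / 2) = fun m => x / 2 * x ^ m := by
    funext m; ring
  have e2 : x / (2 * (1 - x)) = x / 2 * (1 - x)⁻¹ := by
    rw [← div_div, div_eq_mul_inv (x / 2)]
  rw [e, e2]
  exact h

lemma ne_of_norm_lt_one {x : ℂ} (hx : ‖x‖ < 1) {z : ℂ} (hz : 1 ≤ ‖z‖) : z - x ≠ 0 := by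
  intro h
  rw [sub_eq_zero] at h
  rw [h] at hz
  linarith

/-- Only `p = 2` occurs. With `x = 2^(ℓ-s)` the series is `∑ x^m / 2`, and the factor collapses to
`(1 + x)(2 - x) / (2 - x²)`. -/
theorem badFactor_QFT {l : ℕ} (hl : 1 ≤ l) {s : ℂ} (hs : (l : ℝ) < s.re) :
    badFactor (QFT l) s =
      1 + (2 : ℂ) ^ ((l : ℂ) - s - 1) / (1 - (2 : ℂ) ^ (2 * (l : ℂ) - 1 - 2 * s)) := by
  have hp : (2 * firstDisc (QFT l)).natAbs.primeFactors = {2} := by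
    rw [firstDisc_QFT, Int.natAbs_mul, Int.natAbs_pow]
    simp [Nat.prime_two.primeFactors]
  have hcard : (Fintype.card (Fin l ⊕ Fin l) : ℂ) = 2 * l := by
    simp; ring
  rw [badFactor, hp, prod_singleton, hcard]
  push_cast
  set x : ℂ := (2 : ℂ) ^ ((l : ℂ) - s) with hx
  have hx1 : ‖x‖ < 1 := norm_two_cpow_lt_one (by simpa using hs)
  have two : (2 : ℂ) ≠ 0 := two_ne_zero
  have e1 : (2 : ℂ) ^ (2 * (l : ℂ) - 2 * s) = x ^ 2 := by
    rw [hx, ← Complex.cpow_nat_mul]; congr 1; push_cast; ring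
  have e2 : (2 : ℂ) ^ (2 * (l : ℂ) - 2 * s - 1) = x ^ 2 / 2 := by
    rw [Complex.cpow_sub _ _ two, e1, Complex.cpow_one]
  have e3 : (2 : ℂ) ^ (2 * (l : ℂ) - 1 - 2 * s) = x ^ 2 / 2 := by
    rw [← e2]; congr 1; ring
  have e4 : (2 : ℂ) ^ ((l : ℂ) - s - 1) = x / 2 := by
    rw [Complex.cpow_sub _ _ two, Complex.cpow_one]
  have e5 : ∀ m : ℕ, expSum (QFT l) (2 ^ (m + 1)) / (2 : ℂ) ^ (((m : ℂ) + 1) * s) =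
      x ^ (m + 1) / 2 := by
    intro m
    rw [expSum_QFT_two_pow hl (by omega), hx, ← Complex.cpow_nat_mul, mul_sub,
      Complex.cpow_sub _ _ two]
    have h1 : (2 : ℂ) ^ ((m + 1) * l - 1) = 2 ^ ((m + 1) * l) / 2 := by
      have : (m + 1) * l = (m + 1) * l - 1 + 1 := by
        have : 0 < (m + 1) * l := by positivity
        omega
      rw [eq_div_iff two, ← pow_succ, ← this]
    have h2 : (2 : ℂ) ^ (((m + 1 : ℕ) : ℂ) * l) = 2 ^ ((m + 1) * l) := by
      rw [← Nat.cast_mul, Complex.cpow_natCast]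
    rw [h1, h2]
    push_cast
    ring
  simp_rw [e5]
  rw [(hasSum_pow_succ hx1).tsum_eq, e1, e2, e3, e4]
  have n1 : (1 : ℂ) - x ≠ 0 := ne_of_norm_lt_one hx1 (by simp)
  have n2 : (2 : ℂ) - x ^ 2 ≠ 0 := by
    refine ne_of_norm_lt_one ?_ (by simp)
    rw [norm_pow]
    exact pow_lt_one₀ (norm_nonneg _) hx1 two_ne_zero
  have n3 : (1 : ℂ) - x ^ 2 / 2 ≠ 0 := by
    intro h; apply n2; linear_combination 2 * h
  rw [show (1 : ℂ) - x ^ 2 / 2 = (2 - x ^ 2) / 2 by ring]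
  field_simp
  ring

/-- With `y = 2^(2ℓ+1-2s)` the series over even powers sums to `y / (2 (1 - y))`; adding `1` gives
`(2 - y) / (2 (1 - y))`, which the factor in front cancels. -/
theorem badFactor_QFM {l : ℕ} {s : ℂ} (hs : (l : ℝ) + 1 / 2 < s.re) :
    badFactor (QFM l) s = 1 := by
  have hp : (2 * firstDisc (QFM l)).natAbs.primeFactors = {2} := by
    rw [firstDisc_QFM, ← mul_assoc, Int.natAbs_mul, Int.natAbs_pow]
    norm_num
    rw [show 4 = 2 ^ 2 from rfl, Nat.primeFactors_prime_pow two_ne_zero Nat.prime_two]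
  have hcard : (Fintype.card (Unit ⊕ (Fin l ⊕ Fin l)) : ℂ) = 2 * l + 1 := by
    simp; ring
  rw [badFactor, hp, prod_singleton, hcard]
  push_cast
  set y : ℂ := (2 : ℂ) ^ (2 * (l : ℂ) + 1 - 2 * s) with hy
  have hy1 : ‖y‖ < 1 := norm_two_cpow_lt_one (by simp; linarith)
  have two : (2 : ℂ) ≠ 0 := two_ne_zero
  have e2 : (2 : ℂ) ^ (2 * (l : ℂ) + 1 - 2 * s - 1) = y / 2 := by
    rw [Complex.cpow_sub _ _ two, Complex.cpow_one]
  have h1 : HasSum (fun m : ℕ => expSum (QFM l) (2 ^ (m + 1)) / (2 : ℂ) ^ (((m : ℂ) + 1) * s))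
      (0 + y / (2 * (1 - y))) := by
    -- The index `m` belongs to the power `2^(m+1)`, so the even indices are the vanishing odd
    -- powers of `2`.
    refine HasSum.even_add_odd
      (f := fun m : ℕ => expSum (QFM l) (2 ^ (m + 1)) / (2 : ℂ) ^ (((m : ℂ) + 1) * s)) ?_ ?_
    · have : (fun k : ℕ => expSum (QFM l) (2 ^ (2 * k + 1)) /
          (2 : ℂ) ^ ((((2 * k : ℕ) : ℂ) + 1) * s)) = fun _ => 0 := by
        funext k
        rw [expSum_QFM_two_pow l (by omega), if_neg (by simp), zero_div]
      rw [this]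
      exact hasSum_zero
    · have : (fun k : ℕ => expSum (QFM l) (2 ^ (2 * k + 1 + 1)) /
          (2 : ℂ) ^ ((((2 * k + 1 : ℕ) : ℂ) + 1) * s)) = fun k => y ^ (k + 1) / 2 := by
        funext k
        rw [expSum_QFM_two_pow l (by omega), if_pos ⟨k + 1, by ring⟩]
        have a1 : (2 * l + 1) * (2 * k + 1 + 1) / 2 - 1 = (2 * l + 1) * (k + 1) - 1 := by
          rw [show (2 * l + 1) * (2 * k + 1 + 1) = 2 * ((2 * l + 1) * (k + 1)) by ring]
          omega
        have a2 : (2 : ℂ) ^ ((2 * l + 1) * (k + 1) - 1) = 2 ^ ((2 * l + 1) * (k + 1)) / 2 := by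
          have : (2 * l + 1) * (k + 1) = (2 * l + 1) * (k + 1) - 1 + 1 := by
            have : 0 < (2 * l + 1) * (k + 1) := by positivity
            omega
          rw [eq_div_iff two, ← pow_succ, ← this]
        have a3 : (2 : ℂ) ^ (((k + 1 : ℕ) : ℂ) * (2 * l + 1)) = 2 ^ ((2 * l + 1) * (k + 1)) := by
          rw [← Complex.cpow_natCast]
          congr 1; push_cast; ring
        have a4 : (((2 * k + 1 : ℕ) : ℂ) + 1) * s = ((k + 1 : ℕ) : ℂ) * (2 * s) := by
          push_cast; ring
        rw [a1, a2, a4, hy, ← Complex.cpow_nat_mul, mul_sub, Complex.cpow_sub _ _ two, a3]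
        ring
      rw [this]
      exact hasSum_pow_succ hy1
  rw [h1.tsum_eq, e2]
  have n1 : (1 : ℂ) - y ≠ 0 := ne_of_norm_lt_one hy1 (by simp)
  have n2 : (2 : ℂ) - y ≠ 0 := ne_of_norm_lt_one hy1 (by simp)
  rw [show (1 : ℂ) - y / 2 = (2 - y) / 2 by ring]
  field_simp
  ring

/-- Term by term, `S(q) q^(-s) = φ(q) q^(-(s+1-ℓ))`. -/
theorem LSeriesHasSum_expSum_QFT (l : ℕ) {s : ℂ} (hs : (l : ℝ) + 1 < s.re) :
    LSeriesHasSum (expSum (QFT l)) s (riemannZeta (s - l) / riemannZeta (s + 1 - l)) := by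
  have h := LSeriesHasSum_totient (s := s + 1 - l) (by simp; linarith)
  rw [show s + 1 - l - 1 = s - l by ring] at h
  have e : LSeries.term (expSum (QFT l)) s =
      LSeries.term (fun n => (n.totient : ℂ)) (s + 1 - l) := by
    funext q
    rcases eq_or_ne q 0 with rfl | hq
    · simp
    have hq' : (q : ℂ) ≠ 0 := by exact_mod_cast hq
    rw [LSeries.term_of_ne_zero hq, LSeries.term_of_ne_zero hq, expSum_QFT,
      Complex.cpow_sub _ _ hq', Complex.cpow_add _ _ hq', Complex.cpow_one, Complex.cpow_natCast]
    have : (q : ℂ) ^ s ≠ 0 := by simp [Complex.cpow_eq_zero_iff, hq']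
    field_simp
  rw [LSeriesHasSum, e]
  exact h

/-- The coefficients live on squares, and the term at `r²` is `φ(r) r^(-(2s-2ℓ))`. -/
theorem LSeriesHasSum_expSum_QFM (l : ℕ) {s : ℂ} (hs : (l : ℝ) + 1 < s.re) :
    LSeriesHasSum (expSum (QFM l)) s
      (riemannZeta (2 * s - 2 * l - 1) / riemannZeta (2 * s - 2 * l)) := by
  have h := LSeriesHasSum_totient (s := 2 * s - 2 * l) (by simp; linarith)
  have hinj : Function.Injective fun r : ℕ => r ^ 2 := Nat.pow_left_injective two_ne_zero
  rw [LSeriesHasSum, ← hinj.hasSum_iff]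
  · have e : LSeries.term (expSum (QFM l)) s ∘ (fun r : ℕ => r ^ 2) =
        LSeries.term (fun n => (n.totient : ℂ)) (2 * s - 2 * l) := by
      funext r
      rcases eq_or_ne r 0 with rfl | hr
      · simp
      have hr' : (r : ℂ) ≠ 0 := by exact_mod_cast hr
      have hr2 : r ^ 2 ≠ 0 := pow_ne_zero 2 hr
      dsimp only [Function.comp]
      rw [LSeries.term_of_ne_zero hr2, LSeries.term_of_ne_zero hr,
        expSum_QFM (Nat.pos_of_ne_zero hr2), sqTotient_sq, Complex.cpow_sub _ _ hr']
      have a1 : ((r ^ 2 : ℕ) : ℂ) ^ s = (r : ℂ) ^ (2 * s) := by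
        rw [sq, Nat.cast_mul, Complex.natCast_mul_natCast_cpow, two_mul,
          Complex.cpow_add _ _ hr']
      have a2 : (r : ℂ) ^ (2 * (l : ℂ)) = ((r ^ 2 : ℕ) : ℂ) ^ l := by
        rw [show 2 * (l : ℂ) = ((2 * l : ℕ) : ℂ) by push_cast; ring, Complex.cpow_natCast, pow_mul]
        push_cast; rfl
      rw [a1, a2]
      have : (r : ℂ) ^ (2 * s) ≠ 0 := by simp [Complex.cpow_eq_zero_iff, hr']
      field_simp
    rw [e]
    exact h
  · intro q hq
    rcases eq_or_ne q 0 with rfl | hq0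
    · simp
    rw [LSeries.term_of_ne_zero hq0, expSum_QFM (Nat.pos_of_ne_zero hq0), sqTotient, if_neg]
    · simp
    · rintro ⟨r, rfl⟩
      exact hq ⟨r, sq r⟩

end QuadDivisor

theorem mainTheorem4 :
    (∀ l : ℕ, 1 ≤ l →
      -- discriminants
      (firstDisc (QFT l) = (-1) ^ l ∧ secondDisc (QFT l) = 1 ∧
        firstDisc (QFM l) = 2 * (-1) ^ l ∧ secondDisc (QFM l) = 0) ∧
      -- exponential sums at powers of two
      (∀ m : ℕ, 1 ≤ m → expSum (QFT l) (2 ^ m) = 2 ^ (m * l - 1)) ∧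
      (∀ m : ℕ, 1 ≤ m → expSum (QFM l) (2 ^ m) =
        if Even m then 2 ^ ((2 * l + 1) * m / 2 - 1) else 0) ∧
      -- the local factors and the Dirichlet series
      (∀ s : ℂ, (l : ℝ) + 1 < s.re →
        badFactor (QFT l) s =
          1 + (2 : ℂ) ^ ((l : ℂ) - s - 1) / (1 - (2 : ℂ) ^ (2 * (l : ℂ) - 1 - 2 * s)) ∧
        badFactor (QFM l) s = 1 ∧
        LSeriesHasSum (expSum (QFT l)) s (riemannZeta (s - l) / riemannZeta (s + 1 - l)) ∧
        LSeriesHasSum (expSum (QFM l)) s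
          (riemannZeta (2 * s - 2 * l - 1) / riemannZeta (2 * s - 2 * l)))) ∧
    -- the divisor sum over `x₁ x₂ + x₃ x₄`
    (∀ ε : ℝ, 0 < ε → ∃ C : ℝ, ∀ X : ℝ, 3 ≤ X →
      ‖(tauSumFT X : ℂ) - (2 * riemannZeta 2 / riemannZeta 3 * (X : ℂ) ^ 4 * (Real.log X : ℝ)
          + constFT * (X : ℂ) ^ 4)‖ ≤ C * X ^ (4 - 1 / 3 + ε)) ∧
    -- the divisor sum over `x₀² + x₁ x₂`
    (∀ ε : ℝ, 0 < ε → ∃ C : ℝ, ∀ X : ℝ, 3 ≤ X →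
      ‖(tauSumFM X : ℂ) - (2 * riemannZeta 3 / riemannZeta 4 * (X : ℂ) ^ 3 * (Real.log X : ℝ)
          + constFM * (X : ℂ) ^ 3)‖ ≤ C * X ^ (3 - 1 / 5 + ε)) := by
  refine ⟨fun l hl => ⟨⟨QuadDivisor.firstDisc_QFT l, QuadDivisor.secondDisc_QFT l,
    QuadDivisor.firstDisc_QFM l, QuadDivisor.secondDisc_QFM l⟩,
    fun m hm => QuadDivisor.expSum_QFT_two_pow hl hm,
    fun m hm => QuadDivisor.expSum_QFM_two_pow l hm,
    fun s hs => ⟨QuadDivisor.badFactor_QFT hl (by linarith),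
      QuadDivisor.badFactor_QFM (by linarith), QuadDivisor.LSeriesHasSum_expSum_QFT l hs,
      QuadDivisor.LSeriesHasSum_expSum_QFM l hs⟩⟩,
    fun ε hε => QuadDivisor.exists_norm_tauSumFT_sub_le hε,
    fun ε hε => QuadDivisor.exists_norm_tauSumFM_sub_le hε⟩
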